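/- **Setting.** Let $\mathcal M$ be a connected, Hausdorff, second countable smooth 3-manifold with a smooth Riemannian metric $\mathring g$ which is complete. Suppose there are a compact set $K\subset\mathcal M$ and pairwise disjoint open sets $M_1,\dots,M_N$ with $\mathcal M\setminus K=\bigcup_i M_i$, and diffeomorphisms $\phi_i:M_i\to\mathbb R^3\setminus\overline{B_1(0)}$ such that $\mathring g$ is the pull-back under $\phi_i$ of the Euclidean metric on each $M_i$. Let $r\ge 1$ be a smooth function on $\mathcal M$ with $r=|\phi_i|$ where $|\phi_i|$ is sufficiently large. For sections of a bundle of (vector-valued) tensors or tensor densities, $W^{k,2}_\delta$ denotes the completion of the smooth compactly supported sections in the norm $$\|u\|_{k,2,\delta}=\sum_{j=0}^k\Big(\int_{\mathcal M}|\mathring\nabla^j u|^2\,r^{-2(\delta-j)-3}\,d\mathring\mu\Big)^{1/2},$$ where $\mathring\nabla$, $|\cdot|$ and $d\mathring\mu$ are the Levi-Civita connection, pointwise norm and volume measure of $\mathring g$. Let $\mathfrak g$ be a finite-dimensional real Lie algebra (for instance that of a compact Lie group) with an inner product $\gamma$, centre $\mathfrak z$, and $\mathfrak k=\mathfrak z^{\perp}$.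 The phase space $\mathcal F=\mathcal G^+\times\mathcal K\times\mathcal A\times\mathcal E$ consists of the tuples $(g,A,\pi,\varepsilon)$ where * $g$ is an everywhere positive definite symmetric covariant 2-tensor with $g-\mathring g\in W^{2,2}_{-1/2}$ (positivity refers to the continuous representative); * $\pi\in W^{1,2}_{-3/2}$ is a symmetric contravariant 2-tensor density; * $A=A_{\mathfrak z}+A_{\mathfrak k}$ with $A_{\mathfrak z}\in W^{2,2}_{-1/2}(T^*\mathcal M\otimes\mathfrak z)$ and $A_{\mathfrak k}\in W^{2,2}_{-3/2}(T^*\mathcal M\otimes\mathfrak k)$; * $\varepsilon\in W^{1,2}_{-3/2}$ is a $\mathfrak g^*$-valued vector density; viewed, via $g\mapsto g-\mathring g$, as a subset of the corresponding product of Banach spaces. Let $\Sigma\subset\mathcal M$ be a closed (compact, without boundary) smoothly embedded surface such that $\mathcal M\setminus\Sigma$ consists of two connected components, one of which, $\mathcal M_0$, contains exactly one of the ends, and such that each point of $\Sigma$ is adherent to both components (which is automatic if $\Sigma$ is connected). Let $dS$ be the surface element of $\Sigma$ for the unit normal pointing into $\mathcal M_0$. For $(g,A,\pi,\varepsilon)\in\mathcal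 F$ and a vector field $\chi$ on $\mathcal M$ set $$16\pi\,Q_{\Sigma\,a}=-\oint_\Sigma\varepsilon^j_a\,dS_j,\qquad 16\pi\,\tilde J_\chi=-\oint_\Sigma\big(2\chi^i\pi^j_i-\varepsilon^j_aA^a_i\chi^i\big)\,dS_j,\qquad \pi^j_i=g_{ik}\pi^{kj},$$ where the values of $g,A,\pi,\varepsilon$ on $\Sigma$ are the traces in $L^2(\Sigma)$, that is, the $L^2(\Sigma)$ limits of the restrictions to $\Sigma$ of smooth compactly supported sections (added to $\mathring g$ in the case of $g$) that converge in the Sobolev norms. **Lemma.** Let $\chi$ be a vector field on $\mathcal M$ whose restriction to $\Sigma$ is measurable and satisfies $\|\chi\|_{L^\infty(\Sigma)}<\infty$. Then for every element of $\mathcal F$ these traces exist and are unique and both surface integrals converge absolutely, and the maps $Q_\Sigma:\mathcal F\to\mathfrak g^*$ and $\tilde J_\chi:\mathcal F\to\mathbb R$ are smooth ($C^\infty$). -/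

import Mathlib

open MeasureTheory Topology Set
open scoped Manifold ContDiff ENNReal Matrix

noncomputable section

/-! ### Tensor fields in components

`TangentSpace 𝓘(ℝ, E3) x` is the model space `E3`, a tangent vector at `x` being identified with
its components in the preferred chart `chartAt E3 x`.  Accordingly a tensor at `x` is given by its
components in that chart. -/

abbrev E2 : Type := EuclideanSpace ℝ (Fin 2)

abbrev E3 : Type := EuclideanSpace ℝ (Fin 3)

/-- Multi-indices of a tensor with `r` upper and `s` lower indices. -/
abbrev TIdx (r s : ℕ) : Type := (Fin r → Fin 3) × (Fin s → Fin 3)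

/-- Component arrays of `V`-valued tensors with `r` upper and `s` lower indices. -/
abbrev TComp (r s : ℕ) (V : Type*) : Type _ := TIdx r s → V

/-- The `i`-th standard basis vector. -/
def stdVec {n : ℕ} (i : Fin n) : EuclideanSpace ℝ (Fin n) := EuclideanSpace.single i 1

/-- The components of a tangent vector at `x` in the preferred chart at `x`. -/
def tangentToE3 {M : Type*} [TopologicalSpace M] [ChartedSpace E3 M] {x : M}
    (v : TangentSpace 𝓘(ℝ, E3) x) : E3 := v

section Tensor

variable {V : Type*} [NormedAddCommGroup V] [NormedSpace ℝ V] {r s : ℕ}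

/-- Components of a `V`-valued tensor density with `r` upper and `s` lower indices and weight `w`
(weight `1` means: with values in the densities, that is, in `Λ³` when the manifold is oriented)
in the frame whose vectors are the columns of `L`, from its components `T` in the old frame. -/
def changeFrame (w : ℕ) (L : Matrix (Fin 3) (Fin 3) ℝ) (T : TComp r s V) : TComp r s V :=
  fun K => |L.det| ^ w • ∑ K' : TIdx r s,
    ((∏ a, L⁻¹ (K.1 a) (K'.1 a)) * ∏ b, L (K'.2 b) (K.2 b)) • T K'

variable {M : Type*} [TopologicalSpace M] [ChartedSpace E3 M] [IsManifold 𝓘(ℝ, E3) ∞ M]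

/-- The coordinate frame of the chart at `p`, at the point `y`: the columns are the coordinate
vectors, expressed in the preferred chart at `y`. -/
def chartFrame (p y : M) : Matrix (Fin 3) (Fin 3) ℝ :=
  haveI : IsManifold 𝓘(ℝ, E3) 1 M := IsManifold.of_le (n := ∞) (by norm_cast)
  Matrix.of fun i j => (tangentCoordChange 𝓘(ℝ, E3) p y y (stdVec j)) i

/-- The components of the tensor field `T` in the chart at `p`, as functions of the coordinates. -/
def chartComp (w : ℕ) (T : M → TComp r s V) (p : M) (z : E3) : TComp r s V :=
  changeFrame w (chartFrame p ((chartAt E3 p).symm z)) (T ((chartAt E3 p).symm z))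

def IsSmoothTensor (w : ℕ) (T : M → TComp r s V) : Prop :=
  ∀ p : M, ContDiffOn ℝ ∞ (chartComp w T p) (chartAt E3 p).target

def IsContTensor (w : ℕ) (T : M → TComp r s V) : Prop :=
  ∀ p : M, ContinuousOn (chartComp w T p) (chartAt E3 p).target

end Tensor

/-! ### Riemannian geometry of the background metric -/

/-- Smooth Riemannian metrics on `M`. -/
abbrev RMetric (M : Type*) [TopologicalSpace M] [ChartedSpace E3 M]
    [IsManifold 𝓘(ℝ, E3) ∞ M] : Type _ :=
  Bundle.ContMDiffRiemannianMetric 𝓘(ℝ, E3) ∞ E3 (TangentSpace 𝓘(ℝ, E3) : M → Type _)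

section Riemannian

variable {M : Type*} [TopologicalSpace M] [ChartedSpace E3 M] [IsManifold 𝓘(ℝ, E3) ∞ M]

/-- The components of the metric at `x` in the preferred chart at `x`. -/
def gram (g : RMetric M) (x : M) : Matrix (Fin 3) (Fin 3) ℝ :=
  Matrix.of fun i j => g.inner x (stdVec i : E3) (stdVec j : E3)

/-- The metric as a field of components. -/
def metricField (g : RMetric M) : M → TComp 0 2 ℝ := fun x K => gram g x (K.2 0) (K.2 1)

/-- The components of the metric in the chart at `p`, as functions of the coordinates. -/
def chartGram (g : RMetric M) (p : M) (z : E3) : Matrix (Fin 3) (Fin 3) ℝ :=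
  (chartFrame p ((chartAt E3 p).symm z))ᵀ * gram g ((chartAt E3 p).symm z) *
    chartFrame p ((chartAt E3 p).symm z)

/-- `christoffel g x k i j` is the Christoffel symbol `Γ^k_{ij}` of the Levi-Civita connection,
at `x`, in the preferred chart at `x`. -/
def christoffel (g : RMetric M) (x : M) (k i j : Fin 3) : ℝ :=
  let d : Fin 3 → Fin 3 → Fin 3 → ℝ := fun a b c =>
    fderiv ℝ (fun z => chartGram g x z b c) (chartAt E3 x x) (stdVec a)
  (1 / 2) * ∑ l, (gram g x)⁻¹ k l * (d i l j + d j l i - d l i j)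

/-- The Riemannian volume measure: the measure which in each chart is `√(det g) dx`. -/
def riemVolume [MeasurableSpace M] (g : RMetric M) : Measure M :=
  ⨆ p : M, ((volume.restrict (chartAt E3 p).target).withDensity
    (fun z => ENNReal.ofReal (√(chartGram g p z).det))).map (chartAt E3 p).symm

/-- The Riemannian distance. -/
def riemDist (g : RMetric M) (x y : M) : ℝ≥0∞ :=
  letI : ∀ x : M, ENorm (TangentSpace 𝓘(ℝ, E3) x) :=
    fun x => ⟨fun v => ENNReal.ofReal (√(g.inner x v v))⟩
  Manifold.riemannianEDist 𝓘(ℝ, E3) x y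

/-- Completeness of the Riemannian manifold `(M, g)`: Cauchy sequences converge. -/
def IsCompleteMetric (g : RMetric M) : Prop :=
  ∀ u : ℕ → M, (∀ ε : ℝ≥0∞, 0 < ε → ∃ N, ∀ m ≥ N, ∀ n ≥ N, riemDist g (u m) (u n) < ε) →
    ∃ x, Filter.Tendsto u Filter.atTop (𝓝 x)

variable {V : Type*} [NormedAddCommGroup V] [NormedSpace ℝ V] {r s : ℕ}

/-- The Levi-Civita covariant derivative of a tensor density of weight `w`;
the differentiation index is the first lower index of the result. -/
def covDeriv (g : RMetric M) (w : ℕ) (T : M → TComp r s V) : M → TComp r (s + 1) V :=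
  fun x K =>
    let I : Fin r → Fin 3 := K.1
    let k : Fin 3 := K.2 0
    let J : Fin s → Fin 3 := Fin.tail K.2
    fderiv ℝ (fun z => chartComp w T x z (I, J)) (chartAt E3 x x) (stdVec k)
      + ∑ a, ∑ l, christoffel g x (I a) k l • T x (Function.update I a l, J)
      - ∑ b, ∑ l, christoffel g x l k (J b) • T x (I, Function.update J b l)
      - ((w : ℝ) * ∑ l, christoffel g x l k l) • T x (I, J)

/-- Iterated covariant derivatives. -/
def iterCov (g : RMetric M) (w : ℕ) : (j : ℕ) → (M → TComp r s V) → (M → TComp r (s + j) V)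
  | 0, T => T
  | j + 1, T => covDeriv g w (iterCov g w j T)

end Riemannian

/-! ### A measurable orthonormal frame

Sections are integrated through their components in a Borel orthonormal frame: in such a frame the
pointwise norm of a tensor is the Euclidean norm of its components. -/

section Frame

variable {M : Type*} [TopologicalSpace M] [ChartedSpace E3 M]

theorem exists_chartCenters [SecondCountableTopology M] [Nonempty M] :
    ∃ c : ℕ → M, ∀ x, ∃ n, x ∈ (chartAt E3 (c n)).source := by
  obtain ⟨s, hs, hU⟩ := TopologicalSpace.countable_cover_nhds
    (fun x : M => (chartAt E3 x).open_source.mem_nhds (mem_chart_source E3 x))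
  have hne : s.Nonempty := by
    rw [nonempty_iff_ne_empty]
    rintro rfl
    obtain ⟨x⟩ := (inferInstance : Nonempty M)
    have : x ∈ (univ : Set M) := mem_univ x
    simp [← hU] at this
  obtain ⟨c, rfl⟩ := hs.exists_eq_range hne
  refine ⟨c, fun x => ?_⟩
  have : x ∈ (univ : Set M) := mem_univ x
  simpa [← hU] using this

variable [SecondCountableTopology M] [Nonempty M]

/-- Centres of a countable family of charts covering `M`. -/
def chartCenter (M : Type*) [TopologicalSpace M] [ChartedSpace E3 M]
    [SecondCountableTopology M] [Nonempty M] : ℕ → M :=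
  Classical.choose (exists_chartCenters (M := M))

open scoped Classical in
/-- The first member of the family whose chart contains `x`. -/
def chartPick (x : M) : M :=
  chartCenter M (Nat.find (Classical.choose_spec (exists_chartCenters (M := M)) x))

variable [IsManifold 𝓘(ℝ, E3) ∞ M]

/-- The orthonormal frame at `x` obtained by the Gram-Schmidt process from the coordinate frame of
the chart at `chartPick x`; vectors are expressed in the preferred chart at `x`. -/
def orthoVec (g : RMetric M) (x : M) : Fin 3 → E3 :=
  let b : E3 → E3 → ℝ := fun v v' => g.inner x v v'
  let c : Fin 3 → E3 := fun j => WithLp.toLp 2 fun i => chartFrame (chartPick x) x i j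
  let unit : E3 → E3 := fun v => (√(b v v))⁻¹ • v
  let f₀ := unit (c 0)
  let f₁ := unit (c 1 - b (c 1) f₀ • f₀)
  let f₂ := unit (c 2 - b (c 2) f₀ • f₀ - b (c 2) f₁ • f₁)
  ![f₀, f₁, f₂]

/-- The matrix whose columns are the vectors of the orthonormal frame. -/
def orthoFrame (g : RMetric M) (x : M) : Matrix (Fin 3) (Fin 3) ℝ :=
  Matrix.of fun i j => orthoVec g x j i

/-- The components of a tensor at `x` in the orthonormal frame. -/
def frameComp {V : Type*} [NormedAddCommGroup V] [NormedSpace ℝ V] {r s : ℕ}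
    (g : RMetric M) (w : ℕ) (x : M) (T : TComp r s V) : PiLp 2 (fun _ : TIdx r s => V) :=
  WithLp.toLp 2 (changeFrame w (orthoFrame g x) T)

/-- The components of a tangent vector at `x` in the orthonormal frame. -/
def frameVec (g : RMetric M) (x : M) (v : TangentSpace 𝓘(ℝ, E3) x) : E3 :=
  WithLp.toLp 2 ((orthoFrame g x)⁻¹.mulVec fun i => tangentToE3 v i)

end Frame

/-! ### Asymptotically flat manifolds and weighted Sobolev spaces -/

/-- A complete asymptotically flat background: a compact core, finitely many ends diffeomorphic to
the exterior of the closed unit ball, a complete smooth metric which is Euclidean on the ends,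
and a smooth radius function. -/
structure AFBackground (M : Type*) [TopologicalSpace M] [ChartedSpace E3 M]
    [IsManifold 𝓘(ℝ, E3) ∞ M] where
  metric : RMetric M
  complete : IsCompleteMetric metric
  core : Set M
  isCompact_core : IsCompact core
  numEnds : ℕ
  /-- The diffeomorphism of the end `(endChart i).source` onto the exterior region. -/
  endChart : Fin numEnds → OpenPartialHomeomorph M E3
  endChart_mem : ∀ i, endChart i ∈ IsManifold.maximalAtlas 𝓘(ℝ, E3) ∞ M
  endChart_target : ∀ i, (endChart i).target = (Metric.closedBall 0 1)ᶜ
  disjoint_ends : Pairwise fun i j => Disjoint (endChart i).source (endChart j).source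
  compl_core : coreᶜ = ⋃ i, (endChart i).source
  metric_end : ∀ i, ∀ x ∈ (endChart i).source, ∀ v v' : TangentSpace 𝓘(ℝ, E3) x,
    metric.inner x v v' = inner ℝ
      (tangentToE3 (mfderiv 𝓘(ℝ, E3) 𝓘(ℝ, E3) (endChart i) x v))
      (tangentToE3 (mfderiv 𝓘(ℝ, E3) 𝓘(ℝ, E3) (endChart i) x v'))
  radius : M → ℝ
  radius_smooth : ContMDiff 𝓘(ℝ, E3) 𝓘(ℝ, ℝ) ∞ radius
  one_le_radius : ∀ x, 1 ≤ radius x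
  radius_end : ∃ R₀ : ℝ, ∀ i, ∀ x ∈ (endChart i).source, R₀ < ‖endChart i x‖ →
    radius x = ‖endChart i x‖

section Sobolev

variable {M : Type*} [TopologicalSpace M] [ChartedSpace E3 M] [IsManifold 𝓘(ℝ, E3) ∞ M]
  [SecondCountableTopology M] [Nonempty M] [MeasurableSpace M] [BorelSpace M]

/-- The measure `r ^ (-2 δ - 3) dμ`, so that the norm of `L²_δ` is that of `L²` of this measure. -/
def weightedVolume (X : AFBackground M) (δ : ℝ) : Measure M :=
  (riemVolume X.metric).withDensity fun x => ENNReal.ofReal (X.radius x ^ (-2 * δ - 3))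

/-- `L²_δ × L²_{δ-1} × ⋯ × L²_{δ-k}`, with the sum of the norms; the `j`-th factor consists of the
`V`-valued tensor densities with `r` upper and `s + j` lower indices. -/
abbrev JetSpace (X : AFBackground M) (r s : ℕ) (V : Type*) [NormedAddCommGroup V]
    [NormedSpace ℝ V] (k : ℕ) (δ : ℝ) : Type _ :=
  PiLp 1 fun j : Fin (k + 1) =>
    Lp (PiLp 2 fun _ : TIdx r (s + (j : ℕ)) => V) 2 (weightedVolume X (δ - ((j : ℕ) : ℝ)))

variable {V : Type*} [NormedAddCommGroup V] [NormedSpace ℝ V] {r s : ℕ}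

/-- Smooth compactly supported sections of the bundle of tensor densities of weight `w` whose
component arrays lie in `P`. -/
structure IsTestSection (w : ℕ) (P : Submodule ℝ (TComp r s V)) (u : M → TComp r s V) : Prop where
  smooth : IsSmoothTensor w u
  compactSupport : ∃ K : Set M, IsCompact K ∧ ∀ x, x ∉ K → u x = 0
  mem : ∀ x, u x ∈ P

/-- `f = (u, ∇u, …, ∇ᵏu)`. -/
def IsJet (X : AFBackground M) (w : ℕ) {k : ℕ} {δ : ℝ} (u : M → TComp r s V)
    (f : JetSpace X r s V k δ) : Prop :=
  ∀ j : Fin (k + 1), ∀ᵐ x ∂(weightedVolume X (δ - ((j : ℕ) : ℝ))),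
    f j x = frameComp X.metric w x (iterCov X.metric w (j : ℕ) u x)

/-- The weighted Sobolev space `W^{k,2}_δ` of sections: the completion of the smooth compactly
supported sections `u` for the norm `∑_{j ≤ k} ‖∇ʲ u‖_{2, δ - j}`, realised as the closure of
the space of jets `(u, ∇u, …, ∇ᵏu)`. -/
def sobolev (X : AFBackground M) (w : ℕ) (P : Submodule ℝ (TComp r s V)) (k : ℕ) (δ : ℝ) :
    Submodule ℝ (JetSpace X r s V k δ) :=
  (Submodule.span ℝ
    {f : JetSpace X r s V k δ | ∃ u, IsTestSection w P u ∧ IsJet X w u f}).topologicalClosure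

instance (X : AFBackground M) (w : ℕ) (P : Submodule ℝ (TComp r s V)) (k : ℕ) (δ : ℝ) :
    NormedAddCommGroup (sobolev X w P k δ) := Submodule.normedAddCommGroup _

instance (X : AFBackground M) (w : ℕ) (P : Submodule ℝ (TComp r s V)) (k : ℕ) (δ : ℝ) :
    NormedSpace ℝ (sobolev X w P k δ) := Submodule.normedSpace _

end Sobolev

/-! ### The surface, traces and surface integrals -/

/-- A closed surface, embedded by `ι`, which separates `M` into two connected components
`inside` and `outside`, such that `outside` contains the end number `theEnd` and no other end.
Every point of the surface is adherent to both components (this is automatic if the surface is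
connected). -/
structure SeparatingSurface {M : Type*} [TopologicalSpace M] [ChartedSpace E3 M]
    [IsManifold 𝓘(ℝ, E3) ∞ M] (X : AFBackground M) (S : Type*) [TopologicalSpace S]
    [ChartedSpace E2 S] where
  ι : S → M
  embedding : Manifold.IsSmoothEmbedding 𝓘(ℝ, E2) 𝓘(ℝ, E3) ∞ ι
  outside : Set M
  inside : Set M
  isOpen_outside : IsOpen outside
  isOpen_inside : IsOpen inside
  isConnected_outside : IsConnected outside
  isConnected_inside : IsConnected inside
  disjoint : Disjoint outside inside
  compl_range : (range ι)ᶜ = outside ∪ inside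
  subset_closure_outside : range ι ⊆ closure outside
  subset_closure_inside : range ι ⊆ closure inside
  theEnd : Fin X.numEnds
  end_outside : ∃ R : ℝ, ∀ x ∈ (X.endChart theEnd).source, R < ‖X.endChart theEnd x‖ →
    x ∈ outside
  end_inside : ∀ i, i ≠ theEnd → ∃ R : ℝ, ∀ x ∈ (X.endChart i).source,
    R < ‖X.endChart i x‖ → x ∈ inside

section Surface

variable {M : Type*} [TopologicalSpace M] [ChartedSpace E3 M] [IsManifold 𝓘(ℝ, E3) ∞ M]
  {S : Type*} [TopologicalSpace S] [ChartedSpace E2 S] {X : AFBackground M}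

/-- The components of the induced metric in the chart of the surface at `q`. -/
def surfaceGram (Y : SeparatingSurface X S) (q : S) (z : E2) : Matrix (Fin 2) (Fin 2) ℝ :=
  Matrix.of fun a b => X.metric.inner (Y.ι ((chartAt E2 q).symm z))
    (mfderiv 𝓘(ℝ, E2) 𝓘(ℝ, E3) (Y.ι ∘ (chartAt E2 q).symm) z (stdVec a : E2) : E3)
    (mfderiv 𝓘(ℝ, E2) 𝓘(ℝ, E3) (Y.ι ∘ (chartAt E2 q).symm) z (stdVec b : E2) : E3)

/-- The area measure of the induced metric. -/
def surfaceArea [MeasurableSpace S] (Y : SeparatingSurface X S) : Measure S :=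
  ⨆ q : S, ((volume.restrict (chartAt E2 q).target).withDensity
    (fun z => ENNReal.ofReal (√(surfaceGram Y q z).det))).map (chartAt E2 q).symm

/-- `v` is a unit normal at `ι y` which points into `outside`. -/
structure IsOutwardUnitNormal (Y : SeparatingSurface X S) (y : S)
    (v : TangentSpace 𝓘(ℝ, E3) (Y.ι y)) : Prop where
  unit : X.metric.inner (Y.ι y) v v = 1
  normal : ∀ t : TangentSpace 𝓘(ℝ, E2) y,
    X.metric.inner (Y.ι y) v (mfderiv 𝓘(ℝ, E2) 𝓘(ℝ, E3) Y.ι y t) = 0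
  points : ∀ᶠ t : ℝ in 𝓝[>] 0,
    (chartAt E3 (Y.ι y)).symm (chartAt E3 (Y.ι y) (Y.ι y) + t • tangentToE3 v) ∈ Y.outside

open scoped Classical in
/-- The unit normal pointing into `outside`, that is, towards infinity in the chosen end. -/
def unitNormal (Y : SeparatingSurface X S) (y : S) : TangentSpace 𝓘(ℝ, E3) (Y.ι y) :=
  if h : ∃ v, IsOutwardUnitNormal Y y v then h.choose else (0 : E3)

variable [SecondCountableTopology M] [Nonempty M] [MeasurableSpace M] [BorelSpace M]
  [MeasurableSpace S]
  {V : Type*} [NormedAddCommGroup V] [NormedSpace ℝ V] {r s : ℕ}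

/-- Square integrable sections along the surface, in components in the orthonormal frame. -/
abbrev SurfaceL2 (Y : SeparatingSurface X S) (r s : ℕ) (V : Type*) [NormedAddCommGroup V] :
    Type _ :=
  Lp (PiLp 2 fun _ : TIdx r s => V) 2 (surfaceArea Y)

/-- `t` is the trace of `f` on the surface: there are smooth compactly supported sections
converging to `f` in the Sobolev norm, whose restrictions converge to `t` in `L²`. -/
def IsTrace (Y : SeparatingSurface X S) {w : ℕ} {P : Submodule ℝ (TComp r s V)} {k : ℕ} {δ : ℝ}
    (f : sobolev X w P k δ) (t : SurfaceL2 Y r s V) : Prop :=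
  ((f : JetSpace X r s V k δ), t) ∈ closure
    {p : JetSpace X r s V k δ × SurfaceL2 Y r s V | ∃ u : M → TComp r s V,
      IsTestSection w P u ∧ IsJet X w u p.1 ∧
      ∀ᵐ y ∂(surfaceArea Y), p.2 y = frameComp X.metric w (Y.ι y) (u (Y.ι y))}

open scoped Classical in
/-- The trace on the surface. -/
def surfaceTrace (Y : SeparatingSurface X S) {w : ℕ} {P : Submodule ℝ (TComp r s V)} {k : ℕ}
    {δ : ℝ} (f : sobolev X w P k δ) : SurfaceL2 Y r s V :=
  if h : ∃ t, IsTrace Y f t then h.choose else 0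

end Surface

/-! ### The gauge algebra -/

/-- The Lie algebra `𝔤` as the inner product space given by `γ`. -/
def GaugeAlg {𝔤 : Type*} [LieRing 𝔤] [LieAlgebra ℝ 𝔤] (_γ : InnerProductSpace.Core ℝ 𝔤) :
    Type _ := 𝔤

section Gauge

variable {𝔤 : Type*} [LieRing 𝔤] [LieAlgebra ℝ 𝔤] (γ : InnerProductSpace.Core ℝ 𝔤)

instance : NormedAddCommGroup (GaugeAlg γ) := γ.toNormedAddCommGroup

instance : InnerProductSpace ℝ (GaugeAlg γ) := InnerProductSpace.ofCore γ.toCore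

/-- The centre of `𝔤`. -/
def gaugeCenter : Submodule ℝ (GaugeAlg γ) :=
  show Submodule ℝ 𝔤 from (LieAlgebra.center ℝ 𝔤).toSubmodule

/-- The `γ`-orthogonal complement of the centre. -/
def gaugeCompl : Submodule ℝ (GaugeAlg γ) := (gaugeCenter γ)ᗮ

end Gauge

/-! ### The phase space -/

/-- Symmetric covariant 2-tensors. -/
def symmCov : Submodule ℝ (TComp 0 2 ℝ) where
  carrier := {T | ∀ I i j, T (I, ![i, j]) = T (I, ![j, i])}
  add_mem' := fun ha hb I i j => by simp [ha I i j, hb I i j]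
  zero_mem' := fun _ _ _ => rfl
  smul_mem' := fun c _ ha I i j => by simp [ha I i j]

/-- Symmetric contravariant 2-tensors. -/
def symmContra : Submodule ℝ (TComp 2 0 ℝ) where
  carrier := {T | ∀ I i j, T (![i, j], I) = T (![j, i], I)}
  add_mem' := fun ha hb I i j => by simp [ha I i j, hb I i j]
  zero_mem' := fun _ _ _ => rfl
  smul_mem' := fun c _ ha I i j => by simp [ha I i j]

section PhaseSpace

variable {M : Type*} [TopologicalSpace M] [ChartedSpace E3 M] [IsManifold 𝓘(ℝ, E3) ∞ M]
  [SecondCountableTopology M] [Nonempty M] [MeasurableSpace M] [BorelSpace M]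
  {𝔤 : Type*} [LieRing 𝔤] [LieAlgebra ℝ 𝔤]

/-- The space `W^{2,2}_{-1/2}(S₂)` of metric perturbations `h = g - g̊`. -/
abbrev MetricPert (X : AFBackground M) : Type _ := sobolev X 0 symmCov 2 (-1 / 2)

/-- The space `W^{1,2}_{-3/2}(S² ⊗ Λ³)` of gravitational momenta. -/
abbrev Momenta (X : AFBackground M) : Type _ := sobolev X 1 symmContra 1 (-3 / 2)

/-- The space `W^{2,2}_{-1/2}(T* ⊗ 𝔷) ⊕ W^{2,2}_{-3/2}(T* ⊗ 𝔨)` of gauge fields. -/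
abbrev GaugeFields (X : AFBackground M) (γ : InnerProductSpace.Core ℝ 𝔤) : Type _ :=
  sobolev X 0 (⊤ : Submodule ℝ (TComp 0 1 (gaugeCenter γ))) 2 (-1 / 2) ×
    sobolev X 0 (⊤ : Submodule ℝ (TComp 0 1 (gaugeCompl γ))) 2 (-3 / 2)

/-- The space `W^{1,2}_{-3/2}(T ⊗ 𝔤* ⊗ Λ³)` of gauge momenta. -/
abbrev GaugeMomenta (X : AFBackground M) (γ : InnerProductSpace.Core ℝ 𝔤) : Type _ :=
  sobolev X 1 (⊤ : Submodule ℝ (TComp 1 0 (StrongDual ℝ (GaugeAlg γ)))) 1 (-3 / 2)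

/-- The Banach space of quadruples `(h, π, A, ε)`; it parametrises by `g = g̊ + h` the affine space
in which the phase space lies. -/
abbrev PhaseAmbient (X : AFBackground M) (γ : InnerProductSpace.Core ℝ 𝔤) : Type _ :=
  MetricPert X × Momenta X × GaugeFields X γ × GaugeMomenta X γ

/-- `g̊ + h` is a Riemannian metric: its continuous representative is everywhere positive
definite. -/
def IsMetricPerturbation (X : AFBackground M) (h : MetricPert X) : Prop :=
  ∃ g : M → TComp 0 2 ℝ, IsContTensor 0 g ∧
    (∀ᵐ x ∂(riemVolume X.metric),
      (h : JetSpace X 0 2 ℝ 2 (-1 / 2)) 0 x =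
        frameComp X.metric 0 x
          (iterCov X.metric 0 ((0 : Fin (2 + 1)) : ℕ) (g - metricField X.metric) x)) ∧
    ∀ x, (Matrix.of fun i j => g x (![], ![i, j])).PosDef

/-- The phase space `F = G⁺ × K × A × E`. -/
def phaseSpace (X : AFBackground M) (γ : InnerProductSpace.Core ℝ 𝔤) :
    Set (PhaseAmbient X γ) :=
  {Z | IsMetricPerturbation X Z.1}

variable {X : AFBackground M} {S : Type*} [TopologicalSpace S] [ChartedSpace E2 S]
  [MeasurableSpace S] (Y : SeparatingSurface X S) (γ : InnerProductSpace.Core ℝ 𝔤)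

/-- The integrand of `∮ ε^j_a dS_j` with respect to the area measure.  In the orthonormal frame the
components of the background metric and its determinant are those of the identity matrix. -/
def chargeDensity (Z : PhaseAmbient X γ) (y : S) : StrongDual ℝ (GaugeAlg γ) :=
  ∑ j : Fin 3, frameVec X.metric (Y.ι y) (unitNormal Y y) j •
    surfaceTrace Y Z.2.2.2 y (![j], ![])

/-- The surface charge: `16 π Q_a = - ∮ ε^j_a dS_j`. -/
def surfaceCharge (Z : PhaseAmbient X γ) : StrongDual ℝ (GaugeAlg γ) :=
  -(1 / (16 * Real.pi)) • ∫ y, chargeDensity Y γ Z y ∂(surfaceArea Y)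

/-- The integrand of `∮ (2 χ^i π^j_i - ε^j_a A^a_i χ^i) dS_j` with respect to the area measure,
where `π^j_i = g_{ik} π^{kj}` and `g = g̊ + h`. -/
def angularDensity (χ : ∀ x : M, TangentSpace 𝓘(ℝ, E3) x) (Z : PhaseAmbient X γ) (y : S) : ℝ :=
  let n : E3 := frameVec X.metric (Y.ι y) (unitNormal Y y)
  let c : E3 := frameVec X.metric (Y.ι y) (χ (Y.ι y))
  let g : Fin 3 → Fin 3 → ℝ := fun i k =>
    (if i = k then 1 else 0) + surfaceTrace Y Z.1 y (![], ![i, k])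
  let π' : Fin 3 → Fin 3 → ℝ := fun k j => surfaceTrace Y Z.2.1 y (![k, j], ![])
  let A : Fin 3 → GaugeAlg γ := fun i =>
    (surfaceTrace Y Z.2.2.1.1 y (![], ![i]) : GaugeAlg γ) +
      (surfaceTrace Y Z.2.2.1.2 y (![], ![i]) : GaugeAlg γ)
  let ε : Fin 3 → StrongDual ℝ (GaugeAlg γ) := fun j => surfaceTrace Y Z.2.2.2 y (![j], ![])
  ∑ j, (2 * (∑ i, c i * ∑ k, g i k * π' k j) - ∑ i, ε j (A i) * c i) * n j

/-- The generalised angular momentum: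
`16 π J = - ∮ (2 χ^i π^j_i - ε^j_a A^a_i χ^i) dS_j`. -/
def angularMomentum (χ : ∀ x : M, TangentSpace 𝓘(ℝ, E3) x) (Z : PhaseAmbient X γ) : ℝ :=
  -(1 / (16 * Real.pi)) * ∫ y, angularDensity Y γ χ Z y ∂(surfaceArea Y)

end PhaseSpace

end

/-!
The surface charge is linear and the angular momentum is a polynomial of degree two in the traces of
`h = g - g̊`, `π`, `A` and `ε`, with bounded measurable coefficients, namely the components of the
unit normal and of `χ`. So everything follows from the existence of the trace as a bounded linear
operator `traceOp` from `W^{k,2}_δ`, `k ≥ 1`, to `L²` of the surface. Given this, Hölder's inequality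
turns the integrals into sums of bounded linear and bilinear forms (`SmoothIntegrand.bilin`,
`SmoothIntegrand.lin`), which are smooth on the whole ambient Banach space and hence on the phase
space. In particular the positivity of `g` plays no role, and neither do the weights, since the
surface is compact.

The trace operator rests on the trace inequality `exists_lintegral_surface_le` for smooth sections
`u`: the `L²` norm of `u` on the surface is bounded by the `L²` norms of `u` and `∇u`. It is local.
Near each of its points the surface is the slice `t = 0` of smooth coordinates `(z, t)`
(`exists_sliceChart`); there the one-dimensional Sobolev inequality `enorm_sq_le_lintegral` on the
lines `z = const`, integrated over `z`, bounds the values at `t = 0` by the coordinate components of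
`u` and their first derivatives (`SliceChart.exists_lintegral_slice_le`). It remains to compare, on
compact sets, coordinate quantities with geometric ones:
* Lebesgue measure with the weighted volume (`exists_lintegral_chart_le`) and with the area measure
  (`SliceChart.exists_area_le`);
* components in the chart with components in the orthonormal frame (`exists_chartOrtho_bound`);
* partial with covariant derivatives. As the covariant derivative at `x` is defined in the preferred
  chart at `x`, which varies with `x`, this requires that the usual formula is tensorial
  (`chartCov_trans`, `chartComp_covDeriv`), by the transformation law of the Christoffel symbols.

The inequality passes to the closure of the graph of the restriction map, so that traces are unique,
and completeness of `L²` provides their existence.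

For the coefficients one has to see that the unit normal, a choice made point by point, is measurable.
Since every point of the surface is adherent to both components of the complement, in slice
coordinates the outside is one of the sides `t > 0` and `t < 0` (`SliceChart.exists_side`), and the
outward unit normal is, up to that sign, the normalised gradient of `t`
(`SliceChart.exists_frameVec_unitNormal`).
-/

noncomputable section

/-! ### The action of changes of frame on components -/

section ChangeFrame

variable {V : Type*} [NormedAddCommGroup V] [NormedSpace ℝ V] {r s : ℕ}

/-- The matrix entries of `changeFrame w L`. -/
def frameCoeff (w : ℕ) (L : Matrix (Fin 3) (Fin 3) ℝ) (K K' : TIdx r s) : ℝ :=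
  |L.det| ^ w * ((∏ a, L⁻¹ (K.1 a) (K'.1 a)) * ∏ b, L (K'.2 b) (K.2 b))

theorem changeFrame_apply (w : ℕ) (L : Matrix (Fin 3) (Fin 3) ℝ) (T : TComp r s V)
    (K : TIdx r s) : changeFrame w L T K = ∑ K', frameCoeff w L K K' • T K' := by
  simp only [changeFrame, frameCoeff, Finset.smul_sum, smul_smul]

theorem changeFrame_add (w : ℕ) (L : Matrix (Fin 3) (Fin 3) ℝ) (T T' : TComp r s V) :
    changeFrame w L (T + T') = changeFrame w L T + changeFrame w L T' := by
  ext K; simp [changeFrame_apply, Finset.sum_add_distrib]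

theorem changeFrame_smul (w : ℕ) (L : Matrix (Fin 3) (Fin 3) ℝ) (c : ℝ) (T : TComp r s V) :
    changeFrame w L (c • T) = c • changeFrame w L T := by
  ext K; simp [changeFrame_apply, Finset.smul_sum, smul_smul, mul_comm]

theorem prod_delta {n : ℕ} (x y : Fin n → Fin 3) :
    (∏ a, (1 : Matrix (Fin 3) (Fin 3) ℝ) (x a) (y a)) = if x = y then 1 else 0 := by
  split_ifs with h
  · subst h; simp
  · obtain ⟨a, ha⟩ := Function.ne_iff.1 h
    exact Finset.prod_eq_zero (Finset.mem_univ a) (by simp [ha])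

theorem frameCoeff_one (w : ℕ) (K K' : TIdx r s) :
    frameCoeff w 1 K K' = if K = K' then 1 else 0 := by
  obtain ⟨I, J⟩ := K
  obtain ⟨I', J'⟩ := K'
  simp only [frameCoeff, inv_one, Matrix.det_one, abs_one, one_pow, Prod.mk.injEq,
    prod_delta, mul_ite, mul_one, mul_zero]
  by_cases h1 : I = I' <;> by_cases h2 : J = J'
  · simp [h1, h2]
  · simp [h2, Ne.symm h2]
  · simp [h1]
  · simp [h1]

theorem changeFrame_one (w : ℕ) (T : TComp r s V) : changeFrame w 1 T = T := by
  ext K; simp [changeFrame_apply, frameCoeff_one]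

theorem frameCoeff_mul (w : ℕ) (L₁ L₂ : Matrix (Fin 3) (Fin 3) ℝ) (K K'' : TIdx r s) :
    frameCoeff w (L₁ * L₂) K K'' = ∑ K', frameCoeff w L₂ K K' * frameCoeff w L₁ K' K'' := by
  have h1 : (∏ a, (L₁ * L₂)⁻¹ (K.1 a) (K''.1 a)) =
      ∑ I : Fin r → Fin 3, ∏ a, (L₂⁻¹ (K.1 a) (I a) * L₁⁻¹ (I a) (K''.1 a)) := by
    simp only [Matrix.mul_inv_rev, Matrix.mul_apply]
    rw [Finset.prod_univ_sum, Fintype.piFinset_univ]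
  have h2 : (∏ b, (L₁ * L₂) (K''.2 b) (K.2 b)) =
      ∑ J : Fin s → Fin 3, ∏ b, (L₁ (K''.2 b) (J b) * L₂ (J b) (K.2 b)) := by
    simp only [Matrix.mul_apply]
    rw [Finset.prod_univ_sum, Fintype.piFinset_univ]
  rw [Fintype.sum_prod_type]
  simp only [frameCoeff]
  rw [h1, h2, Finset.sum_mul_sum, Finset.mul_sum]
  refine Finset.sum_congr rfl fun I _ => ?_
  rw [Finset.mul_sum]
  refine Finset.sum_congr rfl fun J _ => ?_
  simp only [Finset.prod_mul_distrib, Matrix.det_mul, abs_mul, mul_pow]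
  ring

/-- Components transform by a right action of the matrices. -/
theorem changeFrame_mul (w : ℕ) (L₁ L₂ : Matrix (Fin 3) (Fin 3) ℝ) (T : TComp r s V) :
    changeFrame w (L₁ * L₂) T = changeFrame w L₂ (changeFrame w L₁ T) := by
  ext K
  simp only [changeFrame_apply, frameCoeff_mul, Finset.sum_smul, Finset.smul_sum, smul_smul]
  exact Finset.sum_comm

theorem changeFrame_inv_cancel (w : ℕ) {L : Matrix (Fin 3) (Fin 3) ℝ} (hL : L.det ≠ 0)
    (T : TComp r s V) : changeFrame w L⁻¹ (changeFrame w L T) = T := by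
  rw [← changeFrame_mul, Matrix.mul_nonsing_inv _ (isUnit_iff_ne_zero.2 hL), changeFrame_one]

/-- The infinitesimal action of a matrix `A` on tensor densities: the derivative of
`changeFrame w L` at `L = 1` in the direction `A`. -/
def frameDeriv (w : ℕ) (A : Matrix (Fin 3) (Fin 3) ℝ) (T : TComp r s V) : TComp r s V :=
  fun K => ((w : ℝ) * A.trace) • T K
    - ∑ a, ∑ l, A (K.1 a) l • T (Function.update K.1 a l, K.2)
    + ∑ b, ∑ l, A l (K.2 b) • T (K.1, Function.update K.2 b l)

/-- A sum over multi-indices which agree with `I` except possibly in the slot `a`. -/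
theorem sum_delta_update {n : ℕ} (I : Fin n → Fin 3) (a : Fin n) (c : Fin 3 → ℝ)
    (F : (Fin n → Fin 3) → V) :
    ∑ x : Fin n → Fin 3, ((∏ j ∈ Finset.univ.erase a,
      (1 : Matrix (Fin 3) (Fin 3) ℝ) (I j) (x j)) * c (x a)) • F x =
      ∑ l, c l • F (Function.update I a l) := by
  have h : ∀ x : Fin n → Fin 3, (∏ j ∈ Finset.univ.erase a,
      (1 : Matrix (Fin 3) (Fin 3) ℝ) (I j) (x j)) =
      if x = Function.update I a (x a) then 1 else 0 := by
    intro x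
    split_ifs with hx
    · refine Finset.prod_eq_one fun j hj => ?_
      rw [hx, Function.update_of_ne (Finset.ne_of_mem_erase hj), Matrix.one_apply_eq]
    · obtain ⟨j, hj⟩ := Function.ne_iff.1 hx
      have hja : j ≠ a := by rintro rfl; simp at hj
      rw [Function.update_of_ne hja] at hj
      exact Finset.prod_eq_zero (Finset.mem_erase.2 ⟨hja, Finset.mem_univ j⟩)
        (by simp [Ne.symm hj])
  have h2 : ∀ l, c l • F (Function.update I a l) =
      ∑ x, if x = Function.update I a l then c l • F x else 0 := by
    intro l; simp
  simp only [h2]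
  rw [Finset.sum_comm]
  refine Finset.sum_congr rfl fun x _ => ?_
  rw [h]
  rw [Finset.sum_eq_single (x a)]
  · split_ifs <;> simp
  · intro l _ hl
    rw [if_neg]
    intro hx
    apply hl
    rw [hx]; simp
  · simp

theorem hasDerivAt_det_at_one {N : ℝ → Matrix (Fin 3) (Fin 3) ℝ} {A : Matrix (Fin 3) (Fin 3) ℝ}
    {t₀ : ℝ} (h1 : N t₀ = 1) (hN : ∀ i j, HasDerivAt (fun t => N t i j) (A i j) t₀) :
    HasDerivAt (fun t => (N t).det) A.trace t₀ := by
  simp only [Matrix.det_fin_three, Matrix.trace_fin_three]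
  refine HasDerivAt.congr_deriv (((((((hN 0 0).mul (hN 1 1)).mul (hN 2 2)).sub
    (((hN 0 0).mul (hN 1 2)).mul (hN 2 1))).sub (((hN 0 1).mul (hN 1 0)).mul (hN 2 2))).add
    (((hN 0 1).mul (hN 1 2)).mul (hN 2 0))).add (((hN 0 2).mul (hN 1 0)).mul (hN 2 1)) |>.sub
    (((hN 0 2).mul (hN 1 1)).mul (hN 2 0))) ?_
  simp [h1]

theorem differentiableAt_inv_entry {N : ℝ → Matrix (Fin 3) (Fin 3) ℝ} {t₀ : ℝ}
    (h1 : (N t₀).det ≠ 0) (hN : ∀ i j, DifferentiableAt ℝ (fun t => N t i j) t₀) (i j : Fin 3) :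
    DifferentiableAt ℝ (fun t => (N t)⁻¹ i j) t₀ := by
  have hdet : DifferentiableAt ℝ (fun t => (N t).det) t₀ := by
    simp only [Matrix.det_fin_three]
    fun_prop
  have hadj : DifferentiableAt ℝ (fun t => (N t).adjugate i j) t₀ := by
    simp only [Matrix.adjugate_fin_three]
    fin_cases i <;> fin_cases j <;> simp <;> try fun_prop
  simp only [Matrix.inv_def, Matrix.smul_apply, smul_eq_mul, Ring.inverse_eq_inv']
  exact (hdet.inv h1).mul hadj

theorem hasDerivAt_inv_entry {N : ℝ → Matrix (Fin 3) (Fin 3) ℝ} {A : Matrix (Fin 3) (Fin 3) ℝ}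
    {t₀ : ℝ} (h1 : N t₀ = 1) (hN : ∀ i j, HasDerivAt (fun t => N t i j) (A i j) t₀)
    (i j : Fin 3) : HasDerivAt (fun t => (N t)⁻¹ i j) (-A i j) t₀ := by
  have hd : (N t₀).det ≠ 0 := by simp [h1]
  have hdiff := fun i j => (differentiableAt_inv_entry hd (fun i j => (hN i j).differentiableAt)
    i j).hasDerivAt
  have hne : ∀ᶠ t in 𝓝 t₀, (N t).det ≠ 0 :=
    (hasDerivAt_det_at_one h1 hN).continuousAt.eventually_ne hd
  have hconst : (fun t => ∑ m, N t i m * (N t)⁻¹ m j) =ᶠ[𝓝 t₀]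
      fun _ => (1 : Matrix (Fin 3) (Fin 3) ℝ) i j := by
    filter_upwards [hne] with t ht
    rw [← Matrix.mul_apply, Matrix.mul_nonsing_inv _ (isUnit_iff_ne_zero.2 ht)]
  have hsum := HasDerivAt.fun_sum (u := Finset.univ)
    fun (m : Fin 3) _ => (hN i m).mul (hdiff m j)
  have h0 := (hconst.hasDerivAt_iff.2 (hasDerivAt_const t₀ _)).unique hsum
  have : deriv (fun t => (N t)⁻¹ i j) t₀ = -A i j := by
    simp only [h1, inv_one, Finset.sum_add_distrib, Matrix.one_apply, mul_ite, mul_one, mul_zero,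
      ite_mul, one_mul, zero_mul, Finset.sum_ite_eq, Finset.sum_ite_eq', Finset.mem_univ,
      if_true] at h0
    linarith
  exact this ▸ hdiff i j

theorem hasDerivAt_abs_det_pow {N : ℝ → Matrix (Fin 3) (Fin 3) ℝ}
    {A : Matrix (Fin 3) (Fin 3) ℝ} {t₀ : ℝ} (h1 : N t₀ = 1)
    (hN : ∀ i j, HasDerivAt (fun t => N t i j) (A i j) t₀) (w : ℕ) :
    HasDerivAt (fun t => |(N t).det| ^ w) (w * A.trace) t₀ := by
  have hd := hasDerivAt_det_at_one h1 hN
  have h := hd.pow w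
  simp only [h1, Matrix.det_one, one_pow, mul_one] at h
  refine h.congr_of_eventuallyEq ?_
  have hpos : ∀ᶠ t in 𝓝 t₀, 0 < (N t).det :=
    hd.continuousAt.eventually_const_lt (by simp [h1])
  filter_upwards [hpos] with t ht
  rw [abs_of_pos ht]
  rfl

/-- The derivative of the action along a curve of matrices through `1`. -/
theorem hasDerivAt_changeFrame {N : ℝ → Matrix (Fin 3) (Fin 3) ℝ}
    {A : Matrix (Fin 3) (Fin 3) ℝ} {t₀ : ℝ} (h1 : N t₀ = 1)
    (hN : ∀ i j, HasDerivAt (fun t => N t i j) (A i j) t₀) (w : ℕ) {T : ℝ → TComp r s V}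
    {T' : TComp r s V} (hT : ∀ K, HasDerivAt (fun t => T t K) (T' K) t₀) (K : TIdx r s) :
    HasDerivAt (fun t => changeFrame w (N t) (T t) K) (frameDeriv w A (T t₀) K + T' K) t₀ := by
  obtain ⟨I, J⟩ := K
  have hup := fun K' : TIdx r s => HasDerivAt.fun_finsetProd (u := Finset.univ)
    (fun (a : Fin r) _ => hasDerivAt_inv_entry h1 hN (I a) (K'.1 a))
  have hlow := fun K' : TIdx r s => HasDerivAt.fun_finsetProd (u := Finset.univ)
    (fun (b : Fin s) _ => hN (K'.2 b) (J b))
  have hdet := hasDerivAt_abs_det_pow h1 hN w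
  have hc := fun K' : TIdx r s => (hdet.fun_mul ((hup K').fun_mul (hlow K'))).fun_smul (hT K')
  have hsum := HasDerivAt.fun_sum (u := Finset.univ) fun K' _ => hc K'
  simp only [changeFrame_apply, frameCoeff]
  refine hsum.congr_deriv ?_
  simp only [h1, inv_one, Matrix.det_one, abs_one, one_pow, one_mul, prod_delta]
  have hterm : ∀ I' : Fin r → Fin 3, ∀ J' : Fin s → Fin 3,
      (((if I = I' then (1 : ℝ) else 0) * if J' = J then 1 else 0) • T' (I', J')
        + (w * A.trace * ((if I = I' then (1 : ℝ) else 0) * if J' = J then 1 else 0)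
          + ((∑ a, (∏ j ∈ Finset.univ.erase a, (1 : Matrix (Fin 3) (Fin 3) ℝ) (I j) (I' j)) •
              -A (I a) (I' a)) * (if J' = J then 1 else 0)
            + (if I = I' then (1 : ℝ) else 0) *
              ∑ b, (∏ j ∈ Finset.univ.erase b, (1 : Matrix (Fin 3) (Fin 3) ℝ) (J' j) (J j)) •
                A (J' b) (J b))) • T t₀ (I', J'))
      = (if J' = J then if I = I' then T' (I', J') + ((w : ℝ) * A.trace) • T t₀ (I', J') else 0
          else 0)
        + (if J' = J then ∑ a, ((∏ j ∈ Finset.univ.erase a,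
            (1 : Matrix (Fin 3) (Fin 3) ℝ) (I j) (I' j)) * -A (I a) (I' a)) • T t₀ (I', J') else 0)
        + (if I = I' then ∑ b, ((∏ j ∈ Finset.univ.erase b,
            (1 : Matrix (Fin 3) (Fin 3) ℝ) (J j) (J' j)) * A (J' b) (J b)) • T t₀ (I', J')
            else 0) := by
    intro I' J'
    have hsymm : ∀ j, (1 : Matrix (Fin 3) (Fin 3) ℝ) (J' j) (J j) =
        (1 : Matrix (Fin 3) (Fin 3) ℝ) (J j) (J' j) := fun j => by
      simp [Matrix.one_apply, eq_comm]
    simp only [hsymm, smul_eq_mul]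
    split_ifs <;> simp [add_smul, Finset.sum_smul, add_assoc]
  rw [Fintype.sum_prod_type]
  rw [Finset.sum_congr rfl fun I' _ => Finset.sum_congr rfl fun J' _ => hterm I' J']
  simp only [Finset.sum_add_distrib, Finset.sum_ite_eq, Finset.sum_ite_eq',
    Finset.mem_univ, if_true]
  have e1 : (∑ x : Fin r → Fin 3, ∑ a, ((∏ j ∈ Finset.univ.erase a,
      (1 : Matrix (Fin 3) (Fin 3) ℝ) (I j) (x j)) * -A (I a) (x a)) • T t₀ (x, J)) =
      -∑ a, ∑ l, A (I a) l • T t₀ (Function.update I a l, J) := by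
    rw [Finset.sum_comm, ← Finset.sum_neg_distrib]
    refine Finset.sum_congr rfl fun a _ => ?_
    exact (sum_delta_update I a (fun l => -A (I a) l) fun x => T t₀ (x, J)).trans (by simp)
  have e2 : (∑ x : Fin r → Fin 3, ∑ y : Fin s → Fin 3,
      if I = x then ∑ b, ((∏ j ∈ Finset.univ.erase b,
        (1 : Matrix (Fin 3) (Fin 3) ℝ) (J j) (y j)) * A (y b) (J b)) • T t₀ (x, y) else 0) =
      ∑ b, ∑ l, A l (J b) • T t₀ (I, Function.update J b l) := by
    rw [Finset.sum_comm]
    simp only [Finset.sum_ite_eq, Finset.mem_univ, if_true]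
    rw [Finset.sum_comm]
    refine Finset.sum_congr rfl fun b _ => ?_
    exact sum_delta_update J b (fun l => A l (J b)) fun y => T t₀ (I, y)
  rw [e1, e2]
  simp only [frameDeriv]
  abel

/-- Functoriality of the action on the level of derivatives: differentiate
`(1 + t A) L = L (1 + t L⁻¹ A L)` at `t = 0`. -/
theorem frameDeriv_conj (w : ℕ) {L : Matrix (Fin 3) (Fin 3) ℝ} (hL : L.det ≠ 0)
    (A : Matrix (Fin 3) (Fin 3) ℝ) (T : TComp r s V) :
    changeFrame w L (frameDeriv w A T) = frameDeriv w (L⁻¹ * A * L) (changeFrame w L T) := by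
  have hu : IsUnit L.det := isUnit_iff_ne_zero.2 hL
  ext K
  have hA : ∀ i j, HasDerivAt (fun t : ℝ => (1 + t • A) i j) (A i j) 0 := fun i j => by
    simpa using ((hasDerivAt_id (0 : ℝ)).mul_const (A i j)).const_add
      ((1 : Matrix (Fin 3) (Fin 3) ℝ) i j)
  have hB : ∀ i j, HasDerivAt (fun t : ℝ => (1 + t • (L⁻¹ * A * L)) i j)
      ((L⁻¹ * A * L) i j) 0 := fun i j => by
    simpa using ((hasDerivAt_id (0 : ℝ)).mul_const ((L⁻¹ * A * L) i j)).const_add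
      ((1 : Matrix (Fin 3) (Fin 3) ℝ) i j)
  have h1 : HasDerivAt (fun t : ℝ => changeFrame w L (changeFrame w (1 + t • A) T) K)
      (changeFrame w L (frameDeriv w A T) K) 0 := by
    simp only [changeFrame_apply w L]
    refine HasDerivAt.fun_sum fun K' _ => ?_
    have := hasDerivAt_changeFrame (by simp) hA w (T := fun _ => T) (T' := 0)
      (fun K => hasDerivAt_const _ _) K'
    simpa using this.fun_const_smul (frameCoeff w L K K')
  have h2 := hasDerivAt_changeFrame (t₀ := 0) (by simp) hB w (T := fun _ => changeFrame w L T)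
    (T' := 0) (fun K => hasDerivAt_const _ _) K
  have h3 : (fun t : ℝ => changeFrame w L (changeFrame w (1 + t • A) T) K) =
      fun t : ℝ => changeFrame w (1 + t • (L⁻¹ * A * L)) (changeFrame w L T) K := by
    ext t
    rw [← changeFrame_mul, ← changeFrame_mul]
    congr 1
    rw [Matrix.mul_add, Matrix.add_mul, Matrix.mul_one, Matrix.one_mul, Matrix.mul_smul,
      Matrix.smul_mul, Matrix.mul_assoc, Matrix.mul_nonsing_inv_cancel_left _ _ hu]
  rw [h3] at h1
  simpa using h1.unique h2

theorem frameDeriv_add (w : ℕ) (A B : Matrix (Fin 3) (Fin 3) ℝ) (T : TComp r s V) :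
    frameDeriv w (A + B) T = frameDeriv w A T + frameDeriv w B T := by
  ext K
  simp only [frameDeriv, Matrix.trace_add, mul_add, add_smul, Matrix.add_apply, Pi.add_apply,
    Finset.sum_add_distrib]
  abel

theorem frameDeriv_sum (w : ℕ) (c : Fin 3 → ℝ) (A : Fin 3 → Matrix (Fin 3) (Fin 3) ℝ)
    (T : TComp r s V) :
    frameDeriv w (∑ m, c m • A m) T = ∑ m, c m • frameDeriv w (A m) T := by
  ext K
  simp only [frameDeriv, Fin.sum_univ_three, Matrix.trace_add, Matrix.trace_smul, Matrix.add_apply,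
    Matrix.smul_apply, smul_eq_mul, mul_add, add_smul, Finset.sum_add_distrib, Pi.add_apply,
    Pi.smul_apply, smul_sub, smul_add, Finset.smul_sum, smul_smul]
  simp only [mul_left_comm]
  abel

theorem frameDeriv_add_right (w : ℕ) (A : Matrix (Fin 3) (Fin 3) ℝ) (T T' : TComp r s V) :
    frameDeriv w A (T + T') = frameDeriv w A T + frameDeriv w A T' := by
  ext K
  simp only [frameDeriv, Pi.add_apply, smul_add, Finset.sum_add_distrib]
  abel

theorem frameDeriv_smul_right (w : ℕ) (A : Matrix (Fin 3) (Fin 3) ℝ) (c : ℝ) (T : TComp r s V) :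
    frameDeriv w A (c • T) = c • frameDeriv w A T := by
  ext K
  simp only [frameDeriv, Pi.smul_apply, smul_sub, smul_add, Finset.smul_sum, smul_smul,
    mul_comm c]

/-! ### Bounds on changes of frame -/

theorem abs_det_le_of_entries {L : Matrix (Fin 3) (Fin 3) ℝ} {B : ℝ}
    (hL : ∀ i j, |L i j| ≤ B) : |L.det| ≤ 6 * B ^ 3 := by
  have := Matrix.det_le (A := L) (abv := AbsoluteValue.abs) (x := B) hL
  simpa [Nat.factorial] using this

/-- A common bound for the coefficients of `changeFrame w L` when the entries of `L` and of its
inverse are bounded by `B`. -/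
def frameBound (r s w : ℕ) (B : ℝ) : ℝ := (6 * B ^ 3) ^ w * (B ^ r * B ^ s)

theorem abs_frameCoeff_le {w : ℕ} {L : Matrix (Fin 3) (Fin 3) ℝ} {B : ℝ}
    (hL : ∀ i j, |L i j| ≤ B) (hL' : ∀ i j, |L⁻¹ i j| ≤ B) (K K' : TIdx r s) :
    |frameCoeff w L K K'| ≤ frameBound r s w B := by
  have hB : 0 ≤ B := (abs_nonneg _).trans (hL 0 0)
  have h1 : |∏ a, L⁻¹ (K.1 a) (K'.1 a)| ≤ B ^ r := by
    rw [Finset.abs_prod]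
    exact (Finset.prod_le_prod (fun _ _ => abs_nonneg _) fun a _ => hL' (K.1 a) (K'.1 a)).trans
      (by simp)
  have h2 : |∏ b, L (K'.2 b) (K.2 b)| ≤ B ^ s := by
    rw [Finset.abs_prod]
    exact (Finset.prod_le_prod (fun _ _ => abs_nonneg _) fun a _ => hL (K'.2 a) (K.2 a)).trans
      (by simp)
  rw [frameCoeff, abs_mul, abs_mul, abs_pow, abs_abs, frameBound]
  have h3 := abs_det_le_of_entries hL
  gcongr

theorem norm_changeFrame_le {w : ℕ} {L : Matrix (Fin 3) (Fin 3) ℝ} {B : ℝ}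
    (hL : ∀ i j, |L i j| ≤ B) (hL' : ∀ i j, |L⁻¹ i j| ≤ B) (T : TComp r s V) (K : TIdx r s) :
    ‖changeFrame w L T K‖ ≤ frameBound r s w B * ∑ K', ‖T K'‖ := by
  rw [changeFrame_apply, Finset.mul_sum]
  refine (norm_sum_le _ _).trans (Finset.sum_le_sum fun K' _ => ?_)
  rw [norm_smul, Real.norm_eq_abs]
  gcongr
  exact abs_frameCoeff_le hL hL' K K'

theorem norm_frameDeriv_le {w : ℕ} {A : Matrix (Fin 3) (Fin 3) ℝ} {B : ℝ}
    (hA : ∀ i j, |A i j| ≤ B) (T : TComp r s V) (K : TIdx r s) :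
    ‖frameDeriv w A T K‖ ≤ (3 * w + 3 * r + 3 * s) * B * ∑ K', ‖T K'‖ := by
  have hT : ∀ K', ‖T K'‖ ≤ ∑ K', ‖T K'‖ := fun K' =>
    Finset.single_le_sum (f := fun K' => ‖T K'‖) (fun _ _ => norm_nonneg _) (Finset.mem_univ K')
  set N := ∑ K', ‖T K'‖
  have hB : 0 ≤ B := (abs_nonneg _).trans (hA 0 0)
  have hterm : ∀ i j K', ‖A i j • T K'‖ ≤ B * N := fun i j K' => by
    rw [norm_smul, Real.norm_eq_abs]
    exact mul_le_mul (hA i j) (hT K') (norm_nonneg _) hB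
  have htr : |A.trace| ≤ 3 * B := by
    rw [Matrix.trace_fin_three]
    have := abs_add_three (A 0 0) (A 1 1) (A 2 2)
    linarith [hA 0 0, hA 1 1, hA 2 2]
  have h1 : ‖((w : ℝ) * A.trace) • T K‖ ≤ (3 * w) * B * N := by
    rw [norm_smul, Real.norm_eq_abs, abs_mul, Nat.abs_cast]
    calc (w : ℝ) * |A.trace| * ‖T K‖ ≤ w * (3 * B) * N := by gcongr; exact hT K
      _ = _ := by ring
  have h2 : ‖∑ a, ∑ l, A (K.1 a) l • T (Function.update K.1 a l, K.2)‖ ≤ (3 * r) * B * N := by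
    refine (norm_sum_le_of_le _ fun a _ => norm_sum_le_of_le _ fun l _ =>
      hterm (K.1 a) l (Function.update K.1 a l, K.2)).trans (le_of_eq ?_)
    simp; ring
  have h3 : ‖∑ b, ∑ l, A l (K.2 b) • T (K.1, Function.update K.2 b l)‖ ≤ (3 * s) * B * N := by
    refine (norm_sum_le_of_le _ fun b _ => norm_sum_le_of_le _ fun l _ =>
      hterm l (K.2 b) (K.1, Function.update K.2 b l)).trans (le_of_eq ?_)
    simp; ring
  calc _ ≤ (3 * w) * B * N + (3 * r) * B * N + (3 * s) * B * N :=
        (norm_add_le _ _).trans (add_le_add ((norm_sub_le _ _).trans (add_le_add h1 h2)) h3)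
    _ = _ := by ring

/-! ### Measurability of changes of frame -/

theorem continuous_adjugate_entry (i j : Fin 3) :
    Continuous fun L : Matrix (Fin 3) (Fin 3) ℝ => L.adjugate i j := by
  have : Continuous fun L : Matrix (Fin 3) (Fin 3) ℝ => L.adjugate :=
    Continuous.matrix_adjugate continuous_id
  exact this.matrix_elem i j

theorem measurable_inv_entry {α : Type*} [MeasurableSpace α] {L : α → Matrix (Fin 3) (Fin 3) ℝ}
    (hL : ∀ i j, Measurable fun x => L x i j) (i j : Fin 3) :
    Measurable fun x => (L x)⁻¹ i j := by
  have hL' : Measurable fun x => (fun i j => L x i j : Fin 3 → Fin 3 → ℝ) :=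
    measurable_pi_lambda _ fun i => measurable_pi_lambda _ fun j => hL i j
  have h1 : Measurable fun x => (L x).det :=
    (show Continuous fun L : Fin 3 → Fin 3 → ℝ => (Matrix.of L).det from
      Continuous.matrix_det continuous_id).measurable.comp hL'
  have h2 : Measurable fun x => (L x).adjugate i j :=
    (show Continuous fun L : Fin 3 → Fin 3 → ℝ => (Matrix.of L).adjugate i j from
      continuous_adjugate_entry i j).measurable.comp hL'
  simp only [Matrix.inv_def, Matrix.smul_apply, smul_eq_mul, Ring.inverse_eq_inv']
  exact h1.inv.mul h2

theorem measurable_frameCoeff {α : Type*} [MeasurableSpace α] {L : α → Matrix (Fin 3) (Fin 3) ℝ}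
    (hL : ∀ i j, Measurable fun x => L x i j) (w : ℕ) (K K' : TIdx r s) :
    Measurable fun x => frameCoeff w (L x) K K' := by
  have hL' : Measurable fun x => (fun i j => L x i j : Fin 3 → Fin 3 → ℝ) :=
    measurable_pi_lambda _ fun i => measurable_pi_lambda _ fun j => hL i j
  have h1 : Measurable fun x => (L x).det :=
    (show Continuous fun L : Fin 3 → Fin 3 → ℝ => (Matrix.of L).det from
      Continuous.matrix_det continuous_id).measurable.comp hL'
  refine (h1.abs.pow_const w).mul (Measurable.mul ?_ ?_)
  · exact Finset.measurable_prod _ fun a _ => measurable_inv_entry hL _ _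
  · exact Finset.measurable_prod _ fun a _ => hL _ _

end ChangeFrame

/-! ### Changes of charts -/

section ChartChange

/-- Transition maps between charts of the maximal atlas are smooth. -/
theorem contDiffOn_chartChange {E N : Type*} [NormedAddCommGroup E] [NormedSpace ℝ E]
    [TopologicalSpace N] [ChartedSpace E N] {e e' : OpenPartialHomeomorph N E}
    (he : e ∈ IsManifold.maximalAtlas 𝓘(ℝ, E) ∞ N) (he' : e' ∈ IsManifold.maximalAtlas 𝓘(ℝ, E) ∞ N) :
    ContDiffOn ℝ ∞ (e' ∘ e.symm) (e.symm ≫ₕ e').source := by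
  have := 𝓘(ℝ, E).contDiffOn_extendCoordChange he he'
  simpa [ModelWithCorners.extendCoordChange] using this

theorem eq_sum_stdVec {n : ℕ} (v : EuclideanSpace ℝ (Fin n)) : v = ∑ j, v j • stdVec j := by
  ext i; simp [stdVec, Pi.single_apply]

theorem clm_apply_eq_mulVec (A : E3 →L[ℝ] E3) (v : E3) (i : Fin 3) :
    A v i = (Matrix.of (fun i j => (A (stdVec j)) i) : Matrix (Fin 3) (Fin 3) ℝ).mulVec v i := by
  conv_lhs => rw [eq_sum_stdVec v]
  simp [map_sum, Matrix.mulVec, dotProduct, mul_comm]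

variable {M : Type*} [TopologicalSpace M] [ChartedSpace E3 M]

/-- The transition map from the chart at `p` to the chart at `q`. -/
def transMap (p q : M) (z : E3) : E3 := chartAt E3 q ((chartAt E3 p).symm z)

/-- The Jacobian matrix of the transition map. -/
def jac (p q : M) (z : E3) : Matrix (Fin 3) (Fin 3) ℝ :=
  Matrix.of fun i j => (fderiv ℝ (transMap p q) z (stdVec j)) i

/-- The part of the chart domain at `p`, in coordinates, which lies in the chart domain at `q`. -/
def transDomain (p q : M) : Set E3 := ((chartAt E3 p).symm ≫ₕ chartAt E3 q).source

theorem mem_transDomain {p q : M} {z : E3} : z ∈ transDomain p q ↔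
    z ∈ (chartAt E3 p).target ∧ (chartAt E3 p).symm z ∈ (chartAt E3 q).source := by
  simp [transDomain]

theorem isOpen_transDomain (p q : M) : IsOpen (transDomain p q) :=
  OpenPartialHomeomorph.open_source _

theorem transDomain_of_mem {p q x : M} (hp : x ∈ (chartAt E3 p).source)
    (hq : x ∈ (chartAt E3 q).source) : chartAt E3 p x ∈ transDomain p q := by
  rw [mem_transDomain]
  simp [hp, hq]

theorem tangentCoordChange_eq_fderiv [IsManifold 𝓘(ℝ, E3) 1 M] (p q x : M) :
    tangentCoordChange 𝓘(ℝ, E3) p q x = fderiv ℝ (transMap p q) (chartAt E3 p x) := by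
  rw [tangentCoordChange_def]
  simp only [modelWithCornersSelf_coe, range_id, fderivWithin_univ, extChartAt, OpenPartialHomeomorph.extend]
  rfl

variable [IsManifold 𝓘(ℝ, E3) ∞ M]

theorem contDiffOn_transMap (p q : M) : ContDiffOn ℝ ∞ (transMap p q) (transDomain p q) :=
  contDiffOn_chartChange (IsManifold.chart_mem_maximalAtlas p) (IsManifold.chart_mem_maximalAtlas q)

theorem contDiffAt_transMap {p q : M} {z : E3} (hz : z ∈ transDomain p q) :
    ContDiffAt ℝ ∞ (transMap p q) z :=
  (contDiffOn_transMap p q).contDiffAt ((isOpen_transDomain p q).mem_nhds hz)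

theorem contDiffAt_jac {p q : M} {z : E3} (hz : z ∈ transDomain p q) (i j : Fin 3) :
    ContDiffAt ℝ ∞ (fun z => jac p q z i j) z := by
  have h1 : ContDiffAt ℝ ∞ (fderiv ℝ (transMap p q)) z :=
    (contDiffAt_transMap hz).fderiv_right (m := ∞) (by norm_cast)
  have h2 : ContDiffAt ℝ ∞ (fun z => fderiv ℝ (transMap p q) z (stdVec j)) z :=
    h1.clm_apply contDiffAt_const
  exact (contDiffAt_piLp 2).1 h2 i

/-- The cocycle condition for the coordinate frames. -/
theorem chartFrame_eq_mul {p q x : M} (hp : x ∈ (chartAt E3 p).source)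
    (hq : x ∈ (chartAt E3 q).source) :
    chartFrame p x = chartFrame q x * jac p q (chartAt E3 p x) := by
  have : IsManifold 𝓘(ℝ, E3) 1 M := IsManifold.of_le (n := ∞) (by norm_cast)
  ext i j
  have h := tangentCoordChange_comp (I := 𝓘(ℝ, E3)) (w := p) (x := q) (y := x) (z := x)
    (v := stdVec j) (by simp [hp, hq])
  simp only [chartFrame, Matrix.of_apply]
  rw [← h, clm_apply_eq_mulVec]
  simp only [Matrix.mul_apply, Matrix.mulVec, dotProduct, Matrix.of_apply]
  simp only [tangentCoordChange_eq_fderiv, jac, Matrix.of_apply]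

theorem chartFrame_self (x : M) : chartFrame x x = 1 := by
  have : IsManifold 𝓘(ℝ, E3) 1 M := IsManifold.of_le (n := ∞) (by norm_cast)
  ext i j
  simp only [chartFrame, Matrix.of_apply]
  rw [tangentCoordChange_self (by simp)]
  simp [stdVec, Matrix.one_apply]

theorem chartFrame_mul_jac {p x : M} (hp : x ∈ (chartAt E3 p).source) :
    chartFrame p x * jac x p (chartAt E3 x x) = 1 := by
  rw [← chartFrame_eq_mul (mem_chart_source E3 x) hp, chartFrame_self]

theorem det_chartFrame_ne_zero {p x : M} (hp : x ∈ (chartAt E3 p).source) :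
    (chartFrame p x).det ≠ 0 := by
  intro h
  have := congrArg Matrix.det (chartFrame_mul_jac hp)
  simp [h] at this

theorem chartFrame_inv {p x : M} (hp : x ∈ (chartAt E3 p).source) :
    (chartFrame p x)⁻¹ = jac x p (chartAt E3 x x) :=
  Matrix.inv_eq_right_inv (chartFrame_mul_jac hp)

theorem det_jac_ne_zero {p q : M} {z : E3} (hz : z ∈ transDomain p q) : (jac p q z).det ≠ 0 := by
  obtain ⟨h1, h2⟩ := mem_transDomain.1 hz
  have h3 := (chartAt E3 p).map_target h1
  have := chartFrame_eq_mul h3 h2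
  rw [(chartAt E3 p).right_inv h1] at this
  intro h
  apply det_chartFrame_ne_zero h3
  rw [this, Matrix.det_mul, h, mul_zero]

variable {V : Type*} [NormedAddCommGroup V] [NormedSpace ℝ V] {r s : ℕ}

theorem chartComp_chartAt {w : ℕ} (T : M → TComp r s V) {p x : M}
    (hp : x ∈ (chartAt E3 p).source) :
    chartComp w T p (chartAt E3 p x) = changeFrame w (chartFrame p x) (T x) := by
  rw [chartComp, (chartAt E3 p).left_inv hp]

theorem chartComp_self (w : ℕ) (T : M → TComp r s V) (x : M) :
    chartComp w T x (chartAt E3 x x) = T x := by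
  rw [chartComp_chartAt T (mem_chart_source E3 x), chartFrame_self, changeFrame_one]

/-- The transformation law of components under changes of charts. -/
theorem chartComp_trans (w : ℕ) (T : M → TComp r s V) {p q : M} {z : E3}
    (hz : z ∈ transDomain p q) :
    chartComp w T p z = changeFrame w (jac p q z) (chartComp w T q (transMap p q z)) := by
  obtain ⟨h1, h2⟩ := mem_transDomain.1 hz
  have h3 := (chartAt E3 p).map_target h1
  have := chartFrame_eq_mul h3 h2
  rw [(chartAt E3 p).right_inv h1] at this
  rw [transMap, chartComp_chartAt T h2, chartComp, this, changeFrame_mul]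

theorem chartComp_add (w : ℕ) (T T' : M → TComp r s V) (p : M) :
    chartComp w (T + T') p = chartComp w T p + chartComp w T' p := by
  ext z : 1
  simp [chartComp, changeFrame_add]

theorem chartComp_smul (w : ℕ) (c : ℝ) (T : M → TComp r s V) (p : M) :
    chartComp w (c • T) p = c • chartComp w T p := by
  ext z : 1
  simp [chartComp, changeFrame_smul]

theorem chartGram_trans (g : RMetric M) {p q : M} {z : E3} (hz : z ∈ transDomain p q) :
    chartGram g p z = (jac p q z)ᵀ * chartGram g q (transMap p q z) * jac p q z := by
  obtain ⟨h1, h2⟩ := mem_transDomain.1 hz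
  have h3 := (chartAt E3 p).map_target h1
  have := chartFrame_eq_mul h3 h2
  rw [(chartAt E3 p).right_inv h1] at this
  rw [chartGram, chartGram, transMap, (chartAt E3 q).left_inv h2, this, Matrix.transpose_mul]
  simp only [Matrix.mul_assoc]

theorem chartGram_self (g : RMetric M) (x : M) : chartGram g x (chartAt E3 x x) = gram g x := by
  rw [chartGram, (chartAt E3 x).left_inv (mem_chart_source E3 x), chartFrame_self]
  simp

theorem inner_eq_gram (g : RMetric M) (x : M) (v v' : E3) :
    g.inner x v v' = ∑ i, ∑ j, v i * gram g x i j * v' j := by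
  have h1 : g.inner x v = ∑ i, v i • g.inner x (stdVec i : E3) := by
    conv_lhs => rw [eq_sum_stdVec v]
    exact (map_sum (g.inner x) _ _).trans (Finset.sum_congr rfl fun i _ => map_smul _ _ _)
  have h2 : ∀ i, g.inner x (stdVec i : E3) v' = ∑ j, v' j * gram g x i j := by
    intro i
    conv_lhs => rw [eq_sum_stdVec v']
    exact (map_sum (g.inner x (stdVec i : E3)) _ _).trans
      (Finset.sum_congr rfl fun j _ => map_smul _ _ _)
  rw [h1]
  have h3 : (∑ i, v i • g.inner x (stdVec i : E3)) v' = ∑ i, v i * g.inner x (stdVec i : E3) v' :=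
    sum_apply _ _ _
  rw [h3]
  refine Finset.sum_congr rfl fun i _ => ?_
  rw [h2, Finset.mul_sum]
  exact Finset.sum_congr rfl fun j _ => by ring

theorem gram_posDef (g : RMetric M) (x : M) : (gram g x).PosDef := by
  refine Matrix.PosDef.of_dotProduct_mulVec_pos ?_ fun v hv => ?_
  · ext i j
    simpa [gram] using g.symm x (stdVec j : E3) (stdVec i : E3)
  · have h := g.pos x (WithLp.toLp 2 v : E3) (fun h0 => hv (congrArg WithLp.ofLp h0))
    rw [inner_eq_gram] at h
    simpa [dotProduct, Matrix.mulVec, Finset.mul_sum, mul_assoc] using h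

theorem chartGram_posDef (g : RMetric M) {p : M} {z : E3} (hz : z ∈ (chartAt E3 p).target) :
    (chartGram g p z).PosDef := by
  have h := det_chartFrame_ne_zero ((chartAt E3 p).map_target hz)
  have := (gram_posDef g ((chartAt E3 p).symm z)).conjTranspose_mul_mul_same
    (B := chartFrame p ((chartAt E3 p).symm z))
    (Matrix.mulVec_injective_iff_isUnit.2 ((Matrix.isUnit_iff_isUnit_det _).2 (isUnit_iff_ne_zero.2 h)))
  simpa [chartGram] using this

theorem chartGram_apply (g : RMetric M) (p : M) (z : E3) (i j : Fin 3) :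
    haveI : IsManifold 𝓘(ℝ, E3) 1 M := IsManifold.of_le (n := ∞) (by norm_cast)
    chartGram g p z i j = g.inner ((chartAt E3 p).symm z)
      (tangentCoordChange 𝓘(ℝ, E3) p ((chartAt E3 p).symm z) ((chartAt E3 p).symm z) (stdVec i))
      (tangentCoordChange 𝓘(ℝ, E3) p ((chartAt E3 p).symm z) ((chartAt E3 p).symm z) (stdVec j)) := by
  have : IsManifold 𝓘(ℝ, E3) 1 M := IsManifold.of_le (n := ∞) (by norm_cast)
  rw [inner_eq_gram]
  simp only [chartGram, chartFrame, Matrix.mul_apply, Matrix.transpose_apply, Matrix.of_apply,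
    Finset.sum_mul]
  exact Finset.sum_comm

/-- The components of the metric in a chart are smooth. -/
theorem contDiffOn_chartGram (g : RMetric M) (p : M) (i j : Fin 3) :
    ContDiffOn ℝ ∞ (fun z => chartGram g p z i j) (chartAt E3 p).target := by
  have : IsManifold 𝓘(ℝ, E3) 1 M := IsManifold.of_le (n := ∞) (by norm_cast)
  let e := trivializationAt E3 (TangentSpace 𝓘(ℝ, E3) : M → Type _) p
  have hs : ∀ k : Fin 3, ContMDiffOn 𝓘(ℝ, E3) (𝓘(ℝ, E3).prod 𝓘(ℝ, E3)) ∞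
      (fun x => Bundle.TotalSpace.mk' E3 (E := (TangentSpace 𝓘(ℝ, E3) : M → Type _)) x
        (e.symmL ℝ x (stdVec k))) e.baseSet := by
    intro k
    rw [e.contMDiffOn_section_baseSet_iff]
    apply (contMDiffOn_const (c := stdVec k)).congr
    intro y hy
    simp [hy]
  have h1 := ContMDiffOn.clm_bundle_apply₂ (F₁ := E3) (F₂ := E3) (F₃ := ℝ)
    (E₃ := Bundle.Trivial M ℝ) (g.contMDiff.contMDiffOn) (hs i) (hs j)
  have h2 : ContMDiffOn 𝓘(ℝ, E3) 𝓘(ℝ, ℝ) ∞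
      (fun x => g.inner x (e.symmL ℝ x (stdVec i)) (e.symmL ℝ x (stdVec j))) e.baseSet := by
    intro x hx
    have := h1 x hx
    rw [Bundle.contMDiffWithinAt_totalSpace] at this
    exact this.2
  have h3 := h2.comp (contMDiffOn_chart_symm (I := 𝓘(ℝ, E3)) (n := ∞) (x := p))
    (fun z hz => (chartAt E3 p).map_target hz)
  rw [contMDiffOn_iff_contDiffOn] at h3
  refine h3.congr fun z hz => ?_
  rw [chartGram_apply]
  have hb : (chartAt E3 p).symm z ∈ (chartAt E3 p).source := (chartAt E3 p).map_target hz
  have := TangentBundle.symmL_trivializationAt_eq_core (I := 𝓘(ℝ, E3)) hb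
  simp only [Function.comp]
  rw [this]
  rfl

end ChartChange

/-! ### The Levi-Civita connection in arbitrary charts -/

section Connection

variable {M : Type*} [TopologicalSpace M] [ChartedSpace E3 M]

theorem transMap_mem_target {p q : M} {z : E3} (hz : z ∈ transDomain p q) :
    transMap p q z ∈ (chartAt E3 q).target :=
  (chartAt E3 q).map_source (mem_transDomain.1 hz).2

theorem eventually_line_mem {p q : M} {z : E3} (hz : z ∈ transDomain p q) (v : E3) :
    ∀ᶠ t : ℝ in 𝓝 0, z + t • v ∈ transDomain p q := by
  have : ContinuousAt (fun t : ℝ => z + t • v) 0 := by fun_prop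
  exact this.eventually_mem ((isOpen_transDomain p q).mem_nhds (by simpa using hz))

variable [IsManifold 𝓘(ℝ, E3) ∞ M]

/-- The partial derivatives `∂_a g_{bc}` of the metric in the chart at `p`. -/
def dGram (g : RMetric M) (p : M) (z : E3) (a b c : Fin 3) : ℝ :=
  fderiv ℝ (fun z => chartGram g p z b c) z (stdVec a)

/-- The Christoffel symbols of the first kind, in the chart at `p`. -/
def chrisLow (g : RMetric M) (p : M) (z : E3) (l i j : Fin 3) : ℝ :=
  (1 / 2) * (dGram g p z i l j + dGram g p z j l i - dGram g p z l i j)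

/-- The Christoffel symbols in the chart at `p`, as matrices: the entry `(i, j)` of
`chrisMat g p z k` is `Γ^i_{kj}`. -/
def chrisMat (g : RMetric M) (p : M) (z : E3) (k : Fin 3) : Matrix (Fin 3) (Fin 3) ℝ :=
  (chartGram g p z)⁻¹ * Matrix.of fun l j => chrisLow g p z l k j

theorem christoffel_eq (g : RMetric M) (x : M) (k i j : Fin 3) :
    christoffel g x k i j = chrisMat g x (chartAt E3 x x) i k j := by
  simp only [christoffel, chrisMat, chrisLow, Matrix.mul_apply, Matrix.of_apply, chartGram_self,
    Finset.mul_sum, dGram]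
  exact Finset.sum_congr rfl fun l _ => by ring

/-- The partial derivatives of the Jacobian matrix of a transition map. -/
def djac (p q : M) (z : E3) (k i j : Fin 3) : ℝ :=
  fderiv ℝ (fun z => jac p q z i j) z (stdVec k)

theorem differentiableAt_jac {p q : M} {z : E3} (hz : z ∈ transDomain p q) (i j : Fin 3) :
    DifferentiableAt ℝ (fun z => jac p q z i j) z :=
  (contDiffAt_jac hz i j).differentiableAt (by simp)

/-- Symmetry of the second derivatives of the transition map. -/
theorem djac_symm {p q : M} {z : E3} (hz : z ∈ transDomain p q) (k i j : Fin 3) :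
    djac p q z k i j = djac p q z j i k := by
  have hsymm : IsSymmSndFDerivAt ℝ (transMap p q) z :=
    (contDiffAt_transMap hz).isSymmSndFDerivAt (by simpa using ENat.LEInfty.out)
  have h1 : DifferentiableAt ℝ (fderiv ℝ (transMap p q)) z :=
    ((contDiffAt_transMap hz).fderiv_right (m := ∞) (by norm_cast)).differentiableAt (by simp)
  have h2 : ∀ j k, djac p q z k i j = (fderiv ℝ (fderiv ℝ (transMap p q)) z (stdVec k) (stdVec j)) i := by
    intro j k
    have h3 : HasFDerivAt (fun z => fderiv ℝ (transMap p q) z (stdVec j))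
        ((fderiv ℝ (fderiv ℝ (transMap p q)) z).flip (stdVec j)) z := by
      simpa using h1.hasFDerivAt.clm_apply (hasFDerivAt_const (stdVec j : E3) z)
    have h4 := (EuclideanSpace.proj (𝕜 := ℝ) i).hasFDerivAt.comp z h3
    have h5 : djac p q z k i j = ((EuclideanSpace.proj (𝕜 := ℝ) i).comp
        ((fderiv ℝ (fderiv ℝ (transMap p q)) z).flip (stdVec j))) (stdVec k) := by
      rw [← h4.fderiv]; rfl
    rw [h5]; rfl
  rw [h2, h2, hsymm]

theorem differentiableAt_chartGram (g : RMetric M) {p : M} {z : E3}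
    (hz : z ∈ (chartAt E3 p).target) (i j : Fin 3) :
    DifferentiableAt ℝ (fun z => chartGram g p z i j) z :=
  ((contDiffOn_chartGram g p i j).contDiffAt ((chartAt E3 p).open_target.mem_nhds hz)).differentiableAt
    (by simp)

/-- The chain rule along coordinate lines for functions pulled back by a transition map. -/
theorem fderiv_comp_transMap {F : Type*} [NormedAddCommGroup F] [NormedSpace ℝ F] {p q : M}
    {z : E3} (hz : z ∈ transDomain p q) {f : E3 → F} (hf : DifferentiableAt ℝ f (transMap p q z))
    (k : Fin 3) : HasDerivAt (fun t : ℝ => f (transMap p q (z + t • stdVec k)))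
      (∑ m, jac p q z m k • fderiv ℝ f (transMap p q z) (stdVec m)) 0 := by
  have h1 : HasDerivAt (fun t : ℝ => z + t • (stdVec k : E3)) (stdVec k) 0 := by
    simpa using ((hasDerivAt_id (0 : ℝ)).smul_const (stdVec k : E3)).const_add z
  have h2 : HasFDerivAt (f ∘ transMap p q)
      ((fderiv ℝ f (transMap p q z)).comp (fderiv ℝ (transMap p q) z)) (z + (0 : ℝ) • stdVec k) := by
    simpa using hf.hasFDerivAt.comp z
      ((contDiffAt_transMap hz).differentiableAt (by simp)).hasFDerivAt
  have h3 := h2.comp_hasDerivAt (0 : ℝ) h1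
  refine h3.congr_deriv ?_
  rw [ContinuousLinearMap.comp_apply]
  conv_lhs => rw [eq_sum_stdVec (fderiv ℝ (transMap p q) z (stdVec k))]
  rw [map_sum]
  simp only [map_smul, jac, Matrix.of_apply]

theorem hasDerivAt_line {F : Type*} [NormedAddCommGroup F] [NormedSpace ℝ F] {f : E3 → F} {z : E3}
    (hf : DifferentiableAt ℝ f z) (v : E3) :
    HasDerivAt (fun t : ℝ => f (z + t • v)) (fderiv ℝ f z v) 0 := by
  have h1 : HasDerivAt (fun t : ℝ => z + t • v) v 0 := by
    simpa using ((hasDerivAt_id (0 : ℝ)).smul_const v).const_add z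
  have h2 : HasFDerivAt f (fderiv ℝ f z) (z + (0 : ℝ) • v) := by simpa using hf.hasFDerivAt
  exact h2.comp_hasDerivAt (0 : ℝ) h1

theorem dGram_trans (g : RMetric M) {p q : M} {z : E3} (hz : z ∈ transDomain p q)
    (c a b : Fin 3) : dGram g p z c a b =
      ∑ m, ∑ n, (djac p q z c m a * chartGram g q (transMap p q z) m n * jac p q z n b
        + jac p q z m a * (∑ e, jac p q z e c * dGram g q (transMap p q z) e m n) * jac p q z n b
        + jac p q z m a * chartGram g q (transMap p q z) m n * djac p q z c n b) := by
  have hL := fun i j => hasDerivAt_line (differentiableAt_jac hz i j) (stdVec c)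
  have hG := fun i j => fderiv_comp_transMap hz
    (differentiableAt_chartGram g (transMap_mem_target hz) i j) c
  have h0 := hasDerivAt_line (differentiableAt_chartGram g (mem_transDomain.1 hz).1 a b) (stdVec c)
  have h1 : HasDerivAt (fun t : ℝ => ∑ m, ∑ n, jac p q (z + t • stdVec c) m a *
      chartGram g q (transMap p q (z + t • stdVec c)) m n * jac p q (z + t • stdVec c) n b) _ 0 :=
    HasDerivAt.fun_sum fun m _ => HasDerivAt.fun_sum fun n _ => ((hL m a).fun_mul (hG m n)).fun_mul (hL n b)
  have h2 : (fun t : ℝ => chartGram g p (z + t • stdVec c) a b) =ᶠ[𝓝 0]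
      fun t : ℝ => ∑ m, ∑ n, jac p q (z + t • stdVec c) m a *
      chartGram g q (transMap p q (z + t • stdVec c)) m n * jac p q (z + t • stdVec c) n b := by
    filter_upwards [eventually_line_mem hz (stdVec c)] with t ht
    rw [chartGram_trans g ht]
    simp only [Matrix.mul_apply, Matrix.transpose_apply, Finset.sum_mul]
    exact Finset.sum_comm
  have h3 := h0.unique (h1.congr_of_eventuallyEq h2)
  rw [dGram, h3]
  refine Finset.sum_congr rfl fun m _ => Finset.sum_congr rfl fun n _ => ?_
  simp only [zero_smul, add_zero, dGram, djac, smul_eq_mul]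
  ring

theorem chrisLow_trans (g : RMetric M) {p q : M} {z : E3} (hz : z ∈ transDomain p q)
    (c a b : Fin 3) : chrisLow g p z c a b =
      ∑ m, ∑ n, jac p q z m c * chartGram g q (transMap p q z) m n * djac p q z a n b
      + ∑ m, ∑ n, ∑ e, jac p q z m c * jac p q z n a * jac p q z e b *
          chrisLow g q (transMap p q z) m n e := by
  have hsymm : ∀ m n, chartGram g q (transMap p q z) m n = chartGram g q (transMap p q z) n m := by
    intro m n
    simpa using (chartGram_posDef g (transMap_mem_target hz)).isHermitian.apply n m
  have hdsymm := djac_symm hz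
  have hdG := dGram_trans g hz
  rw [chrisLow]
  set L := jac p q z
  set G := chartGram g q (transMap p q z)
  set D := djac p q z
  have hX : ∀ c a b, (∑ m, ∑ n, D c m a * G m n * L n b) = ∑ m, ∑ n, L m b * G m n * D c n a := by
    intro c a b
    rw [Finset.sum_comm]
    refine Finset.sum_congr rfl fun m _ => Finset.sum_congr rfl fun n _ => ?_
    rw [hsymm n m]; ring
  have hXs : ∀ c a b, (∑ m, ∑ n, L m a * G m n * D c n b) = ∑ m, ∑ n, L m a * G m n * D b n c :=
    fun c a b => by simp only [hdsymm c _ b]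
  simp only [hdG, Finset.sum_add_distrib]
  simp only [hX]
  rw [hXs a b c, hXs b a c, hXs b c a]
  have hD : (∑ m, ∑ n, ∑ e, L m c * L n a * L e b * chrisLow g q (transMap p q z) m n e) =
      (1 / 2) * ((∑ m, ∑ n, L m c * (∑ e, L e a * dGram g q (transMap p q z) e m n) * L n b)
      + (∑ m, ∑ n, L m c * (∑ e, L e b * dGram g q (transMap p q z) e m n) * L n a)
      - ∑ m, ∑ n, L m a * (∑ e, L e c * dGram g q (transMap p q z) e m n) * L n b) := by
    simp only [chrisLow, Fin.sum_univ_three]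
    ring
  rw [hD]
  ring

theorem det_chartGram_ne_zero (g : RMetric M) {p : M} {z : E3} (hz : z ∈ (chartAt E3 p).target) :
    (chartGram g p z).det ≠ 0 := (chartGram_posDef g hz).det_pos.ne'

/-- The transformation law of the Christoffel symbols. -/
theorem chrisMat_trans (g : RMetric M) {p q : M} {z : E3} (hz : z ∈ transDomain p q)
    (k : Fin 3) : jac p q z * chrisMat g p z k = Matrix.of (fun i j => djac p q z k i j)
      + (∑ m, jac p q z m k • chrisMat g q (transMap p q z) m) * jac p q z := by
  have hlow := chrisLow_trans g hz
  set L := jac p q z with hL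
  set G := chartGram g q (transMap p q z) with hG
  have hLu : IsUnit L.det := isUnit_iff_ne_zero.2 (det_jac_ne_zero hz)
  have hGu : IsUnit G.det := isUnit_iff_ne_zero.2 (det_chartGram_ne_zero g (transMap_mem_target hz))
  have hpu : IsUnit (chartGram g p z).det :=
    isUnit_iff_ne_zero.2 (det_chartGram_ne_zero g (mem_transDomain.1 hz).1)
  have hcancel : ∀ A B : Matrix (Fin 3) (Fin 3) ℝ, Lᵀ * G * A = Lᵀ * G * B → A = B := by
    intro A B h
    have hu : IsUnit (Lᵀ * G).det := by
      rw [Matrix.det_mul, Matrix.det_transpose]; exact hLu.mul hGu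
    have := congrArg (fun X => (Lᵀ * G)⁻¹ * X) h
    simpa only [Matrix.nonsing_inv_mul_cancel_left _ _ hu] using this
  apply hcancel
  have h1 : Lᵀ * G * (L * chrisMat g p z k) = Matrix.of fun l j => chrisLow g p z l k j := by
    rw [← Matrix.mul_assoc, ← chartGram_trans g hz, chrisMat,
      Matrix.mul_nonsing_inv_cancel_left _ _ hpu]
  have h2 : ∀ m, G * chrisMat g q (transMap p q z) m =
      Matrix.of fun l j => chrisLow g q (transMap p q z) l m j := by
    intro m
    rw [chrisMat, Matrix.mul_nonsing_inv_cancel_left _ _ hGu]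
  rw [h1, Matrix.mul_add, ← Matrix.mul_assoc (Lᵀ * G), Matrix.mul_assoc Lᵀ G (∑ m, _),
    Finset.mul_sum]
  simp only [Matrix.mul_smul, h2]
  ext c b
  simp only [Matrix.of_apply, hlow, Matrix.add_apply]
  congr 1
  · simp only [Matrix.mul_apply, Matrix.transpose_apply, Matrix.of_apply, Finset.sum_mul]
    exact Finset.sum_comm
  · simp only [Matrix.mul_apply, Matrix.transpose_apply, Matrix.of_apply, Matrix.add_apply,
      Matrix.smul_apply, smul_eq_mul, Fin.sum_univ_three]
    ring

variable {V : Type*} [NormedAddCommGroup V] [NormedSpace ℝ V] {r s : ℕ}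

/-- The covariant derivative in the `k`-th coordinate direction, in the chart at `p`. -/
def chartCov (g : RMetric M) (w : ℕ) (T : M → TComp r s V) (p : M) (z : E3) (k : Fin 3) :
    TComp r s V := fun K =>
  fderiv ℝ (fun z => chartComp w T p z K) z (stdVec k)
    - frameDeriv w (chrisMat g p z k) (chartComp w T p z) K

theorem covDeriv_eq_chartCov (g : RMetric M) (w : ℕ) (T : M → TComp r s V) (x : M)
    (K : TIdx r (s + 1)) :
    covDeriv g w T x K = chartCov g w T x (chartAt E3 x x) (K.2 0) (K.1, Fin.tail K.2) := by
  simp only [covDeriv, chartCov, frameDeriv, chartComp_self, christoffel_eq, Matrix.trace,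
    Matrix.diag_apply]
  abel

theorem IsSmoothTensor.differentiableAt {w : ℕ} {T : M → TComp r s V} (hT : IsSmoothTensor w T)
    {p : M} {z : E3} (hz : z ∈ (chartAt E3 p).target) (K : TIdx r s) :
    DifferentiableAt ℝ (fun z => chartComp w T p z K) z := by
  have := ((hT p).contDiffAt ((chartAt E3 p).open_target.mem_nhds hz)).differentiableAt (by simp)
  exact differentiableAt_pi.1 this K

/-- The covariant derivative in coordinates is tensorial. -/
theorem chartCov_trans (g : RMetric M) {w : ℕ} {T : M → TComp r s V} (hT : IsSmoothTensor w T)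
    {p q : M} {z : E3} (hz : z ∈ transDomain p q) (k : Fin 3) :
    chartCov g w T p z k =
      ∑ m, jac p q z m k • changeFrame w (jac p q z) (chartCov g w T q (transMap p q z) m) := by
  set L := jac p q z with hL
  have hLd := det_jac_ne_zero hz
  have hLu : IsUnit L.det := isUnit_iff_ne_zero.2 hLd
  -- along the `k`-th coordinate line, `chartComp w T p` is the action of `N t`, a curve through
  -- `1`, on the curve `U t` of components whose change of frame is frozen at `z`
  set N : ℝ → Matrix (Fin 3) (Fin 3) ℝ := fun t => L⁻¹ * jac p q (z + t • stdVec k) with hN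
  set dL : Matrix (Fin 3) (Fin 3) ℝ := Matrix.of (fun i j => djac p q z k i j) with hdL
  have hN0 : N 0 = 1 := by simp [hN, ← hL, Matrix.nonsing_inv_mul _ hLu]
  have hND : ∀ i j, HasDerivAt (fun t => N t i j) ((L⁻¹ * dL) i j) 0 := by
    intro i j
    simp only [hN, Matrix.mul_apply]
    exact HasDerivAt.fun_sum fun m _ =>
      (hasDerivAt_line (differentiableAt_jac hz m j) (stdVec k)).const_mul _
  set U : ℝ → TComp r s V := fun t =>
    changeFrame w L (chartComp w T q (transMap p q (z + t • stdVec k))) with hU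
  have hUD : ∀ K, HasDerivAt (fun t => U t K) (changeFrame w L (fun K => ∑ m, L m k •
      fderiv ℝ (fun z => chartComp w T q z K) (transMap p q z) (stdVec m)) K) 0 := by
    intro K
    simp only [hU, changeFrame_apply]
    exact HasDerivAt.fun_sum fun K' _ => (fderiv_comp_transMap hz
      (hT.differentiableAt (transMap_mem_target hz) K') k).fun_const_smul _
  have hU0 : U 0 = chartComp w T p z := by
    simp only [hU, zero_smul, add_zero, chartComp_trans w T hz]; rfl
  have hcov : ∀ m, changeFrame w L (chartCov g w T q (transMap p q z) m) =
      changeFrame w L (fun K => fderiv ℝ (fun z => chartComp w T q z K) (transMap p q z) (stdVec m))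
      - frameDeriv w (L⁻¹ * chrisMat g q (transMap p q z) m * L) (chartComp w T p z) := by
    intro m
    rw [chartComp_trans w T hz, ← frameDeriv_conj w hLd]
    ext K
    simp only [changeFrame_apply, chartCov, smul_sub, Finset.sum_sub_distrib, Pi.sub_apply]
    rfl
  have hsum : changeFrame w L (fun K => ∑ m, L m k •
      fderiv ℝ (fun z => chartComp w T q z K) (transMap p q z) (stdVec m)) =
      ∑ m, L m k • changeFrame w L (fun K =>
        fderiv ℝ (fun z => chartComp w T q z K) (transMap p q z) (stdVec m)) := by
    ext K
    simp only [changeFrame_apply, Finset.sum_apply, Pi.smul_apply, Finset.smul_sum]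
    rw [Finset.sum_comm]
    refine Finset.sum_congr rfl fun m _ => Finset.sum_congr rfl fun K' _ => smul_comm _ _ _
  have hchris : chrisMat g p z k = L⁻¹ * dL
      + ∑ m, L m k • (L⁻¹ * chrisMat g q (transMap p q z) m * L) := by
    have h := congrArg (fun X => L⁻¹ * X) (chrisMat_trans g hz k)
    simp only [Matrix.nonsing_inv_mul_cancel_left _ _ hLu, ← hL] at h
    rw [h, Matrix.mul_add, Finset.sum_mul, Finset.mul_sum]
    simp only [Matrix.smul_mul, Matrix.mul_smul, Matrix.mul_assoc]
    rfl
  have hpart : ∀ K, fderiv ℝ (fun z => chartComp w T p z K) z (stdVec k) =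
      frameDeriv w (L⁻¹ * dL) (chartComp w T p z) K + ∑ m, L m k • changeFrame w L (fun K =>
        fderiv ℝ (fun z => chartComp w T q z K) (transMap p q z) (stdVec m)) K := by
    intro K
    have h0 := hasDerivAt_line (hT.differentiableAt (mem_transDomain.1 hz).1 K) (stdVec k)
    have h1 := hasDerivAt_changeFrame hN0 hND w hUD K
    have h2 : (fun t : ℝ => chartComp w T p (z + t • stdVec k) K) =ᶠ[𝓝 0]
        fun t => changeFrame w (N t) (U t) K := by
      filter_upwards [eventually_line_mem hz (stdVec k)] with t ht
      rw [hU, hN, ← changeFrame_mul, Matrix.mul_nonsing_inv_cancel_left _ _ hLu,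
        ← chartComp_trans w T ht]
    rw [h0.unique (h1.congr_of_eventuallyEq h2), hU0, hsum]
    simp
  ext K
  rw [chartCov, hpart, hchris]
  have hA : frameDeriv w (L⁻¹ * dL + ∑ m, L m k • (L⁻¹ * chrisMat g q (transMap p q z) m * L))
      (chartComp w T p z) = frameDeriv w (L⁻¹ * dL) (chartComp w T p z) +
      ∑ m, L m k • frameDeriv w (L⁻¹ * chrisMat g q (transMap p q z) m * L) (chartComp w T p z) := by
    rw [← frameDeriv_sum, ← frameDeriv_add]
  rw [hA]
  simp only [hcov, smul_sub, Finset.sum_sub_distrib, Pi.add_apply, Pi.sub_apply, Finset.sum_apply,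
    Pi.smul_apply]
  abel

/-- A family of tensors, one for each coordinate direction, transforms like a tensor with one more
lower index, put first. -/
theorem changeFrame_succ (w : ℕ) (L : Matrix (Fin 3) (Fin 3) ℝ) (C : Fin 3 → TComp r s V)
    (K : TIdx r (s + 1)) :
    changeFrame w L (fun K' : TIdx r (s + 1) => C (K'.2 0) (K'.1, Fin.tail K'.2)) K =
      ∑ m, L m (K.2 0) • changeFrame w L (C m) (K.1, Fin.tail K.2) := by
  simp only [changeFrame_apply, Finset.smul_sum]
  rw [← Fintype.sum_prod_type' (f := fun m (K' : TIdx r s) => L m (K.2 0) •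
    frameCoeff w L (K.1, Fin.tail K.2) K' • C m K')]
  refine Fintype.sum_equiv (((Equiv.refl _).prodCongr (Fin.consEquiv fun _ => Fin 3).symm).trans
      ((Equiv.prodAssoc _ _ _).symm.trans (((Equiv.prodComm _ _).prodCongr (Equiv.refl _)).trans
        (Equiv.prodAssoc _ _ _)))) _ _ fun K' => ?_
  simp only [smul_smul, frameCoeff, Fin.prod_univ_succ]
  congr 1
  simp [Fin.consEquiv, Fin.tail]
  ring

/-- The components of the covariant derivative in any chart are given by the usual formula. -/
theorem chartComp_covDeriv (g : RMetric M) {w : ℕ} {T : M → TComp r s V} (hT : IsSmoothTensor w T)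
    {p : M} {z : E3} (hz : z ∈ (chartAt E3 p).target) (K : TIdx r (s + 1)) :
    chartComp w (covDeriv g w T) p z K = chartCov g w T p z (K.2 0) (K.1, Fin.tail K.2) := by
  set y := (chartAt E3 p).symm z with hy
  have hyq : y ∈ (chartAt E3 y).source := mem_chart_source E3 y
  have hzd : z ∈ transDomain p y := mem_transDomain.2 ⟨hz, hyq⟩
  have h1 : covDeriv g w T y = fun K' : TIdx r (s + 1) =>
      chartCov g w T y (chartAt E3 y y) (K'.2 0) (K'.1, Fin.tail K'.2) := by
    ext K'; exact covDeriv_eq_chartCov g w T y K'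
  rw [chartComp_trans w _ hzd, transMap, ← hy, chartComp_self, h1, changeFrame_succ,
    chartCov_trans g hT hzd]
  simp only [transMap, ← hy, Finset.sum_apply, Pi.smul_apply]

theorem contDiffAt_inv_entry {E : Type*} [NormedAddCommGroup E] [NormedSpace ℝ E]
    {A : E → Matrix (Fin 3) (Fin 3) ℝ} {x : E} (hA : ∀ i j, ContDiffAt ℝ ∞ (fun x => A x i j) x)
    (hd : (A x).det ≠ 0) (i j : Fin 3) : ContDiffAt ℝ ∞ (fun x => (A x)⁻¹ i j) x := by
  have hdet : ContDiffAt ℝ ∞ (fun t => (A t).det) x := by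
    simp only [Matrix.det_fin_three]
    fun_prop
  have hadj : ContDiffAt ℝ ∞ (fun t => (A t).adjugate i j) x := by
    simp only [Matrix.adjugate_fin_three]
    fin_cases i <;> fin_cases j <;> simp <;> fun_prop
  simp only [Matrix.inv_def, Matrix.smul_apply, smul_eq_mul, Ring.inverse_eq_inv']
  exact (hdet.inv hd).mul hadj

theorem contDiffAt_chrisMat (g : RMetric M) {p : M} {z : E3} (hz : z ∈ (chartAt E3 p).target)
    (k i j : Fin 3) : ContDiffAt ℝ ∞ (fun z => chrisMat g p z k i j) z := by
  have hG : ∀ i j, ContDiffAt ℝ ∞ (fun z => chartGram g p z i j) z := fun i j =>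
    (contDiffOn_chartGram g p i j).contDiffAt ((chartAt E3 p).open_target.mem_nhds hz)
  have hd : ∀ a b c, ContDiffAt ℝ ∞ (fun z => dGram g p z a b c) z := fun a b c =>
    ((hG b c).fderiv_right (m := ∞) (by norm_cast)).clm_apply contDiffAt_const
  have hl : ∀ a b c, ContDiffAt ℝ ∞ (fun z => chrisLow g p z a b c) z := fun a b c =>
    contDiffAt_const.mul (((hd b a c).add (hd c a b)).sub (hd a b c))
  simp only [chrisMat, Matrix.mul_apply, Matrix.of_apply]
  exact ContDiffAt.sum fun l _ =>
    (contDiffAt_inv_entry hG (det_chartGram_ne_zero g hz) i l).mul (hl l k j)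

theorem IsSmoothTensor.contDiffAt {w : ℕ} {T : M → TComp r s V} (hT : IsSmoothTensor w T)
    {p : M} {z : E3} (hz : z ∈ (chartAt E3 p).target) (K : TIdx r s) :
    ContDiffAt ℝ ∞ (fun z => chartComp w T p z K) z :=
  contDiffAt_pi.1 ((hT p).contDiffAt ((chartAt E3 p).open_target.mem_nhds hz)) K

theorem contDiffAt_chartCov (g : RMetric M) {w : ℕ} {T : M → TComp r s V}
    (hT : IsSmoothTensor w T) {p : M} {z : E3} (hz : z ∈ (chartAt E3 p).target) (k : Fin 3)
    (K : TIdx r s) : ContDiffAt ℝ ∞ (fun z => chartCov g w T p z k K) z := by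
  have hc := fun i j => contDiffAt_chrisMat g hz k i j
  have hTc := hT.contDiffAt hz
  refine ContDiffAt.sub (((hTc K).fderiv_right (m := ∞) (by norm_cast)).clm_apply
    contDiffAt_const) ?_
  simp only [frameDeriv, Matrix.trace, Matrix.diag_apply]
  refine ContDiffAt.add (ContDiffAt.sub ?_ ?_) ?_
  · exact (contDiffAt_const.mul (ContDiffAt.sum fun i _ => hc i i)).smul (hTc K)
  · exact ContDiffAt.sum fun a _ => ContDiffAt.sum fun l _ => (hc _ _).smul (hTc _)
  · exact ContDiffAt.sum fun a _ => ContDiffAt.sum fun l _ => (hc _ _).smul (hTc _)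

theorem IsSmoothTensor.covDeriv (g : RMetric M) {w : ℕ} {T : M → TComp r s V}
    (hT : IsSmoothTensor w T) : IsSmoothTensor w (covDeriv g w T) := by
  intro p
  rw [contDiffOn_pi]
  intro K
  have h : ContDiffOn ℝ ∞ (fun z => chartCov g w T p z (K.2 0) (K.1, Fin.tail K.2))
      (chartAt E3 p).target := fun z hz => (contDiffAt_chartCov g hT hz _ _).contDiffWithinAt
  exact h.congr fun z hz => chartComp_covDeriv g hT hz K

theorem IsSmoothTensor.add {w : ℕ} {T T' : M → TComp r s V} (hT : IsSmoothTensor w T)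
    (hT' : IsSmoothTensor w T') : IsSmoothTensor w (T + T') := fun p => by
  rw [chartComp_add]; exact (hT p).add (hT' p)

theorem IsSmoothTensor.smul {w : ℕ} {T : M → TComp r s V} (c : ℝ) (hT : IsSmoothTensor w T) :
    IsSmoothTensor w (c • T) := fun p => by
  rw [chartComp_smul]; exact contDiffOn_const.smul (hT p)

theorem covDeriv_add (g : RMetric M) {w : ℕ} {T T' : M → TComp r s V} (hT : IsSmoothTensor w T)
    (hT' : IsSmoothTensor w T') : _root_.covDeriv g w (T + T') =
      _root_.covDeriv g w T + _root_.covDeriv g w T' := by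
  ext x K
  have hz := mem_chart_target E3 x
  simp only [Pi.add_apply, covDeriv_eq_chartCov, chartCov, chartComp_add, frameDeriv_add_right]
  rw [fderiv_fun_add (hT.differentiableAt hz _) (hT'.differentiableAt hz _)]
  simp only [add_apply]
  abel

theorem covDeriv_smul (g : RMetric M) {w : ℕ} (c : ℝ) {T : M → TComp r s V}
    (hT : IsSmoothTensor w T) : _root_.covDeriv g w (c • T) = c • _root_.covDeriv g w T := by
  ext x K
  have hz := mem_chart_target E3 x
  simp only [Pi.smul_apply, covDeriv_eq_chartCov, chartCov, chartComp_smul, frameDeriv_smul_right]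
  rw [fderiv_fun_const_smul (hT.differentiableAt hz _)]
  simp only [smul_apply, smul_sub]

theorem IsSmoothTensor.iterCov (g : RMetric M) {w : ℕ} {T : M → TComp r s V}
    (hT : IsSmoothTensor w T) (j : ℕ) : IsSmoothTensor w (iterCov g w j T) := by
  induction j with
  | zero => exact hT
  | succ j ih => exact ih.covDeriv g

theorem iterCov_add (g : RMetric M) {w : ℕ} {T T' : M → TComp r s V} (hT : IsSmoothTensor w T)
    (hT' : IsSmoothTensor w T') (j : ℕ) :
    iterCov g w j (T + T') = iterCov g w j T + iterCov g w j T' := by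
  induction j with
  | zero => rfl
  | succ j ih =>
    simp only [iterCov, ih]
    exact covDeriv_add g (hT.iterCov g j) (hT'.iterCov g j)

theorem iterCov_smul (g : RMetric M) {w : ℕ} (c : ℝ) {T : M → TComp r s V}
    (hT : IsSmoothTensor w T) (j : ℕ) : iterCov g w j (c • T) = c • iterCov g w j T := by
  induction j with
  | zero => rfl
  | succ j ih =>
    simp only [iterCov, ih]
    exact covDeriv_smul g c (hT.iterCov g j)

end Connection

/-! ### The orthonormal frame -/

section GramSchmidt

/-- The bilinear form with matrix `G`. -/
def matForm (G : Matrix (Fin 3) (Fin 3) ℝ) (v v' : E3) : ℝ := ∑ i, ∑ j, v i * G i j * v' j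

theorem matForm_sub_left (G : Matrix (Fin 3) (Fin 3) ℝ) (u v v' : E3) :
    matForm G (u - v) v' = matForm G u v' - matForm G v v' := by
  simp [matForm, sub_mul, Finset.sum_sub_distrib]

theorem matForm_smul_left (G : Matrix (Fin 3) (Fin 3) ℝ) (c : ℝ) (v v' : E3) :
    matForm G (c • v) v' = c * matForm G v v' := by
  simp [matForm, Finset.mul_sum, mul_assoc]

theorem matForm_comm {G : Matrix (Fin 3) (Fin 3) ℝ} (hG : G.PosDef) (v v' : E3) :
    matForm G v v' = matForm G v' v := by
  have hs : ∀ i j, G i j = G j i := fun i j => by simpa using hG.isHermitian.apply j i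
  rw [matForm, matForm, Finset.sum_comm]
  refine Finset.sum_congr rfl fun i _ => Finset.sum_congr rfl fun j _ => ?_
  rw [hs j i]; ring

theorem matForm_pos {G : Matrix (Fin 3) (Fin 3) ℝ} (hG : G.PosDef) {v : E3} (hv : v ≠ 0) :
    0 < matForm G v v := by
  have h := hG.dotProduct_mulVec_pos (x := WithLp.ofLp v) (fun h => hv (by
    ext i; exact congrFun h i))
  simpa [matForm, dotProduct, Matrix.mulVec, Finset.mul_sum, mul_assoc] using h

/-- A vector divided by its length. -/
def unitVec (b : E3 → E3 → ℝ) (v : E3) : E3 := (√(b v v))⁻¹ • v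

/-- The Gram-Schmidt process for the form `b` and the vectors `c`. -/
def gsVec (b : E3 → E3 → ℝ) (c : Fin 3 → E3) : Fin 3 → E3 :=
  ![unitVec b (c 0),
    unitVec b (c 1 - b (c 1) (unitVec b (c 0)) • unitVec b (c 0)),
    unitVec b (c 2 - b (c 2) (unitVec b (c 0)) • unitVec b (c 0)
      - b (c 2) (unitVec b (c 1 - b (c 1) (unitVec b (c 0)) • unitVec b (c 0))) •
        unitVec b (c 1 - b (c 1) (unitVec b (c 0)) • unitVec b (c 0)))]

/-- The Gram-Schmidt process commutes with maps which transport one form to the other. -/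
theorem gsVec_map {b b' : E3 → E3 → ℝ} (A : E3 →ₗ[ℝ] E3) (h : ∀ v v', b (A v) (A v') = b' v v')
    (c : Fin 3 → E3) (j : Fin 3) : gsVec b (fun j => A (c j)) j = A (gsVec b' c j) := by
  have hu : ∀ v, unitVec b (A v) = A (unitVec b' v) := fun v => by simp [unitVec, h]
  fin_cases j
  · exact hu _
  · change unitVec b _ = A (unitVec b' _)
    simp only [hu, h, ← map_smul, ← map_sub]
  · change unitVec b _ = A (unitVec b' _)
    simp only [hu, h, ← map_smul, ← map_sub]

/-- The matrix whose columns arise from the standard basis by the Gram-Schmidt process. -/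
def gsMat (G : Matrix (Fin 3) (Fin 3) ℝ) : Matrix (Fin 3) (Fin 3) ℝ :=
  Matrix.of fun i j => gsVec (matForm G) stdVec j i

theorem matForm_gsVec {G : Matrix (Fin 3) (Fin 3) ℝ} (hG : G.PosDef) (i j : Fin 3) :
    matForm G (gsVec (matForm G) stdVec i) (gsVec (matForm G) stdVec j) = if i = j then 1 else 0 := by
  have hc := matForm_comm hG
  have hunit : ∀ v : E3, v ≠ 0 → matForm G (unitVec (matForm G) v) (unitVec (matForm G) v) = 1 := by
    intro v hv
    have hp := matForm_pos hG hv
    have h1 : matForm G v ((√(matForm G v v))⁻¹ • v) = (√(matForm G v v))⁻¹ * matForm G v v := by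
      rw [hc, matForm_smul_left]
    rw [unitVec, matForm_smul_left, h1]
    have := Real.sq_sqrt hp.le
    have h2 : √(matForm G v v) ≠ 0 := (Real.sqrt_pos.2 hp).ne'
    field_simp
    exact this.symm
  have hort : ∀ v u : E3, matForm G v u = 0 → matForm G (unitVec (matForm G) v) u = 0 := by
    intro v u h
    rw [unitVec, matForm_smul_left, h, mul_zero]
  set b := matForm G with hb
  set f₀ := unitVec b (stdVec 0) with hf0
  set v₁ := (stdVec 1 : E3) - b (stdVec 1) f₀ • f₀ with hv1
  set f₁ := unitVec b v₁ with hf1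
  set v₂ := (stdVec 2 : E3) - b (stdVec 2) f₀ • f₀ - b (stdVec 2) f₁ • f₁ with hv2
  set f₂ := unitVec b v₂ with hf2
  have hgs : gsVec b stdVec = ![f₀, f₁, f₂] := rfl
  have e0 : (stdVec 0 : E3) ≠ 0 := fun h => by
    simpa [stdVec] using congrArg (fun v : E3 => v 0) h
  have f01 : f₀ 1 = 0 := by simp [hf0, unitVec, stdVec]
  have f02 : f₀ 2 = 0 := by simp [hf0, unitVec, stdVec]
  have f12 : f₁ 2 = 0 := by simp [hf1, unitVec, hv1, stdVec, f02]
  have n1 : v₁ ≠ 0 := fun h => by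
    simpa [hv1, stdVec, f01] using congrArg (fun v : E3 => v 1) h
  have n2 : v₂ ≠ 0 := fun h => by
    simpa [hv2, stdVec, f02, f12] using congrArg (fun v : E3 => v 2) h
  have b00 : b f₀ f₀ = 1 := hunit _ e0
  have b11 : b f₁ f₁ = 1 := hunit _ n1
  have b22 : b f₂ f₂ = 1 := hunit _ n2
  have b10 : b f₁ f₀ = 0 := hort _ _ (by
    rw [hv1, hb, matForm_sub_left, matForm_smul_left, ← hb, b00]; ring)
  have b01 : b f₀ f₁ = 0 := by rw [hc, b10]
  have b20 : b f₂ f₀ = 0 := hort _ _ (by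
    rw [hv2, hb, matForm_sub_left, matForm_sub_left, matForm_smul_left, matForm_smul_left, ← hb,
      b00, b10]; ring)
  have b21 : b f₂ f₁ = 0 := hort _ _ (by
    rw [hv2, hb, matForm_sub_left, matForm_sub_left, matForm_smul_left, matForm_smul_left, ← hb,
      b11, b01]; ring)
  have b02 : b f₀ f₂ = 0 := by rw [hc, b20]
  have b12 : b f₁ f₂ = 0 := by rw [hc, b21]
  rw [hgs]
  fin_cases i <;> fin_cases j <;> simp [b00, b11, b22, b10, b01, b20, b21, b02, b12]

theorem gsMat_orthonormal {G : Matrix (Fin 3) (Fin 3) ℝ} (hG : G.PosDef) :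
    (gsMat G)ᵀ * G * gsMat G = 1 := by
  ext i j
  have h := matForm_gsVec hG i j
  rw [Matrix.one_apply, ← h, matForm]
  simp only [Matrix.mul_apply, gsMat, Matrix.transpose_apply, Matrix.of_apply, Finset.sum_mul]
  exact Finset.sum_comm

theorem measurable_gsMat (i j : Fin 3) :
    Measurable fun G : Fin 3 → Fin 3 → ℝ => gsMat (Matrix.of G) i j := by
  have hproj : ∀ {f : (Fin 3 → Fin 3 → ℝ) → E3}, Measurable f → ∀ i, Measurable fun G => f G i :=
    fun hf i => (EuclideanSpace.proj (𝕜 := ℝ) i).continuous.measurable.comp hf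
  have hform : ∀ {f h : (Fin 3 → Fin 3 → ℝ) → E3}, Measurable f → Measurable h →
      Measurable fun G => matForm (Matrix.of G) (f G) (h G) := by
    intro f h hf hh
    refine Finset.measurable_sum _ fun i _ => Finset.measurable_sum _ fun j _ => ?_
    have hG : Measurable fun G : Fin 3 → Fin 3 → ℝ => G i j :=
      (measurable_pi_apply j).comp (measurable_pi_apply i)
    exact ((hproj hf i).mul hG).mul (hproj hh j)
  have hunit : ∀ {f : (Fin 3 → Fin 3 → ℝ) → E3}, Measurable f →
      Measurable fun G => unitVec (matForm (Matrix.of G)) (f G) := fun hf =>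
    ((hform hf hf).sqrt.inv).smul hf
  have m0 := hunit (measurable_const (a := (stdVec 0 : E3)))
  have m1 := hunit ((measurable_const (a := (stdVec 1 : E3))).sub
    ((hform (measurable_const (a := (stdVec 1 : E3))) m0).smul m0))
  have m2 := hunit (((measurable_const (a := (stdVec 2 : E3))).sub
    ((hform (measurable_const (a := (stdVec 2 : E3))) m0).smul m0)).sub
    ((hform (measurable_const (a := (stdVec 2 : E3))) m1).smul m1))
  fin_cases j
  · exact hproj m0 i
  · exact hproj m1 i
  · exact hproj m2 i

end GramSchmidt

theorem aestronglyMeasurable_pi {α ι V : Type*} [Fintype ι] [NormedAddCommGroup V]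
    [MeasurableSpace α] {μ : Measure α} {f : α → ι → V}
    (h : ∀ K, AEStronglyMeasurable (fun x => f x K) μ) : AEStronglyMeasurable f μ := by
  classical
  have : f = fun x => ∑ K, Pi.single K (f x K) := by
    ext x : 1
    exact (Finset.univ_sum_single (f x)).symm
  rw [this]
  exact Finset.aestronglyMeasurable_fun_sum _ fun K _ =>
    (continuous_single K).comp_aestronglyMeasurable (h K)

section OrthoFrame

variable {M : Type*} [TopologicalSpace M] [ChartedSpace E3 M]
  [SecondCountableTopology M] [Nonempty M]

theorem mem_chartPick_source (x : M) : x ∈ (chartAt E3 (chartPick x)).source := by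
  classical
  exact Nat.find_spec (Classical.choose_spec (exists_chartCenters (M := M)) x)

theorem iUnion_chartCenter_source : (⋃ n, (chartAt E3 (chartCenter M n)).source) = univ :=
  eq_univ_of_forall fun x => mem_iUnion.2 (Classical.choose_spec (exists_chartCenters (M := M)) x)

variable [IsManifold 𝓘(ℝ, E3) ∞ M]

/-- The frame in the definitions is obtained by the Gram-Schmidt process in the tangent space; it
agrees with the process in the coordinates of the chosen chart. -/
theorem orthoFrame_eq (g : RMetric M) (x : M) :
    orthoFrame g x = chartFrame (chartPick x) x *
      gsMat (chartGram g (chartPick x) (chartAt E3 (chartPick x) x)) := by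
  set q := chartPick x
  have hq : x ∈ (chartAt E3 q).source := mem_chartPick_source x
  set A : E3 →ₗ[ℝ] E3 := (Matrix.toLpLin 2 2 (chartFrame q x)) with hA
  have hAapp : ∀ v i, A v i = ∑ k, chartFrame q x i k * v k := fun v i => by
    simp [hA, Matrix.toLpLin_apply, Matrix.mulVec, dotProduct]
  have h1 : orthoVec g x = gsVec (fun v v' => g.inner x v v') (fun j => A (stdVec j)) := by
    have : (fun j => WithLp.toLp 2 fun i => chartFrame q x i j) = fun j => A (stdVec j) := by
      ext j i
      rw [hAapp]
      simp [stdVec]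
    rw [← this]
    rfl
  have h2 : ∀ v v', g.inner x (A v : E3) (A v' : E3) = matForm (chartGram g q (chartAt E3 q x)) v v' := by
    intro v v'
    rw [inner_eq_gram, matForm, chartGram, (chartAt E3 q).left_inv hq]
    simp only [hAapp, Matrix.mul_apply, Matrix.transpose_apply, Fin.sum_univ_three]
    ring
  ext i j
  rw [orthoFrame, Matrix.of_apply, h1, gsVec_map A h2, hAapp]
  simp [Matrix.mul_apply, gsMat]

/-- The orthonormal frame in terms of the coordinate frame of the chart at `p`. -/
def chartOrtho (g : RMetric M) (p x : M) : Matrix (Fin 3) (Fin 3) ℝ :=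
  (chartFrame p x)⁻¹ * orthoFrame g x

theorem chartFrame_mul_chartOrtho (g : RMetric M) {p x : M} (hp : x ∈ (chartAt E3 p).source) :
    chartFrame p x * chartOrtho g p x = orthoFrame g x :=
  Matrix.mul_nonsing_inv_cancel_left _ _ (isUnit_iff_ne_zero.2 (det_chartFrame_ne_zero hp))

theorem orthoFrame_orthonormal (g : RMetric M) (x : M) :
    (orthoFrame g x)ᵀ * gram g x * orthoFrame g x = 1 := by
  have hq := mem_chartPick_source x
  have h := gsMat_orthonormal (chartGram_posDef g ((chartAt E3 (chartPick x)).map_source hq))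
  rw [orthoFrame_eq, ← h, chartGram, (chartAt E3 (chartPick x)).left_inv hq, Matrix.transpose_mul]
  simp only [Matrix.mul_assoc]

theorem chartOrtho_orthonormal (g : RMetric M) {p x : M} (hp : x ∈ (chartAt E3 p).source) :
    (chartOrtho g p x)ᵀ * chartGram g p (chartAt E3 p x) * chartOrtho g p x = 1 := by
  rw [← orthoFrame_orthonormal g x, ← chartFrame_mul_chartOrtho g hp, chartGram,
    (chartAt E3 p).left_inv hp, Matrix.transpose_mul]
  simp only [Matrix.mul_assoc]

theorem chartOrtho_inv (g : RMetric M) {p x : M} (hp : x ∈ (chartAt E3 p).source) :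
    (chartOrtho g p x)⁻¹ = (chartOrtho g p x)ᵀ * chartGram g p (chartAt E3 p x) :=
  Matrix.inv_eq_left_inv (chartOrtho_orthonormal g hp)

theorem det_chartOrtho_ne_zero (g : RMetric M) {p x : M} (hp : x ∈ (chartAt E3 p).source) :
    (chartOrtho g p x).det ≠ 0 := by
  intro h
  have := congrArg Matrix.det (chartOrtho_orthonormal g hp)
  simp [h] at this

theorem chartOrtho_mul_transpose (g : RMetric M) {p x : M} (hp : x ∈ (chartAt E3 p).source) :
    chartOrtho g p x * (chartOrtho g p x)ᵀ = (chartGram g p (chartAt E3 p x))⁻¹ := by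
  refine (Matrix.inv_eq_left_inv ?_).symm
  rw [Matrix.mul_assoc, ← chartOrtho_inv g hp,
    Matrix.mul_nonsing_inv _ (isUnit_iff_ne_zero.2 (det_chartOrtho_ne_zero g hp))]

/-- On compact sets of coordinates the orthonormal frame and its inverse are bounded: if `L` is the
frame and `G` the metric, then `L Lᵀ = G⁻¹` bounds `L`, and `L⁻¹ = Lᵀ G`. -/
theorem exists_chartOrtho_bound (g : RMetric M) (p : M) {K : Set E3} (hK : IsCompact K)
    (hKp : K ⊆ (chartAt E3 p).target) : ∃ B : ℝ, ∀ z ∈ K, ∀ i j,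
      |chartOrtho g p ((chartAt E3 p).symm z) i j| ≤ B ∧
      |(chartOrtho g p ((chartAt E3 p).symm z))⁻¹ i j| ≤ B := by
  have hG : ∀ i j, ContinuousOn (fun z => chartGram g p z i j) K := fun i j =>
    (contDiffOn_chartGram g p i j).continuousOn.mono hKp
  have hGi : ∀ i j, ContinuousOn (fun z => (chartGram g p z)⁻¹ i j) K := fun i j z hz =>
    (contDiffAt_inv_entry (fun i j => (contDiffOn_chartGram g p i j).contDiffAt
      ((chartAt E3 p).open_target.mem_nhds (hKp hz))) (det_chartGram_ne_zero g (hKp hz))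
      i j).continuousAt.continuousWithinAt
  choose b hb using fun i j => hK.exists_bound_of_continuousOn (hG i j)
  choose b' hb' using fun i j => hK.exists_bound_of_continuousOn (hGi i j)
  set C := 1 + ∑ i, ∑ j, |b i j| + ∑ i, ∑ j, |b' i j| with hC
  have hs1 : 0 ≤ ∑ i, ∑ j, |b i j| := by positivity
  have hs2 : 0 ≤ ∑ i, ∑ j, |b' i j| := by positivity
  have hsum : ∀ (c : Fin 3 → Fin 3 → ℝ) i j, |c i j| ≤ ∑ i, ∑ j, |c i j| := fun c i j =>
    (Finset.single_le_sum (f := fun j => |c i j|) (fun _ _ => abs_nonneg _) (Finset.mem_univ j)).trans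
      (Finset.single_le_sum (f := fun i => ∑ j, |c i j|) (fun _ _ => by positivity)
        (Finset.mem_univ i))
  have hGC : ∀ z ∈ K, ∀ i j, |chartGram g p z i j| ≤ C := fun z hz i j => by
    have := hb i j z hz
    rw [Real.norm_eq_abs] at this
    linarith [hsum b i j, le_abs_self (b i j)]
  have hGC' : ∀ z ∈ K, ∀ i j, |(chartGram g p z)⁻¹ i j| ≤ C := fun z hz i j => by
    have := hb' i j z hz
    rw [Real.norm_eq_abs] at this
    linarith [hsum b' i j, le_abs_self (b' i j)]
  have hC1 : 1 ≤ C := by linarith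
  refine ⟨3 * C * C, fun z hz => ?_⟩
  set x := (chartAt E3 p).symm z with hx
  have hxp : x ∈ (chartAt E3 p).source := (chartAt E3 p).map_target (hKp hz)
  have hzx : chartAt E3 p x = z := (chartAt E3 p).right_inv (hKp hz)
  have h1 : ∀ i j, |chartOrtho g p x i j| ≤ C := by
    intro i j
    have h := congrFun (congrFun (chartOrtho_mul_transpose g hxp) i) i
    rw [hzx, Matrix.mul_apply] at h
    simp only [Matrix.transpose_apply] at h
    have h2 : chartOrtho g p x i j * chartOrtho g p x i j ≤ C := by
      calc _ ≤ ∑ j, chartOrtho g p x i j * chartOrtho g p x i j :=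
            Finset.single_le_sum (f := fun j => chartOrtho g p x i j * chartOrtho g p x i j)
              (fun _ _ => mul_self_nonneg _) (Finset.mem_univ j)
        _ ≤ C := by rw [h]; exact (le_abs_self _).trans (hGC' z hz i i)
    exact abs_le_of_sq_le_sq (by nlinarith) (by linarith)
  intro i j
  refine ⟨(h1 i j).trans (by nlinarith), ?_⟩
  rw [chartOrtho_inv g hxp, hzx, Matrix.mul_apply, Fin.sum_univ_three]
  simp only [Matrix.transpose_apply]
  have h3 : ∀ k, |chartOrtho g p x k i * chartGram g p z k j| ≤ C * C := fun k => by
    rw [abs_mul]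
    exact mul_le_mul (h1 k i) (hGC z hz k j) (abs_nonneg _) (by linarith)
  exact (abs_add_three _ _ _).trans (by linarith [h3 0, h3 1, h3 2])

variable {V : Type*} [NormedAddCommGroup V] [NormedSpace ℝ V] {r s : ℕ}

theorem frameComp_eq (g : RMetric M) (w : ℕ) {p x : M} (hp : x ∈ (chartAt E3 p).source)
    (T : M → TComp r s V) : frameComp g w x (T x) =
      WithLp.toLp 2 (changeFrame w (chartOrtho g p x) (chartComp w T p (chartAt E3 p x))) := by
  rw [frameComp, chartComp_chartAt T hp, ← changeFrame_mul, chartFrame_mul_chartOrtho g hp]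

variable [MeasurableSpace M] [BorelSpace M]

/-- The orthonormal frame depends on the chart picked at the point, so it need not be continuous; but
the picked chart is constant on the pieces of a countable measurable partition, and on each piece the
frame is a measurable function of the metric. -/
theorem aemeasurable_chartOrtho (g : RMetric M) (p : M) (μ : Measure M) (i j : Fin 3) :
    AEMeasurable (fun x => chartOrtho g p x i j) (μ.restrict (chartAt E3 p).source) := by
  classical
  set c := chartCenter M
  set A : ℕ → Set M := disjointed fun n => (chartAt E3 (c n)).source with hA
  have hmeas : ∀ q : M, MeasurableSet (chartAt E3 q).source := fun q =>
    (chartAt E3 q).open_source.measurableSet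
  have hAm : ∀ n, MeasurableSet (A n) := fun n => MeasurableSet.disjointed (fun k => hmeas _) n
  have hcover : (chartAt E3 p).source = ⋃ n, (A n ∩ (chartAt E3 p).source) := by
    rw [← iUnion_inter, hA, iUnion_disjointed, iUnion_chartCenter_source, univ_inter]
  have hpick : ∀ n, ∀ x ∈ A n, chartPick x = c n := by
    intro n x hx
    rw [hA, disjointed_eq_inter_compl] at hx
    have hfind : Nat.find (Classical.choose_spec (exists_chartCenters (M := M)) x) = n := by
      rw [Nat.find_eq_iff]
      exact ⟨hx.1, fun m hm => mem_iInter₂.1 hx.2 m hm⟩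
    exact congrArg c hfind
  rw [hcover, aemeasurable_iUnion_iff]
  intro n
  set q := c n
  have hU : ContinuousOn (chartAt E3 q) ((chartAt E3 q).source ∩ (chartAt E3 p).source) :=
    (chartAt E3 q).continuousOn.mono inter_subset_left
  have hJ : ∀ k, AEMeasurable (fun x => jac q p (chartAt E3 q x) i k)
      (μ.restrict ((chartAt E3 q).source ∩ (chartAt E3 p).source)) := fun k => by
    refine ContinuousOn.aemeasurable (ContinuousOn.comp (t := transDomain q p)
      (fun z hz => (contDiffAt_jac hz i k).continuousAt.continuousWithinAt) hU
      fun x hx => transDomain_of_mem hx.1 hx.2) ((hmeas _).inter (hmeas _))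
  have hG : AEMeasurable (fun x => (fun a b => chartGram g q (chartAt E3 q x) a b :
      Fin 3 → Fin 3 → ℝ)) (μ.restrict ((chartAt E3 q).source ∩ (chartAt E3 p).source)) := by
    refine aemeasurable_pi_lambda _ fun a => aemeasurable_pi_lambda _ fun b => ?_
    exact ContinuousOn.aemeasurable ((contDiffOn_chartGram g q a b).continuousOn.comp hU
      fun x hx => (chartAt E3 q).map_source hx.1) ((hmeas _).inter (hmeas _))
  have hsub : A n ∩ (chartAt E3 p).source ⊆ (chartAt E3 q).source ∩ (chartAt E3 p).source :=
    inter_subset_inter_left _ (disjointed_subset _ _)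
  have hprod : AEMeasurable (fun x => ∑ k, jac q p (chartAt E3 q x) i k *
      gsMat (Matrix.of fun a b => chartGram g q (chartAt E3 q x) a b) k j)
      (μ.restrict (A n ∩ (chartAt E3 p).source)) := by
    refine AEMeasurable.mono_measure ?_ (Measure.restrict_mono hsub le_rfl)
    exact Finset.aemeasurable_fun_sum _ fun k _ =>
      (hJ k).mul ((measurable_gsMat k j).comp_aemeasurable hG)
  refine hprod.congr ?_
  filter_upwards [ae_restrict_mem ((hAm n).inter (hmeas p))] with x hx
  have hxq : x ∈ (chartAt E3 q).source := (hsub hx).1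
  have hpk := hpick n x hx.1
  rw [chartOrtho, orthoFrame_eq, hpk, chartFrame_eq_mul hxq hx.2, Matrix.mul_assoc,
    Matrix.nonsing_inv_mul_cancel_left _ _ (isUnit_iff_ne_zero.2 (det_chartFrame_ne_zero hx.2)),
    Matrix.mul_apply]
  rfl

theorem aestronglyMeasurable_frameComp (g : RMetric M) {w : ℕ} {T : M → TComp r s V}
    (hT : IsSmoothTensor w T) (μ : Measure M) :
    AEStronglyMeasurable (fun x => frameComp g w x (T x)) μ := by
  rw [← Measure.restrict_univ (μ := μ), ← iUnion_chartCenter_source,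
    aestronglyMeasurable_iUnion_iff]
  intro n
  set q := chartCenter M n
  have hq : MeasurableSet (chartAt E3 q).source := (chartAt E3 q).open_source.measurableSet
  have hL : AEMeasurable (fun x => (fun i j => chartOrtho g q x i j : Fin 3 → Fin 3 → ℝ))
      (μ.restrict (chartAt E3 q).source) :=
    aemeasurable_pi_lambda _ fun a => aemeasurable_pi_lambda _ fun b =>
      aemeasurable_chartOrtho g q μ a b
  have hcoeff : ∀ K K' : TIdx r s, AEMeasurable (fun x => frameCoeff w (chartOrtho g q x) K K')
      (μ.restrict (chartAt E3 q).source) := fun K K' =>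
    (measurable_frameCoeff (L := fun G : Fin 3 → Fin 3 → ℝ => Matrix.of G) (fun i j =>
      (measurable_pi_apply j).comp (measurable_pi_apply i)) w K K').comp_aemeasurable hL
  have hcont : ∀ K', ContinuousOn (fun x => chartComp w T q (chartAt E3 q x) K')
      (chartAt E3 q).source := fun K' =>
    ContinuousOn.comp (t := (chartAt E3 q).target)
      (fun z hz => (hT.contDiffAt hz K').continuousAt.continuousWithinAt) (chartAt E3 q).continuousOn
      (chartAt E3 q).mapsTo
  have h : AEStronglyMeasurable (fun x => (fun K => ∑ K', frameCoeff w (chartOrtho g q x) K K' •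
      chartComp w T q (chartAt E3 q x) K' : TIdx r s → V)) (μ.restrict (chartAt E3 q).source) := by
    refine aestronglyMeasurable_pi fun K => ?_
    refine Finset.aestronglyMeasurable_fun_sum _ fun K' _ => ?_
    exact (hcoeff K K').aestronglyMeasurable.smul ((hcont K').aestronglyMeasurable hq)
  refine ((PiLp.continuous_toLp 2 _).comp_aestronglyMeasurable h).congr ?_
  filter_upwards [ae_restrict_mem hq] with x hx
  rw [frameComp_eq g w hx]
  congr 1
  ext K
  rw [changeFrame_apply]

end OrthoFrame

/-! ### The volume measure in charts -/

section Volume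

variable {M : Type*} [TopologicalSpace M] [ChartedSpace E3 M] [IsManifold 𝓘(ℝ, E3) ∞ M]

theorem continuousOn_sqrt_det_chartGram (g : RMetric M) (p : M) :
    ContinuousOn (fun z => √(chartGram g p z).det) (chartAt E3 p).target := by
  have hG : ∀ i j, ContinuousOn (fun z => chartGram g p z i j) (chartAt E3 p).target := fun i j =>
    (contDiffOn_chartGram g p i j).continuousOn
  refine ContinuousOn.sqrt ?_
  simp only [Matrix.det_fin_three]
  fun_prop

variable [MeasurableSpace M] [BorelSpace M]

/-- On compact sets of coordinates Lebesgue measure is dominated by the weighted volume. -/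
theorem exists_lintegral_chart_le (X : AFBackground M) (δ : ℝ) (p : M) {K : Set E3}
    (hK : IsCompact K) (hKp : K ⊆ (chartAt E3 p).target) :
    ∃ C : ℝ≥0∞, C ≠ ⊤ ∧ ∀ h : M → ℝ≥0∞, Measurable h →
      ∫⁻ z in K, h ((chartAt E3 p).symm z) ≤ C * ∫⁻ x, h x ∂(weightedVolume X δ) := by
  set e := chartAt E3 p
  set ρ : E3 → ℝ := fun z => √(chartGram X.metric p z).det with hρ
  set wt : M → ℝ := fun x => X.radius x ^ (-2 * δ - 3) with hw
  have hrpos : ∀ x, 0 < X.radius x := fun x => zero_lt_one.trans_le (X.one_le_radius x)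
  have hwc : Continuous wt := X.radius_smooth.continuous.rpow_const fun x => Or.inl (hrpos x).ne'
  have hρc : ContinuousOn ρ e.target := continuousOn_sqrt_det_chartGram X.metric p
  have hpos : ∀ z ∈ e.target, 0 < ρ z * wt (e.symm z) := fun z hz =>
    mul_pos (Real.sqrt_pos.2 (chartGram_posDef X.metric hz).det_pos) (Real.rpow_pos_of_pos (hrpos _) _)
  have hcont : ContinuousOn (fun z => ρ z * wt (e.symm z)) K :=
    (hρc.mul (hwc.comp_continuousOn e.continuousOn_symm)).mono hKp
  obtain ⟨c, hc0, hc⟩ : ∃ c : ℝ, 0 < c ∧ ∀ z ∈ K, c ≤ ρ z * wt (e.symm z) := by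
    rcases K.eq_empty_or_nonempty with rfl | hne
    · exact ⟨1, one_pos, by simp⟩
    · obtain ⟨z₀, hz₀, hmin⟩ := hK.exists_isMinOn hne hcont
      exact ⟨_, hpos z₀ (hKp hz₀), fun z hz => hmin hz⟩
  refine ⟨ENNReal.ofReal c⁻¹, ENNReal.ofReal_ne_top, fun h hh => ?_⟩
  have hwm : Measurable fun x => ENNReal.ofReal (wt x) := hwc.measurable.ennreal_ofReal
  have hρm : AEMeasurable (fun z => ENNReal.ofReal (ρ z)) (volume.restrict e.target) :=
    (hρc.aemeasurable e.open_target.measurableSet).ennreal_ofReal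
  have hem : AEMeasurable e.symm (volume.restrict e.target) :=
    e.continuousOn_symm.aemeasurable e.open_target.measurableSet
  have h1 : ∫⁻ z in e.target, (ENNReal.ofReal (ρ z) * (ENNReal.ofReal (wt (e.symm z)) * h (e.symm z)))
      ≤ ∫⁻ x, h x ∂(weightedVolume X δ) := by
    rw [weightedVolume, lintegral_withDensity_eq_lintegral_mul _ hwm hh]
    refine le_trans (le_of_eq ?_) (lintegral_mono' (le_iSup (fun p : M =>
      ((volume.restrict (chartAt E3 p).target).withDensity
        (fun z => ENNReal.ofReal (√(chartGram X.metric p z).det))).map (chartAt E3 p).symm) p) le_rfl)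
    have hem' : AEMeasurable e.symm ((volume.restrict e.target).withDensity
        (fun z => ENNReal.ofReal (ρ z))) := hem.mono_ac (withDensity_absolutelyContinuous _ _)
    rw [lintegral_map' (hwm.mul hh).aemeasurable hem']
    exact (lintegral_withDensity_eq_lintegral_mul₀ hρm ((hwm.mul hh).comp_aemeasurable hem)).symm
  calc ∫⁻ z in K, h (e.symm z)
      ≤ ∫⁻ z in K, ENNReal.ofReal c⁻¹ *
        (ENNReal.ofReal (ρ z) * (ENNReal.ofReal (wt (e.symm z)) * h (e.symm z))) := by
        refine setLIntegral_mono' hK.measurableSet fun z hz => ?_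
        rw [← mul_assoc, ← mul_assoc, ← ENNReal.ofReal_mul (inv_nonneg.2 hc0.le),
          ← ENNReal.ofReal_mul (by positivity)]
        have : 1 ≤ c⁻¹ * ρ z * wt (e.symm z) := by
          rw [mul_assoc, ← inv_mul_cancel₀ hc0.ne']
          exact mul_le_mul_of_nonneg_left (hc z hz) (inv_nonneg.2 hc0.le)
        calc h (e.symm z) = ENNReal.ofReal 1 * h (e.symm z) := by simp
          _ ≤ _ := by gcongr
    _ ≤ ∫⁻ z in e.target, ENNReal.ofReal c⁻¹ *
        (ENNReal.ofReal (ρ z) * (ENNReal.ofReal (wt (e.symm z)) * h (e.symm z))) :=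
        lintegral_mono_set hKp
    _ = ENNReal.ofReal c⁻¹ * ∫⁻ z in e.target,
        (ENNReal.ofReal (ρ z) * (ENNReal.ofReal (wt (e.symm z)) * h (e.symm z))) :=
        lintegral_const_mul' _ _ ENNReal.ofReal_ne_top
    _ ≤ _ := by gcongr

theorem ae_chart_of_ae_weightedVolume (X : AFBackground M) (δ : ℝ) (p : M) {K : Set E3}
    (hK : IsCompact K) (hKp : K ⊆ (chartAt E3 p).target) {P : M → Prop}
    (hP : ∀ᵐ x ∂(weightedVolume X δ), P x) :
    ∀ᵐ z ∂(volume.restrict K), P ((chartAt E3 p).symm z) := by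
  obtain ⟨C, hC, h⟩ := exists_lintegral_chart_le X δ p hK hKp
  obtain ⟨N, hN, hNm, hN0⟩ := exists_measurable_superset_of_null hP
  have h1 := h (N.indicator 1) (measurable_one.indicator hNm)
  rw [lintegral_indicator_one hNm, hN0, mul_zero, nonpos_iff_eq_zero] at h1
  have hem : AEMeasurable (chartAt E3 p).symm (volume.restrict K) :=
    ((chartAt E3 p).continuousOn_symm.mono hKp).aemeasurable hK.measurableSet
  filter_upwards [(lintegral_eq_zero_iff' (f := fun z => N.indicator (1 : M → ℝ≥0∞)
    ((chartAt E3 p).symm z)) ((measurable_one.indicator hNm).comp_aemeasurable hem)).1 h1] with z hz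
  by_contra hcon
  have : (chartAt E3 p).symm z ∈ N := hN hcon
  simp [this] at hz

end Volume

/-! ### Slice coordinates along the surface -/

section Slice

variable {M : Type*} [TopologicalSpace M] [ChartedSpace E3 M] [IsManifold 𝓘(ℝ, E3) ∞ M]
  {X : AFBackground M} {S : Type*} [TopologicalSpace S] [ChartedSpace E2 S]

/-- Coordinates `P = (z, t)` near a point of the surface in which the surface is `t = 0`: the
domain of `P` consists of coordinates in the chart of `M` at `p`, and `z` restricts to the chart
`θ` of the surface.  On the box of radius `ε` around `(z₀, 0)` the surface has no further points. -/
structure SliceChart (Y : SeparatingSurface X S) (p : M) where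
  θ : OpenPartialHomeomorph S E2
  θ_mem : θ ∈ IsManifold.maximalAtlas 𝓘(ℝ, E2) ∞ S
  P : OpenPartialHomeomorph E3 (E2 × ℝ)
  contDiffOn : ContDiffOn ℝ ∞ P P.source
  contDiffOn_symm : ContDiffOn ℝ ∞ P.symm P.target
  source_subset : P.source ⊆ (chartAt E3 p).target
  z₀ : E2
  ε : ℝ
  ε_pos : 0 < ε
  ball_subset : Metric.closedBall z₀ ε ⊆ θ.target
  box_subset : Metric.closedBall z₀ ε ×ˢ Icc (-ε) ε ⊆ P.target
  slice : ∀ z ∈ Metric.closedBall z₀ ε,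
    (chartAt E3 p).symm (P.symm (z, 0)) = Y.ι (θ.symm z)
  range_subset : ∀ z ∈ Metric.closedBall z₀ ε, ∀ t ∈ Icc (-ε) ε,
    (chartAt E3 p).symm (P.symm (z, t)) ∈ range Y.ι → t = 0

/-- A complement of a plane in three-space, as it occurs in the local form of an immersion, is a
line. -/
theorem exists_continuousLinearEquiv_prod {F : Type*} [NormedAddCommGroup F] [NormedSpace ℝ F]
    (L : (E2 × F) ≃L[ℝ] E3) : Nonempty (F ≃L[ℝ] ℝ) := by
  have h1 : FiniteDimensional ℝ (E2 × F) := L.symm.toLinearEquiv.finiteDimensional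
  have h2 : FiniteDimensional ℝ F :=
    FiniteDimensional.of_injective (LinearMap.inr ℝ E2 F) LinearMap.inr_injective
  have h3 := L.toLinearEquiv.finrank_eq
  rw [Module.finrank_prod] at h3
  simp at h3
  exact ⟨ContinuousLinearEquiv.ofFinrankEq (by rw [Module.finrank_self]; omega)⟩

/-- Slice coordinates exist: in the local form of the immersion the surface is a plane, and since `ι`
is a topological embedding, a small box contains no other part of the surface. -/
theorem exists_sliceChart (Y : SeparatingSurface X S) (y₀ : S) :
    ∃ c : SliceChart Y (Y.ι y₀), y₀ ∈ c.θ.source ∧ c.θ y₀ = c.z₀ := by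
  have him := Y.embedding.isImmersion.isImmersionAt y₀
  set p := Y.ι y₀
  obtain ⟨ℓ⟩ := exists_continuousLinearEquiv_prod him.equiv
  let Θ := him.codChart
  let θ := him.domChart
  let L : E3 ≃L[ℝ] E2 × ℝ := him.equiv.symm.trans ((ContinuousLinearEquiv.refl ℝ E2).prodCongr ℓ)
  let Q := (chartAt E3 p).symm ≫ₕ Θ
  let P := Q ≫ₕ L.toHomeomorph.toOpenPartialHomeomorph
  have hΘ := him.codChart_mem_maximalAtlas
  have hp : chartAt E3 p ∈ IsManifold.maximalAtlas 𝓘(ℝ, E3) ∞ M := IsManifold.chart_mem_maximalAtlas p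
  have hPs : P.source = Q.source := by simp [P]
  have hPt : P.target = L.symm ⁻¹' Q.target := by simp [P]
  have hP : ∀ z, P z = L (Θ ((chartAt E3 p).symm z)) := fun z => rfl
  have hPsymm : ∀ x, P.symm x = chartAt E3 p (Θ.symm (L.symm x)) := fun z => rfl
  have hc1 : ContDiffOn ℝ ∞ P P.source := by
    rw [hPs]
    exact L.contDiff.comp_contDiffOn (contDiffOn_chartChange hp hΘ)
  have hc2 : ContDiffOn ℝ ∞ P.symm P.target := by
    rw [hPt]
    exact (contDiffOn_chartChange hΘ hp).comp L.symm.contDiff.contDiffOn (fun x hx => hx)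
  have hwr : ∀ z ∈ θ.target, Θ (Y.ι (θ.symm z)) = him.equiv (z, 0) := fun z hz => by
    have h := him.writtenInCharts
    have := @h z (by simpa [θ] using hz)
    simpa [Θ, θ] using this
  have hy₀ : y₀ ∈ θ.source := him.mem_domChart_source
  have hΘs : ∀ z ∈ θ.target, Y.ι (θ.symm z) ∈ Θ.source := fun z hz =>
    him.source_subset_preimage_source (θ.map_target hz)
  have hL : ∀ z, L.symm (z, 0) = him.equiv (z, 0) := fun z => by simp [L]
  have hslice : ∀ z ∈ θ.target, Θ.symm (L.symm (z, 0)) = Y.ι (θ.symm z) := fun z hz => by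
    rw [hL, ← hwr z hz, Θ.left_inv (hΘs z hz)]
  have hz₀ : θ y₀ ∈ θ.target := θ.map_source hy₀
  -- the surface near `y₀` is cut out by an open set, since `ι` is a topological embedding
  obtain ⟨W, hW, hWθ⟩ : ∃ W : Set M, IsOpen W ∧ Y.ι ⁻¹' W = θ.source := by
    obtain ⟨W, hW, h⟩ := Y.embedding.isEmbedding.isInducing.isOpen_iff.1 θ.open_source
    exact ⟨W, hW, h⟩
  have hx0 : (θ y₀, (0 : ℝ)) ∈ P.target := by
    rw [hPt]
    show L.symm (θ y₀, 0) ∈ Q.target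
    simp only [Q, OpenPartialHomeomorph.trans_target, OpenPartialHomeomorph.symm_target,
      mem_inter_iff, mem_preimage, hslice _ hz₀, θ.left_inv hy₀]
    refine ⟨?_, mem_chart_source E3 p⟩
    rw [hL, ← hwr _ hz₀]
    exact Θ.map_source (hΘs _ hz₀)
  have hcont : ContinuousAt (fun x => (chartAt E3 p).symm (P.symm x)) (θ y₀, (0 : ℝ)) := by
    have h1 := P.symm.continuousAt hx0
    have h2 : P.symm (θ y₀, 0) ∈ (chartAt E3 p).target := by
      have := P.map_target hx0
      rw [hPs] at this
      exact this.1
    exact ContinuousAt.comp ((chartAt E3 p).symm.continuousAt h2) h1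
  have hval : (chartAt E3 p).symm (P.symm (θ y₀, 0)) = p := by
    rw [hPsymm, hslice _ hz₀, θ.left_inv hy₀]
    exact (chartAt E3 p).left_inv (mem_chart_source E3 p)
  have hnhds : ∀ᶠ x in 𝓝 (θ y₀, (0 : ℝ)), x ∈ P.target ∧
      (chartAt E3 p).symm (P.symm x) ∈ W ∧ x.1 ∈ θ.target := by
    refine (P.open_target.eventually_mem hx0).and ((hcont.eventually_mem ?_).and ?_)
    · rw [hval]
      refine hW.mem_nhds ?_
      rw [← hWθ] at hy₀
      exact hy₀
    · exact continuous_fst.continuousAt.eventually_mem (θ.open_target.mem_nhds hz₀)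
  obtain ⟨δ, hδ, hball⟩ := Metric.eventually_nhds_iff_ball.1 hnhds
  have hbox : ∀ z ∈ Metric.closedBall (θ y₀) (δ / 2), ∀ t ∈ Icc (-(δ / 2)) (δ / 2),
      ((z, t) : E2 × ℝ) ∈ Metric.ball (θ y₀, (0 : ℝ)) δ := by
    intro z hz t ht
    rw [Metric.mem_ball, Prod.dist_eq, max_lt_iff]
    rw [Metric.mem_closedBall] at hz
    refine ⟨by simp only; linarith, ?_⟩
    rw [Real.dist_eq, sub_zero]
    exact (abs_le.2 ht).trans_lt (by linarith)
  have h0 : (0 : ℝ) ∈ Icc (-(δ / 2)) (δ / 2) := ⟨by linarith, by linarith⟩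
  have hsl : ∀ z ∈ Metric.closedBall (θ y₀) (δ / 2),
      (chartAt E3 p).symm (P.symm (z, 0)) = Y.ι (θ.symm z) := fun z hz => by
    obtain ⟨h1, -, h3⟩ := hball _ (hbox z hz 0 h0)
    have := P.map_target h1
    rw [hPs] at this
    rw [hPsymm, hslice z h3, (chartAt E3 p).left_inv]
    have h4 : Θ.symm (L.symm (z, 0)) ∈ (chartAt E3 p).source := by
      rw [hPt] at h1
      exact h1.2
    rwa [hslice z h3] at h4
  refine ⟨⟨θ, him.domChart_mem_maximalAtlas, P, hc1, hc2, ?_, θ y₀, δ / 2, half_pos hδ, ?_, ?_, hsl,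
    ?_⟩, hy₀, rfl⟩
  · rw [hPs]; exact fun z hz => hz.1
  · exact fun z hz => (hball _ (hbox z hz 0 h0)).2.2
  · rintro ⟨z, t⟩ ⟨hz, ht⟩
    exact (hball _ (hbox z hz t ht)).1
  · rintro z hz t ht ⟨y, hy⟩
    obtain ⟨h1, h2, h3⟩ := hball _ (hbox z hz t ht)
    have hyθ : y ∈ θ.source := by
      rw [← hWθ]
      show Y.ι y ∈ W
      rw [hy]; exact h2
    have h4 := P.map_target h1
    have h5 : P ((chartAt E3 p) (Y.ι y)) = (z, t) := by
      rw [hy, (chartAt E3 p).right_inv (by rw [hPs] at h4; exact h4.1), P.right_inv h1]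
    have h6 : Y.ι y ∈ (chartAt E3 p).source := by
      rw [hy]; exact (chartAt E3 p).map_target (by rw [hPs] at h4; exact h4.1)
    rw [hP, (chartAt E3 p).left_inv h6, ← θ.left_inv hyθ, hwr _ (θ.map_source hyθ), ← hL,
      ContinuousLinearEquiv.apply_symm_apply] at h5
    exact (congrArg Prod.snd h5).symm

end Slice

/-! ### The area measure in slice coordinates -/

section Tangent

variable {M : Type*} [TopologicalSpace M] [ChartedSpace E3 M]

/-- The components in the chart at `p` of tangent vectors at `x`. -/
def toChart (p x : M) : E3 →L[ℝ] E3 := fderiv ℝ (transMap x p) (chartAt E3 x x)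

theorem matForm_eq_of_clm (G : Matrix (Fin 3) (Fin 3) ℝ) (A : E3 →L[ℝ] E3) (v v' : E3) :
    matForm ((Matrix.of fun i j => (A (stdVec j)) i)ᵀ * G * Matrix.of fun i j => (A (stdVec j)) i)
      v v' = matForm G (A v) (A v') := by
  simp only [matForm, clm_apply_eq_mulVec A v, clm_apply_eq_mulVec A v', Matrix.mulVec, dotProduct,
    Matrix.mul_apply, Matrix.transpose_apply, Fin.sum_univ_three]
  ring

variable [IsManifold 𝓘(ℝ, E3) ∞ M]

theorem inner_eq_matForm (g : RMetric M) {p x : M} (hp : x ∈ (chartAt E3 p).source) (v v' : E3) :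
    g.inner x v v' = matForm (chartGram g p (chartAt E3 p x)) (toChart p x v) (toChart p x v') := by
  have hz := transDomain_of_mem (mem_chart_source E3 x) hp
  have h1 := chartGram_trans g hz
  rw [chartGram_self, transMap, (chartAt E3 x).left_inv (mem_chart_source E3 x)] at h1
  rw [inner_eq_gram, h1]
  exact matForm_eq_of_clm _ _ v v'

theorem chartFrame_mulVec_toChart {p x : M} (hp : x ∈ (chartAt E3 p).source) (v : E3) (i : Fin 3) :
    toChart p x v i = ((chartFrame p x)⁻¹.mulVec fun i => v i) i := by
  rw [chartFrame_inv hp, toChart, clm_apply_eq_mulVec]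
  rfl

theorem fderiv_chart_comp {E : Type*} [NormedAddCommGroup E] [NormedSpace ℝ E] {f : E → M} {z : E}
    {p q : M} (hf : ContinuousAt f z) (hp : f z ∈ (chartAt E3 p).source)
    (hq : f z ∈ (chartAt E3 q).source) (hd : DifferentiableAt ℝ (chartAt E3 p ∘ f) z) :
    fderiv ℝ (chartAt E3 q ∘ f) z =
      (fderiv ℝ (transMap p q) (chartAt E3 p (f z))).comp (fderiv ℝ (chartAt E3 p ∘ f) z) := by
  have h1 : chartAt E3 q ∘ f =ᶠ[𝓝 z] transMap p q ∘ (chartAt E3 p ∘ f) := by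
    filter_upwards [hf.eventually_mem ((chartAt E3 p).open_source.mem_nhds hp)] with x hx
    simp [transMap, (chartAt E3 p).left_inv hx]
  rw [h1.fderiv_eq]
  exact fderiv_comp z ((contDiffAt_transMap (transDomain_of_mem hp hq)).differentiableAt (by simp)) hd

theorem toChart_fderiv {E : Type*} [NormedAddCommGroup E] [NormedSpace ℝ E] {f : E → M} {z : E}
    {p x : M} (hf : ContinuousAt f z) (hx : f z = x) (hp : x ∈ (chartAt E3 p).source)
    (hd : DifferentiableAt ℝ (chartAt E3 x ∘ f) z) (v : E) :
    toChart p x (fderiv ℝ (chartAt E3 x ∘ f) z v) = fderiv ℝ (chartAt E3 p ∘ f) z v := by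
  subst hx
  rw [fderiv_chart_comp hf (mem_chart_source E3 (f z)) hp hd]
  rfl

end Tangent

section Area

variable {M : Type*} [TopologicalSpace M] [ChartedSpace E3 M] [IsManifold 𝓘(ℝ, E3) ∞ M]
  {X : AFBackground M} {S : Type*} [TopologicalSpace S] [ChartedSpace E2 S]

namespace SliceChart

variable {Y : SeparatingSurface X S} {p : M} (c : SliceChart Y p)

/-- The surface in the coordinates of the chart at `p`. -/
def ψ (z : E2) : E3 := c.P.symm (z, 0)

theorem zero_mem_Icc : (0 : ℝ) ∈ Icc (-c.ε) c.ε := ⟨by linarith [c.ε_pos], c.ε_pos.le⟩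

theorem mk_mem_target {z : E2} (hz : z ∈ Metric.closedBall c.z₀ c.ε) : (z, (0 : ℝ)) ∈ c.P.target :=
  c.box_subset ⟨hz, c.zero_mem_Icc⟩

theorem ψ_mem_source {z : E2} (hz : z ∈ Metric.closedBall c.z₀ c.ε) : c.ψ z ∈ c.P.source :=
  c.P.map_target (c.mk_mem_target hz)

theorem ψ_mem_target {z : E2} (hz : z ∈ Metric.closedBall c.z₀ c.ε) :
    c.ψ z ∈ (chartAt E3 p).target :=
  c.source_subset (c.ψ_mem_source hz)

theorem contDiffAt_ψ {z : E2} (hz : z ∈ Metric.closedBall c.z₀ c.ε) : ContDiffAt ℝ ∞ c.ψ z := by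
  have h1 : ContDiffAt ℝ ∞ c.P.symm (z, 0) :=
    c.contDiffOn_symm.contDiffAt (c.P.open_target.mem_nhds (c.mk_mem_target hz))
  exact h1.comp z (contDiffAt_id.prodMk contDiffAt_const)

theorem isCompact_ball : IsCompact (Metric.closedBall c.z₀ c.ε) := isCompact_closedBall _ _

/-- The part of the surface covered by the slice chart. -/
def U : Set S := c.θ.source ∩ c.θ ⁻¹' Metric.ball c.z₀ c.ε

theorem isOpen_U : IsOpen c.U := c.θ.isOpen_inter_preimage Metric.isOpen_ball

theorem mem_closedBall_of_mem {y : S} (hy : y ∈ c.U) : c.θ y ∈ Metric.closedBall c.z₀ c.ε :=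
  Metric.ball_subset_closedBall hy.2

theorem symm_ψ {y : S} (hy : y ∈ c.U) : (chartAt E3 p).symm (c.ψ (c.θ y)) = Y.ι y := by
  rw [ψ, c.slice _ (c.mem_closedBall_of_mem hy), c.θ.left_inv hy.1]

theorem ι_mem_source {y : S} (hy : y ∈ c.U) : Y.ι y ∈ (chartAt E3 p).source := by
  rw [← c.symm_ψ hy]
  exact (chartAt E3 p).map_target (c.ψ_mem_target (c.mem_closedBall_of_mem hy))

theorem chart_ι {y : S} (hy : y ∈ c.U) : chartAt E3 p (Y.ι y) = c.ψ (c.θ y) := by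
  rw [← c.symm_ψ hy, (chartAt E3 p).right_inv (c.ψ_mem_target (c.mem_closedBall_of_mem hy))]

/-- The first fundamental form in the coordinates `z`. -/
def form (z : E2) : Matrix (Fin 2) (Fin 2) ℝ :=
  Matrix.of fun a b => matForm (chartGram X.metric p (c.ψ z)) (fderiv ℝ c.ψ z (stdVec a))
    (fderiv ℝ c.ψ z (stdVec b))

theorem continuousOn_form (a b : Fin 2) :
    ContinuousOn (fun z => c.form z a b) (Metric.closedBall c.z₀ c.ε) := by
  have h1 : ∀ (a : Fin 2) (i : Fin 3), ContinuousOn (fun z => fderiv ℝ c.ψ z (stdVec a) i)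
      (Metric.closedBall c.z₀ c.ε) := fun a i z hz => by
    have := ((c.contDiffAt_ψ hz).fderiv_right (m := ∞) (by norm_cast)).continuousAt
    have h2 : ContinuousAt (fun z => fderiv ℝ c.ψ z (stdVec a)) z := this.clm_apply continuousAt_const
    exact ((EuclideanSpace.proj (𝕜 := ℝ) i).continuous.continuousAt.comp h2).continuousWithinAt
  have h2 : ∀ i j, ContinuousOn (fun z => chartGram X.metric p (c.ψ z) i j)
      (Metric.closedBall c.z₀ c.ε) := fun i j =>
    (contDiffOn_chartGram X.metric p i j).continuousOn.comp
      (fun z hz => (c.contDiffAt_ψ hz).continuousAt.continuousWithinAt) (fun z hz => c.ψ_mem_target hz)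
  simp only [form, matForm, Matrix.of_apply]
  refine continuousOn_finsetSum _ fun i _ => continuousOn_finsetSum _ fun j _ => ?_
  exact ((h1 a i).mul (h2 i j)).mul (h1 b j)

theorem exists_sqrt_det_form_le : ∃ C : ℝ≥0∞, C ≠ ⊤ ∧ ∀ z ∈ Metric.closedBall c.z₀ c.ε,
    ENNReal.ofReal (√(c.form z).det) ≤ C := by
  have h : ContinuousOn (fun z => √(c.form z).det) (Metric.closedBall c.z₀ c.ε) := by
    refine ContinuousOn.sqrt ?_
    simp only [Matrix.det_fin_two]
    exact ((c.continuousOn_form _ _).mul (c.continuousOn_form _ _)).sub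
      ((c.continuousOn_form _ _).mul (c.continuousOn_form _ _))
  obtain ⟨C, hC⟩ := c.isCompact_ball.exists_bound_of_continuousOn h
  exact ⟨ENNReal.ofReal C, ENNReal.ofReal_ne_top, fun z hz =>
    ENNReal.ofReal_le_ofReal ((le_abs_self _).trans (hC z hz))⟩

end SliceChart

variable [IsManifold 𝓘(ℝ, E2) ∞ S]

theorem toChart_mfderiv_surface (Y : SeparatingSurface X S) {p : M} {q : S} {z : E2}
    (hz : z ∈ (chartAt E2 q).target) (hp : Y.ι ((chartAt E2 q).symm z) ∈ (chartAt E3 p).source)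
    (v : E2) :
    toChart p (Y.ι ((chartAt E2 q).symm z))
      (mfderiv 𝓘(ℝ, E2) 𝓘(ℝ, E3) (Y.ι ∘ (chartAt E2 q).symm) z v : E3) =
    fderiv ℝ (chartAt E3 p ∘ Y.ι ∘ (chartAt E2 q).symm) z v := by
  set f := Y.ι ∘ (chartAt E2 q).symm
  have h1 : ContMDiffAt 𝓘(ℝ, E2) 𝓘(ℝ, E3) ∞ f z :=
    ContMDiffAt.comp z Y.embedding.isImmersion.contMDiff.contMDiffAt
      ((contMDiffOn_chart_symm (I := 𝓘(ℝ, E2)) (x := q)).contMDiffAt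
        ((chartAt E2 q).open_target.mem_nhds hz))
  have h2 : MDifferentiableAt 𝓘(ℝ, E2) 𝓘(ℝ, E3) f z := h1.mdifferentiableAt (by simp)
  have h4 : (extChartAt 𝓘(ℝ, E3) (f z) ∘ f ∘ (PartialEquiv.refl E2).symm : E2 → E3)
    = chartAt E3 (f z) ∘ f := by
    ext x : 1
    simp
  have h3 := h2.differentiableWithinAt_writtenInExtChartAt
  have h5 : fderivWithin ℝ (writtenInExtChartAt 𝓘(ℝ, E2) 𝓘(ℝ, E3) z f) (range 𝓘(ℝ, E2))
      (extChartAt 𝓘(ℝ, E2) z z) = fderiv ℝ (chartAt E3 (f z) ∘ f) z := by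
    simp only [writtenInExtChartAt, extChartAt_model_space_eq_id, modelWithCornersSelf_coe, range_id,
      fderivWithin_univ, h4]
    rfl
  simp only [writtenInExtChartAt, extChartAt_model_space_eq_id, modelWithCornersSelf_coe, range_id,
    differentiableWithinAt_univ, h4] at h3
  have h6 := h2.mfderiv.trans h5
  rw [h6]
  exact toChart_fderiv h1.continuousAt rfl hp h3 v

namespace SliceChart

variable {Y : SeparatingSurface X S} {p : M} (c : SliceChart Y p)

/-- The area density in a chart of the surface, in terms of that in the slice coordinates. -/
theorem surfaceGram_eq {q : S} {z : E2} (hz : z ∈ (chartAt E2 q).target)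
    (hU : (chartAt E2 q).symm z ∈ c.U) :
    √(surfaceGram Y q z).det =
      |(fderiv ℝ (c.θ ∘ (chartAt E2 q).symm) z).det| * √(c.form (c.θ ((chartAt E2 q).symm z))).det := by
  set τ := c.θ ∘ (chartAt E2 q).symm
  have hp := c.ι_mem_source hU
  have hev : chartAt E3 p ∘ Y.ι ∘ (chartAt E2 q).symm =ᶠ[𝓝 z] c.ψ ∘ τ := by
    filter_upwards [((chartAt E2 q).symm.continuousAt hz).eventually_mem (c.isOpen_U.mem_nhds hU)]
      with x hx
    exact c.chart_ι hx
  have hτ : DifferentiableAt ℝ τ z := by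
    refine ((contDiffOn_chartChange (IsManifold.chart_mem_maximalAtlas q) c.θ_mem).contDiffAt
      ((OpenPartialHomeomorph.open_source _).mem_nhds ?_)).differentiableAt (by simp)
    exact ⟨hz, hU.1⟩
  have hψ : DifferentiableAt ℝ c.ψ (τ z) :=
    (c.contDiffAt_ψ (c.mem_closedBall_of_mem hU)).differentiableAt (by simp)
  have hchain : ∀ v, fderiv ℝ (chartAt E3 p ∘ Y.ι ∘ (chartAt E2 q).symm) z v =
      fderiv ℝ c.ψ (τ z) (fderiv ℝ τ z v) := fun v => by
    rw [hev.fderiv_eq, fderiv_comp z hψ hτ]; rfl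
  set J : Matrix (Fin 2) (Fin 2) ℝ := Matrix.of fun i j => (fderiv ℝ τ z (stdVec j)) i with hJ
  have hdet : (fderiv ℝ τ z).det = J.det := by
    rw [ContinuousLinearMap.det, ← LinearMap.det_toMatrix (EuclideanSpace.basisFun (Fin 2) ℝ).toBasis]
    congr 1
  have hexp : ∀ a, fderiv ℝ c.ψ (τ z) (fderiv ℝ τ z (stdVec a)) =
      ∑ b, J b a • fderiv ℝ c.ψ (τ z) (stdVec b) := fun a => by
    conv_lhs => rw [eq_sum_stdVec (fderiv ℝ τ z (stdVec a))]
    simp [hJ]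
  have hG : surfaceGram Y q z = Jᵀ * c.form (τ z) * J := by
    ext a b
    have h1 : surfaceGram Y q z a b = matForm (chartGram X.metric p (c.ψ (τ z)))
        (fderiv ℝ c.ψ (τ z) (fderiv ℝ τ z (stdVec a)))
        (fderiv ℝ c.ψ (τ z) (fderiv ℝ τ z (stdVec b))) := by
      refine (inner_eq_matForm X.metric hp _ _).trans ?_
      rw [toChart_mfderiv_surface Y hz hp, toChart_mfderiv_surface Y hz hp, hchain, hchain,
        c.chart_ι hU]
      rfl
    rw [h1, hexp, hexp]
    simp only [matForm, form, Matrix.mul_apply, Matrix.transpose_apply, Matrix.of_apply,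
      Fin.sum_univ_three, Fin.sum_univ_two, PiLp.add_apply, PiLp.smul_apply, smul_eq_mul]
    ring
  rw [hG, hdet, Matrix.det_mul, Matrix.det_mul, Matrix.det_transpose, mul_right_comm, ← sq,
    Real.sqrt_mul (sq_nonneg _), Real.sqrt_sq_eq_abs]
  rfl

variable [MeasurableSpace S] [BorelSpace S]

/-- Area is dominated by Lebesgue measure of the slice coordinates. -/
theorem exists_area_le : ∃ C : ℝ≥0∞, C ≠ ⊤ ∧ (surfaceArea Y).restrict c.U ≤
    C • (volume.restrict (Metric.ball c.z₀ c.ε)).map c.θ.symm := by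
  obtain ⟨C, hC, hle⟩ := c.exists_sqrt_det_form_le
  refine ⟨C, hC, ?_⟩
  have hUm : MeasurableSet c.U := c.isOpen_U.measurableSet
  set κ := C • (volume.restrict (Metric.ball c.z₀ c.ε)).map c.θ.symm with hκ
  have hθm : AEMeasurable c.θ.symm (volume.restrict (Metric.ball c.z₀ c.ε)) :=
    (c.θ.continuousOn_symm.mono (Metric.ball_subset_closedBall.trans c.ball_subset)).aemeasurable
      Metric.isOpen_ball.measurableSet
  have key : ∀ q : S, (((volume.restrict (chartAt E2 q).target).withDensity
      (fun z => ENNReal.ofReal (√(surfaceGram Y q z).det))).map (chartAt E2 q).symm).restrict c.U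
      ≤ κ := by
    intro q
    set e := chartAt E2 q
    set τ := c.θ ∘ e.symm with hτ
    have hem : AEMeasurable e.symm (volume.restrict e.target) :=
      e.continuousOn_symm.aemeasurable e.open_target.measurableSet
    refine Measure.le_iff.2 fun A hA => ?_
    set B := A ∩ c.U with hBdef
    have hB : MeasurableSet B := hA.inter hUm
    have hBm : MeasurableSet (e.target ∩ e.symm ⁻¹' B) := by
      have := (continuousOn_iff_continuous_domRestrict.1 e.continuousOn_symm).measurable hB
      have h2 := (MeasurableEmbedding.subtype_coe
        e.open_target.measurableSet).measurableSet_image.2 this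
      convert h2 using 1
      ext x; simp [and_comm]
    rw [Measure.restrict_apply hA, Measure.map_apply_of_aemeasurable
      (hem.mono_ac (withDensity_absolutelyContinuous _ _)) hB, withDensity_apply',
      Measure.restrict_restrict' e.open_target.measurableSet, inter_comm]
    set D := e.target ∩ e.symm ⁻¹' B
    have hτd : ∀ z ∈ D, HasFDerivWithinAt τ (fderiv ℝ τ z) D z := fun z hz => by
      refine DifferentiableAt.hasFDerivAt ?_ |>.hasFDerivWithinAt
      refine ((contDiffOn_chartChange (IsManifold.chart_mem_maximalAtlas q) c.θ_mem).contDiffAt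
        ((OpenPartialHomeomorph.open_source _).mem_nhds ?_)).differentiableAt (by simp)
      exact ⟨hz.1, hz.2.2.1⟩
    have hinj : InjOn τ D := fun z hz z' hz' h =>
      e.symm.injOn hz.1 hz'.1 (c.θ.injOn hz.2.2.1 hz'.2.2.1 h)
    calc ∫⁻ z in D, ENNReal.ofReal (√(surfaceGram Y q z).det)
        ≤ ∫⁻ z in D, ENNReal.ofReal |(fderiv ℝ τ z).det| * C := by
          refine setLIntegral_mono' hBm fun z hz => ?_
          rw [c.surfaceGram_eq hz.1 hz.2.2, ENNReal.ofReal_mul (abs_nonneg _)]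
          exact mul_le_mul_right (hle _ (c.mem_closedBall_of_mem hz.2.2)) _
      _ = ∫⁻ _ in τ '' D, C :=
          (lintegral_image_eq_lintegral_abs_det_fderiv_mul volume hBm hτd hinj fun _ => C).symm
      _ = C * volume (τ '' D) := by rw [setLIntegral_const]
      _ ≤ C * volume (c.θ.symm ⁻¹' A ∩ Metric.ball c.z₀ c.ε) := by
          refine mul_le_mul_right (measure_mono ?_) _
          rintro _ ⟨z, hz, rfl⟩
          refine ⟨?_, hz.2.2.2⟩
          simp only [hτ, mem_preimage, Function.comp, c.θ.left_inv hz.2.2.1]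
          exact hz.2.1
      _ = κ A := by
          rw [hκ, Measure.smul_apply, Measure.map_apply_of_aemeasurable hθm hA,
            Measure.restrict_apply' Metric.isOpen_ball.measurableSet, smul_eq_mul]
  have h2 : surfaceArea Y ≤ κ + (surfaceArea Y).restrict c.Uᶜ := by
    refine iSup_le fun q => ?_
    conv_lhs => rw [← Measure.restrict_add_restrict_compl (μ := Measure.map _ _) hUm]
    refine add_le_add (key q) (Measure.restrict_mono le_rfl (le_iSup (fun q : S =>
      ((volume.restrict (chartAt E2 q).target).withDensity
      (fun z => ENNReal.ofReal (√(surfaceGram Y q z).det))).map (chartAt E2 q).symm) q))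
  calc (surfaceArea Y).restrict c.U ≤ (κ + (surfaceArea Y).restrict c.Uᶜ).restrict c.U :=
        Measure.restrict_mono le_rfl h2
    _ = κ.restrict c.U := by
        rw [Measure.restrict_add, Measure.restrict_restrict hUm]; simp
    _ ≤ κ := Measure.restrict_le_self

end SliceChart

end Area

/-! ### The trace inequality in coordinates -/

section Euclidean

theorem ennreal_add_sq_le (a b : ℝ≥0∞) : (a + b) ^ 2 ≤ 2 * a ^ 2 + 2 * b ^ 2 := by
  induction a using ENNReal.recTopCoe with
  | top => simp
  | coe a =>
    induction b using ENNReal.recTopCoe with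
    | top => simp
    | coe b =>
      norm_cast
      rw [← NNReal.coe_le_coe]
      push_cast
      nlinarith [sq_nonneg ((a : ℝ) - b)]

theorem lintegral_sq_le {α : Type*} [MeasurableSpace α] (μ : Measure α) {f : α → ℝ≥0∞}
    (hf : AEMeasurable f μ) : (∫⁻ x, f x ∂μ) ^ 2 ≤ μ univ * ∫⁻ x, f x ^ 2 ∂μ := by
  have h := ENNReal.lintegral_mul_le_Lp_mul_Lq μ Real.HolderConjugate.two_two hf
    (aemeasurable_const (b := (1 : ℝ≥0∞)))
  simp only [Pi.mul_apply, mul_one, ENNReal.one_rpow, lintegral_const, one_mul] at h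
  have h2 := pow_le_pow_left₀ zero_le h 2
  refine h2.trans (le_of_eq ?_)
  rw [mul_pow, ← ENNReal.rpow_natCast, ← ENNReal.rpow_natCast, ← ENNReal.rpow_mul, ← ENNReal.rpow_mul]
  simp [mul_comm]

/-- The one-dimensional Sobolev inequality for the value at an end point. -/
theorem enorm_sq_le_lintegral {W : Type*} [NormedAddCommGroup W] [NormedSpace ℝ W] {ε : ℝ}
    (hε : 0 < ε) {f : ℝ → W} (hf : ContDiffOn ℝ 1 f (Icc 0 ε)) {D : ℝ → ℝ≥0∞}
    (hD : AEMeasurable D (volume.restrict (Icc 0 ε))) (hfD : ∀ t ∈ Icc 0 ε, ‖deriv f t‖ₑ ≤ D t) :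
    ‖f 0‖ₑ ^ 2 ≤ (2 * ENNReal.ofReal ε⁻¹ + 2 * ENNReal.ofReal ε) *
      ∫⁻ t in Icc 0 ε, (‖f t‖ₑ ^ 2 + D t ^ 2) := by
  set A := ∫⁻ t in Icc 0 ε, D t with hA
  have h1 : ∀ t ∈ Icc 0 ε, ‖f 0‖ₑ ≤ ‖f t‖ₑ + A := fun t ht => by
    have h := enorm_sub_le_lintegral_deriv_of_contDiffOn_Icc
      (hf.mono (Icc_subset_Icc_right ht.2)) ht.1
    have h' : ∫⁻ x in Icc 0 t, ‖deriv f x‖ₑ ≤ A :=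
      (lintegral_mono_set (Icc_subset_Icc_right ht.2)).trans
        (setLIntegral_mono' measurableSet_Icc hfD)
    calc ‖f 0‖ₑ = ‖f t - (f t - f 0)‖ₑ := by simp
      _ ≤ ‖f t‖ₑ + ‖f t - f 0‖ₑ := enorm_sub_le
      _ ≤ _ := by gcongr; exact h.trans h'
  have hA2 : A ^ 2 ≤ ENNReal.ofReal ε * ∫⁻ t in Icc 0 ε, D t ^ 2 := by
    simpa using lintegral_sq_le (volume.restrict (Icc 0 ε)) hD
  have hfm : AEMeasurable (fun t => 2 * ‖f t‖ₑ ^ 2) (volume.restrict (Icc 0 ε)) := by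
    refine ContinuousOn.aemeasurable ?_ measurableSet_Icc
    refine ENNReal.continuous_const_mul (by simp) |>.comp_continuousOn ?_
    exact (ENNReal.continuous_pow 2).comp_continuousOn hf.continuousOn.enorm
  have h2 : ‖f 0‖ₑ ^ 2 * ENNReal.ofReal ε ≤
      2 * (∫⁻ t in Icc 0 ε, ‖f t‖ₑ ^ 2) + 2 * A ^ 2 * ENNReal.ofReal ε := by
    calc ‖f 0‖ₑ ^ 2 * ENNReal.ofReal ε = ∫⁻ _ in Icc 0 ε, ‖f 0‖ₑ ^ 2 := by simp
      _ ≤ ∫⁻ t in Icc 0 ε, (2 * ‖f t‖ₑ ^ 2 + 2 * A ^ 2) :=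
        setLIntegral_mono' measurableSet_Icc fun t ht =>
          (pow_le_pow_left₀ zero_le (h1 t ht) 2).trans (ennreal_add_sq_le _ _)
      _ = _ := by
        rw [lintegral_add_left' hfm, lintegral_const_mul' _ _ (by simp)]
        simp
  have he : ENNReal.ofReal ε * ENNReal.ofReal ε⁻¹ = 1 := by
    rw [← ENNReal.ofReal_mul hε.le, mul_inv_cancel₀ hε.ne', ENNReal.ofReal_one]
  set F := ∫⁻ t in Icc 0 ε, ‖f t‖ₑ ^ 2
  set G := ∫⁻ t in Icc 0 ε, D t ^ 2
  have h3 : ∫⁻ t in Icc 0 ε, (‖f t‖ₑ ^ 2 + D t ^ 2) = F + G :=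
    lintegral_add_right' _ (hD.pow_const 2)
  rw [h3]
  calc ‖f 0‖ₑ ^ 2 = ‖f 0‖ₑ ^ 2 * ENNReal.ofReal ε * ENNReal.ofReal ε⁻¹ := by
        rw [mul_assoc, he, mul_one]
    _ ≤ (2 * F + 2 * A ^ 2 * ENNReal.ofReal ε) * ENNReal.ofReal ε⁻¹ := by gcongr
    _ = 2 * ENNReal.ofReal ε⁻¹ * F + 2 * A ^ 2 * (ENNReal.ofReal ε * ENNReal.ofReal ε⁻¹) := by ring
    _ ≤ 2 * ENNReal.ofReal ε⁻¹ * F + 2 * (ENNReal.ofReal ε * G) * 1 := by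
        rw [he]; gcongr
    _ ≤ (2 * ENNReal.ofReal ε⁻¹ + 2 * ENNReal.ofReal ε) * (F + G) := by
        rw [mul_one, ← mul_assoc, add_mul]
        gcongr
        · exact le_self_add
        · exact le_add_self

theorem norm_clm_le_sum {W : Type*} [NormedAddCommGroup W] [NormedSpace ℝ W] (A : E3 →L[ℝ] W) :
    ‖A‖ ≤ ∑ k, ‖A (stdVec k)‖ := by
  refine A.opNorm_le_bound (Finset.sum_nonneg fun _ _ => norm_nonneg _) fun v => ?_
  conv_lhs => rw [eq_sum_stdVec v]
  rw [map_sum, Finset.sum_mul]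
  refine (norm_sum_le _ _).trans (Finset.sum_le_sum fun k _ => ?_)
  rw [map_smul, norm_smul, mul_comm]
  gcongr
  exact PiLp.norm_apply_le v k

/-- On compact sets a change of coordinates distorts volumes by a bounded factor. -/
theorem exists_lintegral_symm_le (P : OpenPartialHomeomorph E3 (E2 × ℝ))
    (hP : ContDiffOn ℝ ∞ P P.source) {B : Set (E2 × ℝ)} (hB : IsCompact B) (hBP : B ⊆ P.target) :
    ∃ C : ℝ≥0∞, C ≠ ⊤ ∧ ∀ h : E3 → ℝ≥0∞,
      ∫⁻ x in B, h (P.symm x) ≤ C * ∫⁻ z in P.symm '' B, h z := by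
  have hfin : Module.finrank ℝ E3 = Module.finrank ℝ (E2 × ℝ) := by simp
  let L : (E2 × ℝ) ≃L[ℝ] E3 := ContinuousLinearEquiv.ofFinrankEq hfin.symm
  set A := P.symm '' B with hA
  have hAc : IsCompact A := hB.image_of_continuousOn (P.continuousOn_symm.mono hBP)
  have hAs : A ⊆ P.source := by
    rintro _ ⟨x, hx, rfl⟩
    exact P.map_target (hBP hx)
  set Q : E3 → E3 := fun z => L (P z)
  have hQ : ∀ z ∈ P.source, ContDiffAt ℝ ∞ Q z := fun z hz =>
    L.contDiff.contDiffAt.comp z (hP.contDiffAt (P.open_source.mem_nhds hz))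
  obtain ⟨C, hC⟩ : ∃ C : ℝ, ∀ z ∈ A, ‖(fderiv ℝ Q z).det‖ ≤ C := by
    refine hAc.exists_bound_of_continuousOn fun z hz => ContinuousAt.continuousWithinAt ?_
    exact ContinuousLinearMap.continuous_det.continuousAt.comp
      ((hQ z (hAs hz)).fderiv_right (m := ∞) (by norm_cast)).continuousAt
  -- the image of the product measure under `L` is a multiple of Lebesgue measure
  have hprod : (volume : Measure (E2 × ℝ)).IsAddHaarMeasure :=
    inferInstanceAs ((volume : Measure E2).prod (volume : Measure ℝ)).IsAddHaarMeasure
  have hmapL : (Measure.map L (volume : Measure (E2 × ℝ))).IsAddHaarMeasure :=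
    ContinuousLinearEquiv.isAddHaarMeasure_map L volume
  have hκ := Measure.isAddLeftInvariant_eq_smul (Measure.map L (volume : Measure (E2 × ℝ)))
    (volume : Measure E3)
  set κ := Measure.addHaarScalarFactor (Measure.map L (volume : Measure (E2 × ℝ))) volume
  let e : (E2 × ℝ) ≃ᵐ E3 := L.toHomeomorph.toMeasurableEquiv
  have hQA : Q '' A = e.symm ⁻¹' B := by
    ext w
    constructor
    · rintro ⟨_, ⟨x, hx, rfl⟩, rfl⟩
      show L.symm (L (P (P.symm x))) ∈ B
      rwa [P.right_inv (hBP hx), L.symm_apply_apply]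
    · intro hw
      refine ⟨P.symm (L.symm w), ⟨L.symm w, hw, rfl⟩, ?_⟩
      show L (P (P.symm (L.symm w))) = w
      rw [P.right_inv (hBP (show L.symm w ∈ B from hw)), L.apply_symm_apply]
  have hinj : InjOn Q A := fun z hz z' hz' h => P.injOn (hAs hz) (hAs hz') (L.injective h)
  refine ⟨κ * ENNReal.ofReal C, ENNReal.mul_ne_top ENNReal.coe_ne_top ENNReal.ofReal_ne_top,
    fun h => ?_⟩
  calc ∫⁻ x in B, h (P.symm x)
      = ∫⁻ w in Q '' A, h (P.symm (e.symm w)) ∂(Measure.map e volume) := by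
        rw [e.restrict_map, lintegral_map_equiv, hQA]
        simp [← preimage_comp]
    _ = κ * ∫⁻ w in Q '' A, h (P.symm (e.symm w)) := by
        change ∫⁻ w in Q '' A, h (P.symm (e.symm w)) ∂(Measure.map L volume) = _
        rw [hκ, Measure.restrict_smul, lintegral_smul_measure]
        rfl
    _ = κ * ∫⁻ z in A, ENNReal.ofReal |(fderiv ℝ Q z).det| * h (P.symm (e.symm (Q z))) := by
        rw [lintegral_image_eq_lintegral_abs_det_fderiv_mul volume hAc.measurableSet
          (fun z hz => ((hQ z (hAs hz)).differentiableAt (by simp)).hasFDerivAt.hasFDerivWithinAt)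
          hinj]
    _ ≤ κ * ∫⁻ z in A, ENNReal.ofReal C * h z := by
        refine mul_le_mul_right (setLIntegral_mono' hAc.measurableSet fun z hz => ?_) _
        have : P.symm (e.symm (Q z)) = z := by
          show P.symm (L.symm (L (P z))) = z
          rw [L.symm_apply_apply, P.left_inv (hAs hz)]
        rw [this]
        gcongr
        exact hC z hz
    _ = _ := by rw [lintegral_const_mul' _ _ ENNReal.ofReal_ne_top, mul_assoc]

end Euclidean

section SliceTrace

variable {M : Type*} [TopologicalSpace M] [ChartedSpace E3 M] [IsManifold 𝓘(ℝ, E3) ∞ M]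
  {X : AFBackground M} {S : Type*} [TopologicalSpace S] [ChartedSpace E2 S]
  {Y : SeparatingSurface X S} {p : M} (c : SliceChart Y p)

namespace SliceChart

/-- The half-box on the side `t ≥ 0`, in the coordinates of the chart at `p`. -/
def halfBox : Set E3 := c.P.symm '' (Metric.closedBall c.z₀ c.ε ×ˢ Icc 0 c.ε)

theorem prod_subset : Metric.closedBall c.z₀ c.ε ×ˢ Icc 0 c.ε ⊆ c.P.target :=
  (prod_mono le_rfl (Icc_subset_Icc_left (neg_nonpos.2 c.ε_pos.le))).trans c.box_subset

theorem isCompact_prod : IsCompact (Metric.closedBall c.z₀ c.ε ×ˢ Icc 0 c.ε) :=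
  c.isCompact_ball.prod isCompact_Icc

theorem isCompact_halfBox : IsCompact c.halfBox :=
  c.isCompact_prod.image_of_continuousOn (c.P.continuousOn_symm.mono c.prod_subset)

theorem halfBox_subset_source : c.halfBox ⊆ c.P.source := by
  rintro _ ⟨x, hx, rfl⟩
  exact c.P.map_target (c.prod_subset hx)

theorem halfBox_subset_target : c.halfBox ⊆ (chartAt E3 p).target :=
  c.halfBox_subset_source.trans c.source_subset

/-- The trace inequality on the slice `t = 0`. -/
theorem exists_lintegral_slice_le (W : Type*) [NormedAddCommGroup W] [NormedSpace ℝ W] :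
    ∃ C : ℝ≥0∞, C ≠ ⊤ ∧ ∀ f : E3 → W, ContDiffOn ℝ ∞ f c.P.source →
      ∫⁻ z in Metric.closedBall c.z₀ c.ε, ‖f (c.ψ z)‖ₑ ^ 2 ≤
        C * ∫⁻ z in c.halfBox, (‖f z‖ₑ ^ 2 + ‖fderiv ℝ f z‖ₑ ^ 2) := by
  set Bx := Metric.closedBall c.z₀ c.ε ×ˢ Icc 0 c.ε with hBx
  have hsm : ∀ x ∈ Bx, ContDiffAt ℝ ∞ c.P.symm x := fun x hx =>
    c.contDiffOn_symm.contDiffAt (c.P.open_target.mem_nhds (c.prod_subset hx))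
  obtain ⟨b, hb⟩ : ∃ b : ℝ, ∀ x ∈ Bx, ‖fderiv ℝ c.P.symm x (0, 1)‖ ≤ b := by
    refine c.isCompact_prod.exists_bound_of_continuousOn fun x hx =>
      ContinuousAt.continuousWithinAt ?_
    exact ((hsm x hx).fderiv_right (m := ∞) (by norm_cast)).continuousAt.clm_apply
      continuousAt_const
  obtain ⟨C, hC, hCle⟩ := exists_lintegral_symm_le c.P c.contDiffOn c.isCompact_prod c.prod_subset
  set a : ℝ≥0∞ := 2 * ENNReal.ofReal c.ε⁻¹ + 2 * ENNReal.ofReal c.ε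
  have ha : a ≠ ⊤ := by simp [a, ENNReal.mul_eq_top]
  set β := ENNReal.ofReal b
  refine ⟨a * ((1 + β ^ 2) * C), ENNReal.mul_ne_top ha (ENNReal.mul_ne_top (by simp [β]) hC),
    fun f hf => ?_⟩
  have hfs : ∀ z ∈ c.P.source, ContDiffAt ℝ ∞ f z := fun z hz =>
    hf.contDiffAt (c.P.open_source.mem_nhds hz)
  have hmaps : MapsTo c.P.symm Bx c.P.source := fun x hx => c.P.map_target (c.prod_subset hx)
  have hPc : ContinuousOn c.P.symm Bx := c.P.continuousOn_symm.mono c.prod_subset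
  have hfc : ContinuousOn (fun x => ‖f (c.P.symm x)‖ₑ ^ 2) Bx :=
    (ENNReal.continuous_pow 2).comp_continuousOn (hf.continuousOn.comp hPc hmaps).enorm
  have hdc : ContinuousOn (fun x => ‖fderiv ℝ f (c.P.symm x)‖ₑ) Bx := by
    refine ContinuousOn.enorm (ContinuousOn.comp (t := c.P.source) ?_ hPc hmaps)
    exact fun z hz => ((hfs z hz).fderiv_right (m := ∞) (by norm_cast)).continuousAt.continuousWithinAt
  have hdc' : ContinuousOn (fun x => β * ‖fderiv ℝ f (c.P.symm x)‖ₑ) Bx :=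
    (ENNReal.continuous_const_mul (by simp [β])).comp_continuousOn hdc
  have hline : ∀ z ∈ Metric.closedBall c.z₀ c.ε, ∀ t ∈ Icc 0 c.ε, ((z, t) : E2 × ℝ) ∈ Bx :=
    fun z hz t ht => ⟨hz, ht⟩
  have key : ∀ z ∈ Metric.closedBall c.z₀ c.ε, ‖f (c.ψ z)‖ₑ ^ 2 ≤
      a * ∫⁻ t in Icc 0 c.ε, (‖f (c.P.symm (z, t))‖ₑ ^ 2
        + (β * ‖fderiv ℝ f (c.P.symm (z, t))‖ₑ) ^ 2) := by
    intro z hz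
    have hd : ∀ t ∈ Icc 0 c.ε, HasDerivAt (fun t => c.P.symm (z, t))
        (fderiv ℝ c.P.symm (z, t) (0, 1)) t := fun t ht =>
      HasFDerivAt.comp_hasDerivAt t ((hsm _ (hline z hz t ht)).differentiableAt (by simp)).hasFDerivAt
        ((hasDerivAt_const t z).prodMk (hasDerivAt_id t))
    refine enorm_sq_le_lintegral c.ε_pos (f := fun t => f (c.P.symm (z, t)))
      (D := fun t => β * ‖fderiv ℝ f (c.P.symm (z, t))‖ₑ) ?_ ?_ ?_
    · intro t ht
      have h1 : ContDiffAt ℝ ∞ (fun t => c.P.symm (z, t)) t :=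
        (hsm _ (hline z hz t ht)).comp t (contDiffAt_const.prodMk contDiffAt_id)
      exact (((hfs _ (hmaps (hline z hz t ht))).comp t h1).of_le (by norm_cast)).contDiffWithinAt
    · exact (hdc'.comp (by fun_prop) (hline z hz)).aemeasurable measurableSet_Icc
    · intro t ht
      have h2 : HasDerivAt (fun t => f (c.P.symm (z, t)))
          (fderiv ℝ f (c.P.symm (z, t)) (fderiv ℝ c.P.symm (z, t) (0, 1))) t :=
        HasFDerivAt.comp_hasDerivAt t ((hfs _ (hmaps (hline z hz t ht))).differentiableAt
          (by simp)).hasFDerivAt (hd t ht)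
      rw [h2.deriv, mul_comm]
      refine (ContinuousLinearMap.le_opENorm _ _).trans ?_
      gcongr
      rw [← ofReal_norm]
      exact ENNReal.ofReal_le_ofReal (hb _ (hline z hz t ht))
  have hball : MeasurableSet (Metric.closedBall c.z₀ c.ε) := Metric.isClosed_closedBall.measurableSet
  have hBm : MeasurableSet Bx := c.isCompact_prod.measurableSet
  calc ∫⁻ z in Metric.closedBall c.z₀ c.ε, ‖f (c.ψ z)‖ₑ ^ 2
      ≤ ∫⁻ z in Metric.closedBall c.z₀ c.ε, a * ∫⁻ t in Icc 0 c.ε, (‖f (c.P.symm (z, t))‖ₑ ^ 2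
        + (β * ‖fderiv ℝ f (c.P.symm (z, t))‖ₑ) ^ 2) := setLIntegral_mono' hball key
    _ = a * ∫⁻ x in Bx, (‖f (c.P.symm x)‖ₑ ^ 2 + (β * ‖fderiv ℝ f (c.P.symm x)‖ₑ) ^ 2) := by
        rw [lintegral_const_mul' _ _ ha]
        congr 1
        have hm : AEMeasurable (fun x => ‖f (c.P.symm x)‖ₑ ^ 2 +
            (β * ‖fderiv ℝ f (c.P.symm x)‖ₑ) ^ 2) (volume.restrict Bx) :=
          (hfc.aemeasurable hBm).add ((hdc'.aemeasurable hBm).pow_const 2)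
        have hv : (volume : Measure (E2 × ℝ)).restrict Bx =
          (volume.restrict (Metric.closedBall c.z₀ c.ε)).prod (volume.restrict (Icc 0 c.ε)) := by
          rw [Measure.prod_restrict]; rfl
        rw [hv] at hm ⊢
        exact (lintegral_prod _ hm).symm
    _ ≤ a * ∫⁻ x in Bx, (1 + β ^ 2) * (‖f (c.P.symm x)‖ₑ ^ 2 + ‖fderiv ℝ f (c.P.symm x)‖ₑ ^ 2) := by
        gcongr with x
        rw [mul_pow, add_mul, one_mul]
        gcongr
        · exact le_self_add
        · exact le_add_self
    _ = a * ((1 + β ^ 2) * ∫⁻ x in Bx,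
          (‖f (c.P.symm x)‖ₑ ^ 2 + ‖fderiv ℝ f (c.P.symm x)‖ₑ ^ 2)) := by
        rw [lintegral_const_mul' _ _ (by simp [β])]
    _ ≤ a * ((1 + β ^ 2) * (C * ∫⁻ z in c.halfBox, (‖f z‖ₑ ^ 2 + ‖fderiv ℝ f z‖ₑ ^ 2))) := by
        gcongr
        exact hCle fun z => ‖f z‖ₑ ^ 2 + ‖fderiv ℝ f z‖ₑ ^ 2
    _ = _ := by ring

end SliceChart

end SliceTrace

/-! ### The local trace inequality -/

section LocalTrace

theorem norm_piLp_two_le_sum {ι V : Type*} [Fintype ι] [NormedAddCommGroup V]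
    (x : PiLp 2 fun _ : ι => V) :
    ‖x‖ ≤ ∑ i, ‖x i‖ := by
  have h0 : 0 ≤ ∑ i, ‖x i‖ := Finset.sum_nonneg fun _ _ => norm_nonneg _
  refine le_of_sq_le_sq ?_ h0
  rw [PiLp.norm_sq_eq_of_L2]
  exact Finset.sum_sq_le_sq_sum_of_nonneg fun _ _ => norm_nonneg _

variable {V : Type*} [NormedAddCommGroup V] [NormedSpace ℝ V] {r s : ℕ}

theorem enorm_sq_le_of_norm_le {W W' : Type*} [NormedAddCommGroup W] [NormedAddCommGroup W'] {C : ℝ}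
    {a : W} {b : W'} (h : ‖a‖ ≤ C * ‖b‖) : ‖a‖ₑ ^ 2 ≤ ENNReal.ofReal C ^ 2 * ‖b‖ₑ ^ 2 := by
  rw [← mul_pow]
  refine pow_le_pow_left₀ zero_le ?_ 2
  rw [← ofReal_norm, ← ofReal_norm, ← ENNReal.ofReal_mul' (norm_nonneg _)]
  exact ENNReal.ofReal_le_ofReal h

variable {M : Type*} [TopologicalSpace M] [ChartedSpace E3 M] [IsManifold 𝓘(ℝ, E3) ∞ M]

section Compare

variable [SecondCountableTopology M] [Nonempty M]

/-- On compact sets of coordinates, components in the chart are bounded by components in the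
orthonormal frame. -/
theorem exists_norm_chartComp_le (g : RMetric M) (w r s : ℕ) (p : M) {K : Set E3}
    (hK : IsCompact K) (hKp : K ⊆ (chartAt E3 p).target) : ∃ C : ℝ, ∀ u : M → TComp r s V, ∀ z ∈ K,
      ‖chartComp w u p z‖ ≤
        C * ‖frameComp g w ((chartAt E3 p).symm z) (u ((chartAt E3 p).symm z))‖ := by
  obtain ⟨B, hB⟩ := exists_chartOrtho_bound g p hK hKp
  refine ⟨|frameBound r s w B| * Fintype.card (TIdx r s), fun u z hz => ?_⟩
  have hp := (chartAt E3 p).map_target (hKp hz)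
  set L := chartOrtho g p ((chartAt E3 p).symm z) with hL
  have hd := det_chartOrtho_ne_zero g hp
  have heq := frameComp_eq g w hp u
  rw [(chartAt E3 p).right_inv (hKp hz)] at heq
  have hback : changeFrame w L⁻¹ (WithLp.ofLp (frameComp g w ((chartAt E3 p).symm z)
      (u ((chartAt E3 p).symm z)))) = chartComp w u p z := by
    rw [heq]
    exact changeFrame_inv_cancel w hd _
  rw [← hback]
  refine (pi_norm_le_iff_of_nonneg (by positivity)).2 fun K' => ?_
  refine (norm_changeFrame_le (B := B) (fun i j => (hB z hz i j).2) (fun i j => ?_) _ _).trans ?_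
  · rw [Matrix.nonsing_inv_nonsing_inv _ (isUnit_iff_ne_zero.2 hd)]
    exact (hB z hz i j).1
  · rw [mul_assoc]
    refine mul_le_mul (le_abs_self _) ?_ (Finset.sum_nonneg fun _ _ => norm_nonneg _) (abs_nonneg _)
    refine (Finset.sum_le_card_nsmul _ _ _ fun K' _ => PiLp.norm_apply_le _ K').trans ?_
    rw [nsmul_eq_mul]; rfl

/-- On compact sets of coordinates, components in the orthonormal frame are bounded by components in
the chart. -/
theorem exists_norm_frameComp_le (g : RMetric M) (w r s : ℕ) (p : M) {K : Set E3}
    (hK : IsCompact K) (hKp : K ⊆ (chartAt E3 p).target) : ∃ C : ℝ, ∀ u : M → TComp r s V, ∀ z ∈ K,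
      ‖frameComp g w ((chartAt E3 p).symm z) (u ((chartAt E3 p).symm z))‖ ≤
        C * ‖chartComp w u p z‖ := by
  obtain ⟨B, hB⟩ := exists_chartOrtho_bound g p hK hKp
  refine ⟨Fintype.card (TIdx r s) * (|frameBound r s w B| * Fintype.card (TIdx r s)),
    fun u z hz => ?_⟩
  have hp := (chartAt E3 p).map_target (hKp hz)
  have heq := frameComp_eq g w hp u
  rw [(chartAt E3 p).right_inv (hKp hz)] at heq
  rw [heq]
  refine (norm_piLp_two_le_sum _).trans ?_
  rw [mul_assoc, ← nsmul_eq_mul]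
  refine Finset.sum_le_card_nsmul _ _ _ fun K' _ => ?_
  refine (norm_changeFrame_le (B := B) (fun i j => (hB z hz i j).1) (fun i j => (hB z hz i j).2)
    _ _).trans ?_
  rw [mul_assoc]
  refine mul_le_mul (le_abs_self _) ?_ (Finset.sum_nonneg fun _ _ => norm_nonneg _) (abs_nonneg _)
  refine (Finset.sum_le_card_nsmul _ _ _ fun K' _ => norm_le_pi_norm _ K').trans ?_
  rw [nsmul_eq_mul]; rfl

end Compare

/-- On compact sets of coordinates, the partial derivatives of the components are bounded by the
components of the tensor and of its covariant derivative. -/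
theorem exists_norm_fderiv_chartComp_le (g : RMetric M) (w r s : ℕ) (p : M) {K : Set E3}
    (hK : IsCompact K) (hKp : K ⊆ (chartAt E3 p).target) : ∃ C : ℝ, ∀ u : M → TComp r s V,
      IsSmoothTensor w u → ∀ z ∈ K, ‖fderiv ℝ (chartComp w u p) z‖ ≤
        3 * ‖chartComp w (covDeriv g w u) p z‖ + C * ‖chartComp w u p z‖ := by
  have hb : ∀ k i j, ∃ B : ℝ, ∀ z ∈ K, ‖chrisMat g p z k i j‖ ≤ B := fun k i j =>
    hK.exists_bound_of_continuousOn fun z hz =>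
      (contDiffAt_chrisMat g (hKp hz) k i j).continuousAt.continuousWithinAt
  choose B hB using hb
  set b : ℝ := ∑ k, ∑ i, ∑ j, |B k i j| with hbdef
  have hb' : ∀ z ∈ K, ∀ k i j, |chrisMat g p z k i j| ≤ b := fun z hz k i j => by
    refine (hB k i j z hz).trans ((le_abs_self _).trans ?_)
    refine (Finset.single_le_sum (f := fun j => |B k i j|) (fun _ _ => abs_nonneg _)
      (Finset.mem_univ j)).trans ?_
    refine (Finset.single_le_sum (f := fun i => ∑ j, |B k i j|)
      (fun _ _ => Finset.sum_nonneg fun _ _ => abs_nonneg _) (Finset.mem_univ i)).trans ?_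
    exact Finset.single_le_sum (f := fun k => ∑ i, ∑ j, |B k i j|)
      (fun _ _ => Finset.sum_nonneg fun _ _ => Finset.sum_nonneg fun _ _ => abs_nonneg _)
      (Finset.mem_univ k)
  have hb0 : 0 ≤ b := Finset.sum_nonneg fun _ _ => Finset.sum_nonneg fun _ _ =>
    Finset.sum_nonneg fun _ _ => abs_nonneg _
  set c : ℝ := (3 * w + 3 * r + 3 * s) * b * Fintype.card (TIdx r s) with hc
  refine ⟨3 * c, fun u hu z hz => ?_⟩
  refine (norm_clm_le_sum _).trans ?_
  have hk : ∀ k, ‖fderiv ℝ (chartComp w u p) z (stdVec k)‖ ≤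
      ‖chartComp w (covDeriv g w u) p z‖ + c * ‖chartComp w u p z‖ := by
    intro k
    refine (pi_norm_le_iff_of_nonneg (by positivity)).2 fun K' => ?_
    have h1 : fderiv ℝ (chartComp w u p) z (stdVec k) K' =
        fderiv ℝ (fun z => chartComp w u p z K') z (stdVec k) := by
      have hd : ∀ K', DifferentiableAt ℝ (fun z => chartComp w u p z K') z :=
        fun K' => hu.differentiableAt (hKp hz) K'
      have := fderiv_pi hd
      rw [show chartComp w u p = fun z K' => chartComp w u p z K' from rfl, this]
      rfl
    have h2 : fderiv ℝ (fun z => chartComp w u p z K') z (stdVec k) =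
        chartComp w (covDeriv g w u) p z (K'.1, Fin.cons k K'.2)
          + frameDeriv w (chrisMat g p z k) (chartComp w u p z) K' := by
      rw [chartComp_covDeriv g hu (hKp hz), chartCov]
      simp
    rw [h1, h2]
    refine (norm_add_le _ _).trans (add_le_add (norm_le_pi_norm _ _) ?_)
    refine (norm_frameDeriv_le (hb' z hz k) _ _).trans ?_
    rw [hc, mul_assoc _ (Fintype.card (TIdx r s) : ℝ)]
    refine mul_le_mul_of_nonneg_left ?_ (by positivity)
    rw [← nsmul_eq_mul]
    exact Finset.sum_le_card_nsmul _ _ _ fun K' _ => norm_le_pi_norm _ K'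
  refine (Finset.sum_le_card_nsmul _ _ _ fun k _ => hk k).trans (le_of_eq ?_)
  simp
  ring

variable [SecondCountableTopology M] [Nonempty M] [MeasurableSpace M] [BorelSpace M]
  {X : AFBackground M}

theorem lintegral_enorm_sq_eq {α W : Type*} [MeasurableSpace α] [NormedAddCommGroup W]
    {μ : Measure α} (f : Lp W 2 μ) : ∫⁻ x, ‖f x‖ₑ ^ 2 ∂μ = ‖f‖ₑ ^ 2 := by
  have h := eLpNorm_nnreal_pow_eq_lintegral (μ := μ) (f := f) (p := 2) (by simp)
  rw [Lp.enorm_def]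
  simpa using h.symm

theorem IsJet.lintegral_chartComp_le (w : ℕ) (δ : ℝ) (k : ℕ) (p : M) {K : Set E3}
    (hK : IsCompact K) (hKp : K ⊆ (chartAt E3 p).target) (j : Fin (k + 1)) :
    ∃ C : ℝ≥0∞, C ≠ ⊤ ∧ ∀ (u : M → TComp r s V) (f : JetSpace X r s V k δ), IsJet X w u f →
      ∫⁻ z in K, ‖chartComp w (iterCov X.metric w (j : ℕ) u) p z‖ₑ ^ 2 ≤ C * ‖f‖ₑ ^ 2 := by
  obtain ⟨C₁, h₁⟩ := exists_norm_chartComp_le (V := V) X.metric w r (s + (j : ℕ)) p hK hKp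
  obtain ⟨C₂, hC₂, h₂⟩ := exists_lintegral_chart_le X (δ - ((j : ℕ) : ℝ)) p hK hKp
  refine ⟨ENNReal.ofReal C₁ ^ 2 * C₂, ENNReal.mul_ne_top (by simp) hC₂, fun u f hf => ?_⟩
  have hae := ae_chart_of_ae_weightedVolume X (δ - ((j : ℕ) : ℝ)) p hK hKp (hf j)
  have hm : Measurable fun x => ‖f j x‖ₑ ^ 2 := (Lp.stronglyMeasurable (f j)).enorm.pow_const 2
  calc ∫⁻ z in K, ‖chartComp w (iterCov X.metric w (j : ℕ) u) p z‖ₑ ^ 2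
      ≤ ∫⁻ z in K, ENNReal.ofReal C₁ ^ 2 * ‖f j ((chartAt E3 p).symm z)‖ₑ ^ 2 := by
        refine lintegral_mono_ae ?_
        filter_upwards [hae, self_mem_ae_restrict hK.measurableSet] with z hz hzK
        rw [hz]
        exact enorm_sq_le_of_norm_le (h₁ _ z hzK)
    _ = ENNReal.ofReal C₁ ^ 2 * ∫⁻ z in K, ‖f j ((chartAt E3 p).symm z)‖ₑ ^ 2 :=
        lintegral_const_mul' _ _ (by simp)
    _ ≤ ENNReal.ofReal C₁ ^ 2 * (C₂ * ∫⁻ x, ‖f j x‖ₑ ^ 2 ∂(weightedVolume X (δ - ((j : ℕ) : ℝ)))) := by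
        gcongr
        exact h₂ _ hm
    _ ≤ ENNReal.ofReal C₁ ^ 2 * (C₂ * ‖f‖ₑ ^ 2) := by
        rw [lintegral_enorm_sq_eq]
        gcongr
        rw [← ofReal_norm, ← ofReal_norm]
        exact ENNReal.ofReal_le_ofReal (PiLp.norm_apply_le f j)
    _ = _ := by rw [mul_assoc]

variable {S : Type*} [TopologicalSpace S] [ChartedSpace E2 S] [IsManifold 𝓘(ℝ, E2) ∞ S]
  [MeasurableSpace S] [BorelSpace S] {Y : SeparatingSurface X S} {p : M} (c : SliceChart Y p)

/-- The local trace inequality: along the part of the surface in a slice chart, a section is bounded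
in `L²` by its first order jet. -/
theorem SliceChart.exists_lintegral_frameComp_le (w : ℕ) {k : ℕ} (hk : 1 ≤ k) (δ : ℝ) :
    ∃ C : ℝ≥0∞, C ≠ ⊤ ∧ ∀ (u : M → TComp r s V) (f : JetSpace X r s V k δ), IsSmoothTensor w u →
      IsJet X w u f →
      ∫⁻ y in c.U, ‖frameComp X.metric w (Y.ι y) (u (Y.ι y))‖ₑ ^ 2 ∂(surfaceArea Y) ≤
        C * ‖f‖ₑ ^ 2 := by
  have hK := c.isCompact_halfBox
  have hKp := c.halfBox_subset_target
  obtain ⟨C₀, hC₀, h₀⟩ := c.exists_area_le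
  obtain ⟨C₁, h₁⟩ := exists_norm_frameComp_le (V := V) X.metric w r s p hK hKp
  obtain ⟨C₂, hC₂, h₂⟩ := c.exists_lintegral_slice_le (TComp r s V)
  obtain ⟨C₃, h₃⟩ := exists_norm_fderiv_chartComp_le (V := V) X.metric w r s p hK hKp
  obtain ⟨A₀, hA₀, hj₀⟩ := IsJet.lintegral_chartComp_le (X := X) (V := V) (r := r) (s := s) w δ k p
    hK hKp ⟨0, by omega⟩
  obtain ⟨A₁, hA₁, hj₁⟩ := IsJet.lintegral_chartComp_le (X := X) (V := V) (r := r) (s := s) w δ k p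
    hK hKp ⟨1, by omega⟩
  set a : ℝ≥0∞ := 2 * ENNReal.ofReal 3 ^ 2
  set b : ℝ≥0∞ := 2 * ENNReal.ofReal C₃ ^ 2
  refine ⟨C₀ * (ENNReal.ofReal C₁ ^ 2 * (C₂ * (A₀ + (a * A₁ + b * A₀)))), ?_, fun u f hu hf => ?_⟩
  · simp [ENNReal.mul_eq_top, hC₀, hC₂, hA₀, hA₁, a, b]
  have hcont : ∀ {s : ℕ} {T : M → TComp r s V}, IsSmoothTensor w T →
      AEMeasurable (fun z => ‖chartComp w T p z‖ₑ ^ 2) (volume.restrict c.halfBox) := fun hT =>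
    ((ENNReal.continuous_pow 2).comp_continuousOn ((hT p).continuousOn.mono hKp).enorm).aemeasurable
      hK.measurableSet
  have hfd : ∀ z ∈ c.halfBox, ‖fderiv ℝ (chartComp w u p) z‖ₑ ^ 2 ≤
      a * ‖chartComp w (covDeriv X.metric w u) p z‖ₑ ^ 2 + b * ‖chartComp w u p z‖ₑ ^ 2 := by
    intro z hz
    have h := h₃ u hu z hz
    have h' : ‖fderiv ℝ (chartComp w u p) z‖ₑ ≤
        ENNReal.ofReal 3 * ‖chartComp w (covDeriv X.metric w u) p z‖ₑ
          + ENNReal.ofReal C₃ * ‖chartComp w u p z‖ₑ := by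
      simp only [← ofReal_norm]
      rw [← ENNReal.ofReal_mul (by norm_num), ← ENNReal.ofReal_mul' (norm_nonneg _)]
      exact (ENNReal.ofReal_le_ofReal h).trans ENNReal.ofReal_add_le
    refine (pow_le_pow_left₀ zero_le h' 2).trans ((ennreal_add_sq_le _ _).trans (le_of_eq ?_))
    simp only [a, b]
    ring
  calc ∫⁻ y in c.U, ‖frameComp X.metric w (Y.ι y) (u (Y.ι y))‖ₑ ^ 2 ∂(surfaceArea Y)
      ≤ ∫⁻ y, ‖frameComp X.metric w (Y.ι y) (u (Y.ι y))‖ₑ ^ 2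
        ∂(C₀ • (volume.restrict (Metric.ball c.z₀ c.ε)).map c.θ.symm) := lintegral_mono' h₀ le_rfl
    _ ≤ C₀ * ∫⁻ z in Metric.ball c.z₀ c.ε,
        ‖frameComp X.metric w (Y.ι (c.θ.symm z)) (u (Y.ι (c.θ.symm z)))‖ₑ ^ 2 := by
        rw [lintegral_smul_measure]
        exact mul_le_mul_right (lintegral_map_le _ _) _
    _ ≤ C₀ * ∫⁻ z in Metric.closedBall c.z₀ c.ε,
        ENNReal.ofReal C₁ ^ 2 * ‖chartComp w u p (c.ψ z)‖ₑ ^ 2 := by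
        refine mul_le_mul_right ((lintegral_mono_set Metric.ball_subset_closedBall).trans
          (setLIntegral_mono' Metric.isClosed_closedBall.measurableSet fun z hz => ?_)) _
        rw [← c.slice z hz]
        exact enorm_sq_le_of_norm_le (h₁ u (c.ψ z) ⟨(z, 0), ⟨hz, le_rfl, c.ε_pos.le⟩, rfl⟩)
    _ = C₀ * (ENNReal.ofReal C₁ ^ 2 * ∫⁻ z in Metric.closedBall c.z₀ c.ε,
        ‖chartComp w u p (c.ψ z)‖ₑ ^ 2) := by
        rw [lintegral_const_mul' _ _ (by simp)]
    _ ≤ C₀ * (ENNReal.ofReal C₁ ^ 2 * (C₂ * ∫⁻ z in c.halfBox,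
        (‖chartComp w u p z‖ₑ ^ 2 + ‖fderiv ℝ (chartComp w u p) z‖ₑ ^ 2))) := by
        gcongr
        exact h₂ _ ((hu p).mono c.source_subset)
    _ ≤ C₀ * (ENNReal.ofReal C₁ ^ 2 * (C₂ * ∫⁻ z in c.halfBox, (‖chartComp w u p z‖ₑ ^ 2 +
        (a * ‖chartComp w (covDeriv X.metric w u) p z‖ₑ ^ 2 + b * ‖chartComp w u p z‖ₑ ^ 2)))) := by
        gcongr C₀ * (_ * (C₂ * ?_))
        exact setLIntegral_mono' hK.measurableSet fun z hz => add_le_add le_rfl (hfd z hz)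
    _ = C₀ * (ENNReal.ofReal C₁ ^ 2 * (C₂ * ((∫⁻ z in c.halfBox, ‖chartComp w u p z‖ₑ ^ 2) +
        (a * (∫⁻ z in c.halfBox, ‖chartComp w (covDeriv X.metric w u) p z‖ₑ ^ 2)
          + b * ∫⁻ z in c.halfBox, ‖chartComp w u p z‖ₑ ^ 2)))) := by
        rw [lintegral_add_left' (hcont hu),
          lintegral_add_left' ((hcont (hu.covDeriv X.metric)).const_mul _),
          lintegral_const_mul' _ _ (by simp [a, ENNReal.mul_eq_top]),
          lintegral_const_mul' _ _ (by simp [b, ENNReal.mul_eq_top])]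
    _ ≤ C₀ * (ENNReal.ofReal C₁ ^ 2 * (C₂ * (A₀ * ‖f‖ₑ ^ 2 +
        (a * (A₁ * ‖f‖ₑ ^ 2) + b * (A₀ * ‖f‖ₑ ^ 2))))) := by
        have e₀ := hj₀ u f hf
        have e₁ := hj₁ u f hf
        gcongr C₀ * (_ * (C₂ * (?_ + (a * ?_ + b * ?_))))
        · exact e₀
        · exact e₁
        · exact e₀
    _ = _ := by ring

end LocalTrace

/-! ### The trace operator -/

section Trace

variable {M : Type*} [TopologicalSpace M] [ChartedSpace E3 M] [IsManifold 𝓘(ℝ, E3) ∞ M]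
  {X : AFBackground M} {S : Type*} [TopologicalSpace S] [ChartedSpace E2 S]

/-- A slice chart around each point of the surface. -/
def sliceAt (Y : SeparatingSurface X S) (y : S) : SliceChart Y (Y.ι y) :=
  (exists_sliceChart Y y).choose

theorem mem_sliceAt_U (Y : SeparatingSurface X S) (y : S) : y ∈ (sliceAt Y y).U := by
  obtain ⟨h1, h2⟩ := (exists_sliceChart Y y).choose_spec
  refine ⟨h1, ?_⟩
  rw [mem_preimage, sliceAt, h2]
  exact Metric.mem_ball_self (SliceChart.ε_pos _)

theorem exists_finset_sliceAt [CompactSpace S] (Y : SeparatingSurface X S) :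
    ∃ t : Finset S, (⋃ y : t, (sliceAt Y (y : S)).U) = univ := by
  obtain ⟨t, ht⟩ := CompactSpace.elim_nhds_subcover (fun y => (sliceAt Y y).U)
    fun y => (sliceAt Y y).isOpen_U.mem_nhds (mem_sliceAt_U Y y)
  refine ⟨t, ?_⟩
  rw [← top_eq_univ, ← ht]
  ext y; simp

theorem isFiniteMeasure_surfaceArea [IsManifold 𝓘(ℝ, E2) ∞ S] [CompactSpace S] [MeasurableSpace S]
    [BorelSpace S] (Y : SeparatingSurface X S) : IsFiniteMeasure (surfaceArea Y) := by
  obtain ⟨t, ht⟩ := exists_finset_sliceAt Y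
  refine ⟨?_⟩
  rw [← ht]
  refine (measure_iUnion_le _).trans_lt ?_
  rw [tsum_fintype]
  refine ENNReal.sum_lt_top.2 fun y _ => ?_
  set c := sliceAt Y (y : S)
  obtain ⟨C, hC, hle⟩ := c.exists_area_le
  have h := hle univ
  rw [Measure.restrict_apply_univ] at h
  refine h.trans_lt ?_
  have hm : AEMeasurable c.θ.symm (volume.restrict (Metric.ball c.z₀ c.ε)) :=
    (c.θ.continuousOn_symm.mono (Metric.ball_subset_closedBall.trans c.ball_subset)).aemeasurable
      Metric.isOpen_ball.measurableSet
  rw [Measure.smul_apply, Measure.map_apply_of_aemeasurable hm MeasurableSet.univ, preimage_univ,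
    Measure.restrict_apply_univ, smul_eq_mul]
  exact ENNReal.mul_lt_top hC.lt_top measure_ball_lt_top

variable {V : Type*} [NormedAddCommGroup V] [NormedSpace ℝ V] {r s : ℕ} {w : ℕ}
  {P : Submodule ℝ (TComp r s V)}

theorem IsTestSection.add {u u' : M → TComp r s V} (hu : IsTestSection w P u)
    (hu' : IsTestSection w P u') : IsTestSection w P (u + u') := by
  obtain ⟨K, hK, h⟩ := hu.compactSupport
  obtain ⟨K', hK', h'⟩ := hu'.compactSupport
  refine ⟨hu.smooth.add hu'.smooth, ⟨K ∪ K', hK.union hK', fun x hx => ?_⟩,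
    fun x => P.add_mem (hu.mem x) (hu'.mem x)⟩
  rw [mem_union, not_or] at hx
  rw [Pi.add_apply, h x hx.1, h' x hx.2, add_zero]

theorem IsTestSection.smul (a : ℝ) {u : M → TComp r s V} (hu : IsTestSection w P u) :
    IsTestSection w P (a • u) := by
  obtain ⟨K, hK, h⟩ := hu.compactSupport
  refine ⟨hu.smooth.smul a, ⟨K, hK, fun x hx => ?_⟩, fun x => P.smul_mem a (hu.mem x)⟩
  rw [Pi.smul_apply, h x hx, smul_zero]

variable [SecondCountableTopology M] [Nonempty M]

theorem frameComp_add (g : RMetric M) (w : ℕ) (x : M) (T T' : TComp r s V) :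
    frameComp g w x (T + T') = frameComp g w x T + frameComp g w x T' := by
  simp [frameComp, changeFrame_add]

theorem frameComp_smul (g : RMetric M) (w : ℕ) (x : M) (a : ℝ) (T : TComp r s V) :
    frameComp g w x (a • T) = a • frameComp g w x T := by
  simp [frameComp, changeFrame_smul]

variable [MeasurableSpace M] [MeasurableSpace S] (Y : SeparatingSurface X S) {k : ℕ} {δ : ℝ}

theorem IsJet.add {u u' : M → TComp r s V} (hu : IsSmoothTensor w u) (hu' : IsSmoothTensor w u')
    {f f' : JetSpace X r s V k δ} (hf : IsJet X w u f) (hf' : IsJet X w u' f') :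
    IsJet X w (u + u') (f + f') := fun j => by
  filter_upwards [hf j, hf' j, Lp.coeFn_add (f j) (f' j)] with x h1 h2 h3
  rw [iterCov_add X.metric hu hu', Pi.add_apply, frameComp_add, ← h1, ← h2]
  exact h3

theorem IsJet.smul (a : ℝ) {u : M → TComp r s V} (hu : IsSmoothTensor w u)
    {f : JetSpace X r s V k δ} (hf : IsJet X w u f) : IsJet X w (a • u) (a • f) := fun j => by
  filter_upwards [hf j, Lp.coeFn_smul a (f j)] with x h1 h2
  rw [iterCov_smul X.metric a hu, Pi.smul_apply, frameComp_smul, ← h1]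
  exact h2

variable (w P k δ) in
/-- The pairs consisting of the jet and the restriction to the surface of a test section. -/
def traceGraph : Submodule ℝ (JetSpace X r s V k δ × SurfaceL2 Y r s V) where
  carrier := {p | ∃ u : M → TComp r s V, IsTestSection w P u ∧ IsJet X w u p.1 ∧
    ∀ᵐ y ∂(surfaceArea Y), p.2 y = frameComp X.metric w (Y.ι y) (u (Y.ι y))}
  add_mem' := by
    rintro p p' ⟨u, hu, hj, ht⟩ ⟨u', hu', hj', ht'⟩
    refine ⟨u + u', hu.add hu', hj.add hu.smooth hu'.smooth hj', ?_⟩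
    filter_upwards [ht, ht', Lp.coeFn_add p.2 p'.2] with y h1 h2 h3
    rw [Pi.add_apply, frameComp_add, ← h1, ← h2]
    exact h3
  zero_mem' := by
    have h0 : IsSmoothTensor w (0 : M → TComp r s V) := fun p => by
      have : chartComp w (0 : M → TComp r s V) p = 0 := by
        simpa using chartComp_smul w 0 (0 : M → TComp r s V) p
      rw [this]
      exact contDiffOn_const (c := (0 : TComp r s V))
    have hi : ∀ j, iterCov X.metric w j (0 : M → TComp r s V) = 0 := fun j => by
      simpa using iterCov_smul X.metric 0 h0 j
    have hfr : ∀ (s : ℕ) (x : M), frameComp X.metric w x (0 : TComp r s V) = 0 := fun s x => by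
      simpa using frameComp_smul X.metric w x 0 (0 : TComp r s V)
    refine ⟨0, ⟨h0, ⟨∅, isCompact_empty, fun _ _ => rfl⟩, fun _ => P.zero_mem⟩, fun j => ?_, ?_⟩
    · filter_upwards [Lp.coeFn_zero (PiLp 2 fun _ : TIdx r (s + (j : ℕ)) => V) 2
        (weightedVolume X (δ - ((j : ℕ) : ℝ)))] with x hx
      rw [hi, Pi.zero_apply, hfr]
      exact hx
    · filter_upwards [Lp.coeFn_zero (PiLp 2 fun _ : TIdx r s => V) 2 (surfaceArea Y)] with y hy
      rw [Pi.zero_apply, hfr]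
      exact hy
  smul_mem' := by
    rintro a p ⟨u, hu, hj, ht⟩
    refine ⟨a • u, hu.smul a, hj.smul a hu.smooth, ?_⟩
    filter_upwards [ht, Lp.coeFn_smul a p.2] with y h1 h2
    rw [Pi.smul_apply, frameComp_smul, ← h1]
    exact h2

/-- The set in the definition of the trace is already a subspace, so traces depend linearly on
sections. -/
theorem isTrace_iff (f : sobolev X w P k δ) (t : SurfaceL2 Y r s V) :
    IsTrace Y f t ↔ ((f : JetSpace X r s V k δ), t) ∈ (traceGraph w P Y k δ).topologicalClosure :=
  Iff.rfl

variable [BorelSpace M] [IsManifold 𝓘(ℝ, E2) ∞ S] [CompactSpace S] [BorelSpace S]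

/-- The trace inequality for smooth sections. -/
theorem exists_lintegral_surface_le (V : Type*) [NormedAddCommGroup V] [NormedSpace ℝ V]
    (r s w : ℕ) {k : ℕ} (hk : 1 ≤ k) (δ : ℝ) :
    ∃ C : ℝ≥0∞, C ≠ ⊤ ∧ ∀ (u : M → TComp r s V) (f : JetSpace X r s V k δ), IsSmoothTensor w u →
      IsJet X w u f →
      ∫⁻ y, ‖frameComp X.metric w (Y.ι y) (u (Y.ι y))‖ₑ ^ 2 ∂(surfaceArea Y) ≤ C * ‖f‖ₑ ^ 2 := by
  obtain ⟨t, ht⟩ := exists_finset_sliceAt Y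
  have h := fun y : t => (sliceAt Y (y : S)).exists_lintegral_frameComp_le (V := V) (r := r)
    (s := s) w hk δ
  choose C hC hle using h
  refine ⟨∑ y, C y, ENNReal.sum_ne_top.2 fun y _ => hC y, fun u f hu hf => ?_⟩
  rw [← setLIntegral_univ, ← ht]
  refine (lintegral_iUnion_le _ _).trans ?_
  rw [tsum_fintype, Finset.sum_mul]
  exact Finset.sum_le_sum fun y _ => hle y u f hu hf

/-- The trace inequality passes to the closure of the graph; hence this closure is the graph of a
bounded operator. -/
theorem exists_norm_le_of_mem_traceGraph (hk : 1 ≤ k) : ∃ C : ℝ, 0 ≤ C ∧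
    ∀ p ∈ (traceGraph w P Y k δ).topologicalClosure, ‖p.2‖ ≤ C * ‖p.1‖ := by
  obtain ⟨C, hC, hle⟩ := exists_lintegral_surface_le Y V r s w hk δ
  refine ⟨(C + 1).toReal, ENNReal.toReal_nonneg, ?_⟩
  have hcl : IsClosed {p : JetSpace X r s V k δ × SurfaceL2 Y r s V |
      ‖p.2‖ ≤ (C + 1).toReal * ‖p.1‖} :=
    isClosed_le continuous_snd.norm (continuous_const.mul continuous_fst.norm)
  have hsub : (traceGraph w P Y k δ : Set (JetSpace X r s V k δ × SurfaceL2 Y r s V)) ⊆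
      {p | ‖p.2‖ ≤ (C + 1).toReal * ‖p.1‖} := by
    rintro p ⟨u, hu, hj, ht⟩
    have h1 : ‖p.2‖ₑ ^ 2 ≤ C * ‖p.1‖ₑ ^ 2 := by
      rw [← lintegral_enorm_sq_eq]
      refine le_trans (le_of_eq (lintegral_congr_ae ?_)) (hle u p.1 hu.smooth hj)
      filter_upwards [ht] with y hy
      rw [hy]
    have h2 : ‖p.2‖ₑ ^ 2 ≤ ((C + 1) * ‖p.1‖ₑ) ^ 2 := by
      refine h1.trans ?_
      rw [mul_pow]
      gcongr
      calc C ≤ C + 1 := le_self_add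
        _ = (C + 1) * 1 := (mul_one _).symm
        _ ≤ (C + 1) * (C + 1) := by gcongr; exact le_add_self
        _ = _ := (sq _).symm
    have h3 : ‖p.2‖ₑ ≤ (C + 1) * ‖p.1‖ₑ := (ENNReal.pow_right_strictMono two_ne_zero).le_iff_le.1 h2
    have h4 := ENNReal.toReal_mono (ENNReal.mul_ne_top (by simp [hC]) (by simp)) h3
    simpa [ENNReal.toReal_mul] using h4
  exact fun p hp => closure_minimal hsub hcl hp

theorem IsTrace.unique (hk : 1 ≤ k) {f : sobolev X w P k δ} {t t' : SurfaceL2 Y r s V}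
    (h : IsTrace Y f t) (h' : IsTrace Y f t') : t = t' := by
  obtain ⟨C, -, hC⟩ := exists_norm_le_of_mem_traceGraph (w := w) (P := P) (δ := δ) Y hk
  rw [isTrace_iff] at h h'
  have := hC _ (Submodule.sub_mem _ h h')
  simp only [Prod.fst_sub, Prod.snd_sub, sub_self, norm_zero, mul_zero] at this
  exact sub_eq_zero.1 (norm_le_zero_iff.1 this)

/-- Along a sequence of jets converging in the Sobolev norm, the restrictions to the surface form a
Cauchy sequence by the trace inequality, and its limit is a trace. -/
theorem exists_isTrace [CompleteSpace V] (hk : 1 ≤ k) (f : sobolev X w P k δ) :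
    ∃ t, IsTrace Y f t := by
  obtain ⟨C, hC0, hC⟩ := exists_norm_le_of_mem_traceGraph (w := w) (P := P) (δ := δ) Y hk
  obtain ⟨C', hC', hle⟩ := exists_lintegral_surface_le Y V r s w hk δ
  set G := traceGraph w P Y k δ
  -- every combination of jets of test sections has a square integrable restriction to the surface
  have hspan : Submodule.span ℝ {f : JetSpace X r s V k δ | ∃ u, IsTestSection w P u ∧ IsJet X w u f}
      ≤ G.map (LinearMap.fst ℝ _ _) := by
    refine Submodule.span_le.2 ?_
    rintro f ⟨u, hu, hj⟩
    have hm : AEStronglyMeasurable (fun y => frameComp X.metric w (Y.ι y) (u (Y.ι y)))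
        (surfaceArea Y) := by
      have hι : Measurable Y.ι := Y.embedding.isEmbedding.continuous.measurable
      exact (aestronglyMeasurable_frameComp X.metric hu.smooth
        ((surfaceArea Y).map Y.ι)).comp_measurable hι
    have hmem : MemLp (fun y => frameComp X.metric w (Y.ι y) (u (Y.ι y))) 2 (surfaceArea Y) := by
      refine ⟨hm, ?_⟩
      have h := eLpNorm_nnreal_pow_eq_lintegral (μ := surfaceArea Y)
        (f := fun y => frameComp X.metric w (Y.ι y) (u (Y.ι y))) (p := 2) (by simp)
      have h2 : ∫⁻ y, ‖frameComp X.metric w (Y.ι y) (u (Y.ι y))‖ₑ ^ 2 ∂(surfaceArea Y) < ⊤ :=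
        (hle u f hu.smooth hj).trans_lt (ENNReal.mul_lt_top hC'.lt_top (by simp))
      by_contra hcon
      rw [not_lt, top_le_iff] at hcon
      norm_num [hcon] at h
      exact h2.ne h.symm
    exact ⟨(f, hmem.toLp), ⟨u, hu, hj, hmem.coeFn_toLp⟩, rfl⟩
  obtain ⟨a, ha, hlim⟩ := mem_closure_iff_seq_limit.1 f.2
  have ha' : ∀ n, ∃ t, (a n, t) ∈ G := fun n => by
    obtain ⟨⟨b, t⟩, hG, hb⟩ := hspan (ha n)
    simp only [LinearMap.fst_apply] at hb
    exact ⟨t, hb ▸ hG⟩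
  choose t ht using ha'
  have hcau : CauchySeq t := by
    have ha2 : CauchySeq a := hlim.cauchySeq
    rw [Metric.cauchySeq_iff] at ha2 ⊢
    intro ε hε
    obtain ⟨N, hN⟩ := ha2 (ε / (C + 1)) (by positivity)
    refine ⟨N, fun m hm n hn => ?_⟩
    have h1 := hC _ (G.le_topologicalClosure (G.sub_mem (ht m) (ht n)))
    have h2 := hN m hm n hn
    rw [dist_eq_norm] at h2 ⊢
    rw [lt_div_iff₀ (by positivity)] at h2
    simp only [Prod.fst_sub, Prod.snd_sub] at h1
    nlinarith [norm_nonneg (a m - a n)]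
  obtain ⟨t₀, ht₀⟩ := cauchySeq_tendsto_of_complete hcau
  refine ⟨t₀, mem_closure_of_tendsto (hlim.prodMk_nhds ht₀) (Filter.Eventually.of_forall fun n => ?_)⟩
  exact ht n

theorem isTrace_surfaceTrace [CompleteSpace V] (hk : 1 ≤ k) (f : sobolev X w P k δ) :
    IsTrace Y f (surfaceTrace Y f) := by
  have h := exists_isTrace Y hk f
  rw [surfaceTrace, dif_pos h]
  exact h.choose_spec

theorem existsUnique_isTrace [CompleteSpace V] (hk : 1 ≤ k) (f : sobolev X w P k δ) :
    ∃! t, IsTrace Y f t :=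
  ⟨_, isTrace_surfaceTrace Y hk f, fun _ h => h.unique Y hk (isTrace_surfaceTrace Y hk f)⟩

end Trace

section TraceOp

variable {M : Type*} [TopologicalSpace M] [ChartedSpace E3 M] [IsManifold 𝓘(ℝ, E3) ∞ M]
  [SecondCountableTopology M] [Nonempty M] [MeasurableSpace M] [BorelSpace M]
  {X : AFBackground M} {S : Type*} [TopologicalSpace S] [ChartedSpace E2 S]
  [IsManifold 𝓘(ℝ, E2) ∞ S] [CompactSpace S] [MeasurableSpace S] [BorelSpace S]
  {V : Type*} [NormedAddCommGroup V] [NormedSpace ℝ V] {r s w : ℕ}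
  {P : Submodule ℝ (TComp r s V)} (Y : SeparatingSurface X S) {k : ℕ} {δ : ℝ}

variable (w P δ) in
/-- The trace as a linear map. -/
def traceLin [CompleteSpace V] (hk : 1 ≤ k) : sobolev X w P k δ →ₗ[ℝ] SurfaceL2 Y r s V where
  toFun := surfaceTrace Y
  map_add' f f' := by
    refine IsTrace.unique Y hk (isTrace_surfaceTrace Y hk (f + f')) ?_
    have h := isTrace_surfaceTrace Y hk f
    have h' := isTrace_surfaceTrace Y hk f'
    rw [isTrace_iff] at h h' ⊢
    exact Submodule.add_mem _ h h'
  map_smul' a f := by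
    refine IsTrace.unique Y hk (isTrace_surfaceTrace Y hk (a • f)) ?_
    have h := isTrace_surfaceTrace Y hk f
    rw [isTrace_iff] at h ⊢
    exact Submodule.smul_mem _ a h

theorem exists_norm_trace_le (hk : 1 ≤ k) : ∃ C : ℝ, ∀ f : sobolev X w P k δ, ∀ t,
    IsTrace Y f t → ‖t‖ ≤ C * ‖(f : JetSpace X r s V k δ)‖ := by
  obtain ⟨C, -, hC⟩ := exists_norm_le_of_mem_traceGraph (w := w) (P := P) (δ := δ) Y hk
  exact ⟨C, fun f t h => hC (f, t) h⟩

theorem exists_norm_surfaceTrace_le [CompleteSpace V] (hk : 1 ≤ k) :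
    ∃ C : ℝ, ∀ f : sobolev X w P k δ, ‖surfaceTrace Y f‖ ≤ C * ‖f‖ := by
  obtain ⟨C, hC⟩ := exists_norm_trace_le (w := w) (P := P) (δ := δ) Y hk
  exact ⟨C, fun f => hC f (surfaceTrace Y f) (isTrace_surfaceTrace Y hk f)⟩

variable (w P δ) in
/-- The trace as a bounded linear operator. -/
def traceOp [CompleteSpace V] (hk : 1 ≤ k) : sobolev X w P k δ →L[ℝ] SurfaceL2 Y r s V :=
  (traceLin w P Y δ hk).mkContinuousOfExistsBound (exists_norm_surfaceTrace_le Y hk)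

end TraceOp

/-! ### The sides of the surface and its conormal -/

section Normal

variable {M : Type*} [TopologicalSpace M] [ChartedSpace E3 M] [IsManifold 𝓘(ℝ, E3) ∞ M]
  {X : AFBackground M} {S : Type*} [TopologicalSpace S] [ChartedSpace E2 S]

namespace SliceChart

variable {Y : SeparatingSurface X S} {p : M} (c : SliceChart Y p)

theorem P_ψ {z : E2} (hz : z ∈ Metric.closedBall c.z₀ c.ε) : c.P (c.ψ z) = (z, 0) :=
  c.P.right_inv (c.mk_mem_target hz)

/-- Points near the surface lie in the box. -/
theorem eventually_mem_box {y : S} (hy : y ∈ c.U) : ∀ᶠ x in 𝓝 (Y.ι y),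
    x ∈ (chartAt E3 p).source ∧ chartAt E3 p x ∈ c.P.source ∧
      c.P (chartAt E3 p x) ∈ Metric.ball c.z₀ c.ε ×ˢ Ioo (-c.ε) c.ε := by
  have hz := c.mem_closedBall_of_mem hy
  have h1 := c.ι_mem_source hy
  have h2 : chartAt E3 p (Y.ι y) ∈ c.P.source := by
    rw [c.chart_ι hy]; exact c.ψ_mem_source hz
  have h3 : c.P (chartAt E3 p (Y.ι y)) ∈ Metric.ball c.z₀ c.ε ×ˢ Ioo (-c.ε) c.ε := by
    rw [c.chart_ι hy, c.P_ψ hz]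
    exact ⟨hy.2, neg_lt_zero.2 c.ε_pos, c.ε_pos⟩
  have hc := (chartAt E3 p).continuousAt h1
  refine ((chartAt E3 p).open_source.eventually_mem h1).and
    ((hc.eventually_mem (c.P.open_source.mem_nhds h2)).and ?_)
  exact (ContinuousAt.comp (c.P.continuousAt h2) hc).eventually_mem
    ((Metric.isOpen_ball.prod isOpen_Ioo).mem_nhds h3)

/-- The outside of the surface is exactly one side of it. -/
theorem exists_side (hne : c.U.Nonempty) : ∃ s : ℝ, (s = 1 ∨ s = -1) ∧
    ∀ z ∈ Metric.ball c.z₀ c.ε, ∀ t ∈ Ioo (-c.ε) c.ε,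
      (0 < s * t → (chartAt E3 p).symm (c.P.symm (z, t)) ∈ Y.outside) ∧
      (s * t < 0 → (chartAt E3 p).symm (c.P.symm (z, t)) ∈ Y.inside) := by
  set Φ : E2 × ℝ → M := fun x => (chartAt E3 p).symm (c.P.symm x) with hΦ
  have hbox : Metric.ball c.z₀ c.ε ×ˢ Ioo (-c.ε) c.ε ⊆ c.P.target :=
    (prod_mono Metric.ball_subset_closedBall Ioo_subset_Icc_self).trans c.box_subset
  have hcont : ContinuousOn Φ (Metric.ball c.z₀ c.ε ×ˢ Ioo (-c.ε) c.ε) :=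
    (chartAt E3 p).continuousOn_symm.comp (c.P.continuousOn_symm.mono hbox)
      fun x hx => c.source_subset (c.P.map_target (hbox hx))
  -- a connected piece of the box away from the surface lies on one side
  have hpiece : ∀ I : Set ℝ, IsPreconnected I → I ⊆ Ioo (-c.ε) c.ε → (0 : ℝ) ∉ I →
      Φ '' (Metric.ball c.z₀ c.ε ×ˢ I) ⊆ Y.outside ∨ Φ '' (Metric.ball c.z₀ c.ε ×ˢ I) ⊆ Y.inside := by
    intro I hI hIs h0
    have hconn : IsPreconnected (Φ '' (Metric.ball c.z₀ c.ε ×ˢ I)) :=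
      ((convex_ball c.z₀ c.ε).isPreconnected.prod hI).image _ (hcont.mono (prod_mono le_rfl hIs))
    refine hconn.subset_or_subset Y.isOpen_outside Y.isOpen_inside Y.disjoint ?_
    rw [← Y.compl_range]
    rintro _ ⟨⟨z, t⟩, ⟨hz, ht⟩, rfl⟩ hr
    have := c.range_subset z (Metric.ball_subset_closedBall hz) t (Ioo_subset_Icc_self (hIs ht)) hr
    exact h0 (this ▸ ht)
  -- both components of the complement meet the box
  have hmeet : ∀ O : Set M, range Y.ι ⊆ closure O → Disjoint (range Y.ι) O →
      ∃ z ∈ Metric.ball c.z₀ c.ε, ∃ t ∈ Ioo (-c.ε) c.ε, t ≠ 0 ∧ Φ (z, t) ∈ O := by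
    intro O hO hdis
    obtain ⟨y, hy⟩ := hne
    obtain ⟨x, hxO, h1, h2, h3⟩ :=
      ((mem_closure_iff_frequently.1 (hO ⟨y, rfl⟩)).and_eventually (c.eventually_mem_box hy)).exists
    have hx : Φ (c.P (chartAt E3 p x)) = x := by
      rw [hΦ]
      simp only
      rw [c.P.left_inv h2, (chartAt E3 p).left_inv h1]
    refine ⟨_, h3.1, _, h3.2, fun h0 => ?_, by rw [Prod.mk.eta, hx]; exact hxO⟩
    refine disjoint_left.1 hdis ?_ hxO
    have h4 := c.slice _ (Metric.ball_subset_closedBall h3.1)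
    rw [← h0] at h4
    exact ⟨_, h4.symm.trans hx⟩
  have hro : Disjoint (range Y.ι) Y.outside := by
    rw [disjoint_left]
    intro x hx hxo
    exact (show x ∈ (range Y.ι)ᶜ by rw [Y.compl_range]; exact Or.inl hxo) hx
  have hri : Disjoint (range Y.ι) Y.inside := by
    rw [disjoint_left]
    intro x hx hxo
    exact (show x ∈ (range Y.ι)ᶜ by rw [Y.compl_range]; exact Or.inr hxo) hx
  obtain ⟨z₁, hz₁, t₁, ht₁, h₁0, h₁⟩ := hmeet _ Y.subset_closure_outside hro
  obtain ⟨z₂, hz₂, t₂, ht₂, h₂0, h₂⟩ := hmeet _ Y.subset_closure_inside hri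
  have hε := c.ε_pos
  have hcon : ∀ {x : M}, x ∈ Y.outside → x ∈ Y.inside → False := fun h h' =>
    disjoint_left.1 Y.disjoint h h'
  have hp := hpiece (Ioo 0 c.ε) isPreconnected_Ioo (Ioo_subset_Ioo_left (by linarith)) (by simp)
  have hn := hpiece (Ioo (-c.ε) 0) isPreconnected_Ioo (Ioo_subset_Ioo_right hε.le) (by simp)
  have key : (Φ '' (Metric.ball c.z₀ c.ε ×ˢ Ioo 0 c.ε) ⊆ Y.outside ∧
      Φ '' (Metric.ball c.z₀ c.ε ×ˢ Ioo (-c.ε) 0) ⊆ Y.inside) ∨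
      (Φ '' (Metric.ball c.z₀ c.ε ×ˢ Ioo 0 c.ε) ⊆ Y.inside ∧
      Φ '' (Metric.ball c.z₀ c.ε ×ˢ Ioo (-c.ε) 0) ⊆ Y.outside) := by
    rcases hp with hp | hp <;> rcases hn with hn | hn
    · exfalso
      rcases lt_or_gt_of_ne h₂0 with h | h
      · exact hcon (hn ⟨(z₂, t₂), ⟨hz₂, ht₂.1, h⟩, rfl⟩) h₂
      · exact hcon (hp ⟨(z₂, t₂), ⟨hz₂, h, ht₂.2⟩, rfl⟩) h₂
    · exact Or.inl ⟨hp, hn⟩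
    · exact Or.inr ⟨hp, hn⟩
    · exfalso
      rcases lt_or_gt_of_ne h₁0 with h | h
      · exact hcon h₁ (hn ⟨(z₁, t₁), ⟨hz₁, ht₁.1, h⟩, rfl⟩)
      · exact hcon h₁ (hp ⟨(z₁, t₁), ⟨hz₁, h, ht₁.2⟩, rfl⟩)
  rcases key with ⟨hp, hn⟩ | ⟨hp, hn⟩
  · refine ⟨1, Or.inl rfl, fun z hz t ht => ⟨fun h => ?_, fun h => ?_⟩⟩
    · exact hp ⟨(z, t), ⟨hz, by linarith, ht.2⟩, rfl⟩
    · exact hn ⟨(z, t), ⟨hz, ht.1, by linarith⟩, rfl⟩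
  · refine ⟨-1, Or.inr rfl, fun z hz t ht => ⟨fun h => ?_, fun h => ?_⟩⟩
    · exact hn ⟨(z, t), ⟨hz, ht.1, by linarith⟩, rfl⟩
    · exact hp ⟨(z, t), ⟨hz, by linarith, ht.2⟩, rfl⟩

/-- The differential of the defining function `t` of the surface, in the chart at `p`. -/
def dt (z : E3) : E3 →L[ℝ] ℝ := fderiv ℝ (fun z => (c.P z).2) z

theorem contDiffAt_t {z : E3} (hz : z ∈ c.P.source) : ContDiffAt ℝ ∞ (fun z => (c.P z).2) z :=
  (c.contDiffOn.contDiffAt (c.P.open_source.mem_nhds hz)).snd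

theorem fderiv_symm_comp {z : E2} (hz : z ∈ Metric.closedBall c.z₀ c.ε) (v : E3) :
    fderiv ℝ c.P.symm (z, 0) (fderiv ℝ c.P (c.ψ z) v) = v := by
  have hs := c.ψ_mem_source hz
  have h1 : HasFDerivAt c.P (fderiv ℝ c.P (c.ψ z)) (c.ψ z) :=
    ((c.contDiffOn.contDiffAt (c.P.open_source.mem_nhds hs)).differentiableAt (by simp)).hasFDerivAt
  have h2 : HasFDerivAt c.P.symm (fderiv ℝ c.P.symm (z, 0)) (c.P (c.ψ z)) := by
    rw [c.P_ψ hz]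
    exact ((c.contDiffOn_symm.contDiffAt (c.P.open_target.mem_nhds
      (c.mk_mem_target hz))).differentiableAt (by simp)).hasFDerivAt
  have h3 := (h2.comp _ h1).congr_of_eventuallyEq (f₁ := id) (by
    filter_upwards [c.P.open_source.mem_nhds hs] with x hx
    simp [c.P.left_inv hx])
  have h4 := h3.unique (hasFDerivAt_id _)
  exact DFunLike.congr_fun h4 v

theorem fderiv_comp_symm {z : E2} (hz : z ∈ Metric.closedBall c.z₀ c.ε) (v : E2 × ℝ) :
    fderiv ℝ c.P (c.ψ z) (fderiv ℝ c.P.symm (z, 0) v) = v := by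
  have hs := c.ψ_mem_source hz
  have h1 : HasFDerivAt c.P (fderiv ℝ c.P (c.ψ z)) (c.P.symm (z, 0)) :=
    ((c.contDiffOn.contDiffAt (c.P.open_source.mem_nhds hs)).differentiableAt (by simp)).hasFDerivAt
  have h2 : HasFDerivAt c.P.symm (fderiv ℝ c.P.symm (z, 0)) (z, 0) :=
    ((c.contDiffOn_symm.contDiffAt (c.P.open_target.mem_nhds
      (c.mk_mem_target hz))).differentiableAt (by simp)).hasFDerivAt
  have h3 := (h1.comp _ h2).congr_of_eventuallyEq (f₁ := id) (by
    filter_upwards [c.P.open_target.mem_nhds (c.mk_mem_target hz)] with x hx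
    simp [c.P.right_inv hx])
  have h4 := h3.unique (hasFDerivAt_id _)
  exact DFunLike.congr_fun h4 v

theorem dt_apply {z : E3} (hz : z ∈ c.P.source) (v : E3) : c.dt z v = (fderiv ℝ c.P z v).2 := by
  have h1 : HasFDerivAt c.P (fderiv ℝ c.P z) z :=
    ((c.contDiffOn.contDiffAt (c.P.open_source.mem_nhds hz)).differentiableAt (by simp)).hasFDerivAt
  rw [dt, h1.snd.fderiv]
  rfl

theorem fderiv_ψ_apply {z : E2} (hz : z ∈ Metric.closedBall c.z₀ c.ε) (a : E2) :
    fderiv ℝ c.ψ z a = fderiv ℝ c.P.symm (z, 0) (a, 0) := by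
  have h2 : HasFDerivAt c.P.symm (fderiv ℝ c.P.symm (z, 0)) (z, 0) :=
    ((c.contDiffOn_symm.contDiffAt (c.P.open_target.mem_nhds
      (c.mk_mem_target hz))).differentiableAt (by simp)).hasFDerivAt
  have h3 : HasFDerivAt (fun z : E2 => (z, (0 : ℝ))) (ContinuousLinearMap.inl ℝ E2 ℝ) z :=
    (hasFDerivAt_id z).prodMk (hasFDerivAt_const (0 : ℝ) z)
  have h4 : HasFDerivAt c.ψ _ z := HasFDerivAt.comp z h2 h3
  rw [h4.fderiv]
  simp

/-- The tangent space of the slice is the kernel of `dt`. -/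
theorem dt_eq_zero_iff {z : E2} (hz : z ∈ Metric.closedBall c.z₀ c.ε) (v : E3) :
    c.dt (c.ψ z) v = 0 ↔ ∃ a, fderiv ℝ c.ψ z a = v := by
  rw [c.dt_apply (c.ψ_mem_source hz)]
  constructor
  · intro h
    refine ⟨(fderiv ℝ c.P (c.ψ z) v).1, ?_⟩
    have h' : ((fderiv ℝ c.P (c.ψ z) v).1, (0 : ℝ)) = fderiv ℝ c.P (c.ψ z) v := by rw [← h]
    rw [c.fderiv_ψ_apply hz, h', c.fderiv_symm_comp hz]
  · rintro ⟨a, rfl⟩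
    rw [c.fderiv_ψ_apply hz, c.fderiv_comp_symm hz]

theorem exists_dt_ne_zero {z : E2} (hz : z ∈ Metric.closedBall c.z₀ c.ε) :
    ∃ v, c.dt (c.ψ z) v ≠ 0 := by
  refine ⟨fderiv ℝ c.P.symm (z, 0) (0, 1), ?_⟩
  rw [c.dt_apply (c.ψ_mem_source hz), c.fderiv_comp_symm hz]
  exact one_ne_zero

variable [IsManifold 𝓘(ℝ, E2) ∞ S]

/-- The tangent space of the surface, in the chart at `p`, is the kernel of `dt`. -/
theorem dt_eq_zero_iff_mfderiv {y : S} (hy : y ∈ c.U) (v : E3) :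
    c.dt (c.ψ (c.θ y)) v = 0 ↔
      ∃ t : E2, toChart p (Y.ι y) (mfderiv 𝓘(ℝ, E2) 𝓘(ℝ, E3) Y.ι y t : E3) = v := by
  have hz := c.mem_closedBall_of_mem hy
  rw [c.dt_eq_zero_iff hz]
  set e := chartAt E2 y
  have hys : y ∈ e.source := mem_chart_source E2 y
  have het : e y ∈ e.target := e.map_source hys
  have hsy : e.symm (e y) = y := e.left_inv hys
  set τ := c.θ ∘ e.symm with hτ
  -- the transition map between the two charts of the surface is a diffeomorphism
  have hτd : DifferentiableAt ℝ τ (e y) := by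
    refine ((contDiffOn_chartChange (IsManifold.chart_mem_maximalAtlas y) c.θ_mem).contDiffAt
      ((OpenPartialHomeomorph.open_source _).mem_nhds ?_)).differentiableAt (by simp)
    exact ⟨het, (by rw [hsy]; exact hy.1 : e.symm (e y) ∈ c.θ.source)⟩
  have hτd' : DifferentiableAt ℝ (e ∘ c.θ.symm) (c.θ y) := by
    refine ((contDiffOn_chartChange c.θ_mem (IsManifold.chart_mem_maximalAtlas y)).contDiffAt
      ((OpenPartialHomeomorph.open_source _).mem_nhds ?_)).differentiableAt (by simp)
    exact ⟨c.θ.map_source hy.1,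
      (by rw [c.θ.left_inv hy.1]; exact hys : c.θ.symm (c.θ y) ∈ e.source)⟩
  have hτy : τ (e y) = c.θ y := by simp [hτ, hsy]
  have hsurj : ∀ a, fderiv ℝ τ (e y) (fderiv ℝ (e ∘ c.θ.symm) (c.θ y) a) = a := by
    intro a
    have h0 : (e ∘ c.θ.symm) (c.θ y) = e y := by simp [c.θ.left_inv hy.1]
    have h1 : HasFDerivAt τ (fderiv ℝ τ (e y)) ((e ∘ c.θ.symm) (c.θ y)) := by
      rw [h0]; exact hτd.hasFDerivAt
    have h3 := (h1.comp _ hτd'.hasFDerivAt).congr_of_eventuallyEq (f₁ := id) (by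
      have hmem : c.θ.symm ⁻¹' e.source ∈ 𝓝 (c.θ y) :=
        (c.θ.symm.continuousAt (c.θ.map_source hy.1)).preimage_mem_nhds
          (e.open_source.mem_nhds (by rw [c.θ.left_inv hy.1]; exact hys))
      filter_upwards [c.θ.open_target.mem_nhds (c.θ.map_source hy.1), hmem] with x hx hx'
      simp [hτ, e.left_inv hx', c.θ.right_inv hx])
    exact DFunLike.congr_fun (h3.unique (hasFDerivAt_id _)) a
  have hev : chartAt E3 p ∘ Y.ι ∘ e.symm =ᶠ[𝓝 (e y)] c.ψ ∘ τ := by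
    filter_upwards [(e.symm.continuousAt het).eventually_mem
      (c.isOpen_U.mem_nhds (by rw [hsy]; exact hy))] with x hx
    exact c.chart_ι hx
  have hψ : DifferentiableAt ℝ c.ψ (τ (e y)) := by
    rw [hτy]; exact (c.contDiffAt_ψ hz).differentiableAt (by simp)
  have hmf : ∀ t : E2, toChart p (Y.ι y) (mfderiv 𝓘(ℝ, E2) 𝓘(ℝ, E3) Y.ι y t : E3) =
      fderiv ℝ c.ψ (c.θ y) (fderiv ℝ τ (e y) t) := by
    intro t
    have h1 : ContMDiffAt 𝓘(ℝ, E2) 𝓘(ℝ, E3) ∞ Y.ι y :=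
      Y.embedding.isImmersion.contMDiff.contMDiffAt
    have h2 : MDifferentiableAt 𝓘(ℝ, E2) 𝓘(ℝ, E3) Y.ι y := h1.mdifferentiableAt (by simp)
    have h4 : writtenInExtChartAt 𝓘(ℝ, E2) 𝓘(ℝ, E3) y Y.ι = chartAt E3 (Y.ι y) ∘ Y.ι ∘ e.symm := by
      ext x : 1
      simp [e]
    have h5 : extChartAt 𝓘(ℝ, E2) y y = e y := by simp [e]
    have h3 := h2.differentiableWithinAt_writtenInExtChartAt
    have h6 : fderivWithin ℝ (writtenInExtChartAt 𝓘(ℝ, E2) 𝓘(ℝ, E3) y Y.ι) (range 𝓘(ℝ, E2))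
        (extChartAt 𝓘(ℝ, E2) y y) = fderiv ℝ (chartAt E3 (Y.ι y) ∘ Y.ι ∘ e.symm) (e y) := by
      rw [h4, h5]
      simp
    rw [h4, h5] at h3
    simp only [modelWithCornersSelf_coe, range_id, differentiableWithinAt_univ] at h3
    have h7 := h2.mfderiv.trans h6
    rw [h7]
    have hcont : ContinuousAt (Y.ι ∘ e.symm) (e y) :=
      Y.embedding.isEmbedding.continuous.continuousAt.comp (e.symm.continuousAt het)
    refine (toChart_fderiv hcont (by simp [hsy]) (c.ι_mem_source hy) h3 t).trans ?_
    rw [hev.fderiv_eq, fderiv_comp _ hψ hτd, hτy]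
    rfl
  constructor
  · rintro ⟨a, rfl⟩
    exact ⟨_, by rw [hmf, hsurj]⟩
  · rintro ⟨t, rfl⟩
    exact ⟨_, (hmf t).symm⟩

end SliceChart

end Normal

/-! ### The unit normal in the orthonormal frame -/

section FrameVec

variable {M : Type*} [TopologicalSpace M] [ChartedSpace E3 M] [IsManifold 𝓘(ℝ, E3) ∞ M]

theorem toChart_injective {p x : M} (hp : x ∈ (chartAt E3 p).source) :
    Function.Injective (toChart p x) := by
  intro v v' h
  have hd := isUnit_iff_ne_zero.2 (det_chartFrame_ne_zero hp)
  have h1 : (chartFrame p x)⁻¹.mulVec v = (chartFrame p x)⁻¹.mulVec v' := by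
    ext i
    have := congrArg (fun a : E3 => a i) h
    simp only [chartFrame_mulVec_toChart hp] at this
    exact this
  have h2 := congrArg (fun a => (chartFrame p x).mulVec a) h1
  simp only [Matrix.mulVec_mulVec, Matrix.mul_nonsing_inv _ hd, Matrix.one_mulVec] at h2
  ext i
  exact congrFun h2 i

theorem toChart_surjective {p x : M} (hp : x ∈ (chartAt E3 p).source) (u : E3) :
    ∃ v, toChart p x v = u := by
  refine ⟨WithLp.toLp 2 ((chartFrame p x).mulVec u), ?_⟩
  ext i
  rw [chartFrame_mulVec_toChart hp]
  have : (chartFrame p x)⁻¹.mulVec ((chartFrame p x).mulVec u) = u := by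
    rw [Matrix.mulVec_mulVec, Matrix.nonsing_inv_mul _
      (isUnit_iff_ne_zero.2 (det_chartFrame_ne_zero hp)), Matrix.one_mulVec]
  exact congrFun this i

variable [SecondCountableTopology M] [Nonempty M]

theorem det_orthoFrame_ne_zero (g : RMetric M) (x : M) : (orthoFrame g x).det ≠ 0 := by
  intro h
  have := congrArg Matrix.det (orthoFrame_orthonormal g x)
  simp [h] at this

/-- The tangent vector at `x` with components `ν` in the orthonormal frame. -/
def ofFrame (g : RMetric M) (x : M) (ν : E3) : E3 := WithLp.toLp 2 ((orthoFrame g x).mulVec ν)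

theorem frameVec_ofFrame (g : RMetric M) (x : M) (ν : E3) : frameVec g x (ofFrame g x ν) = ν := by
  have h : (orthoFrame g x)⁻¹.mulVec ((orthoFrame g x).mulVec ν) = ν := by
    rw [Matrix.mulVec_mulVec,
      Matrix.nonsing_inv_mul _ (isUnit_iff_ne_zero.2 (det_orthoFrame_ne_zero g x)), Matrix.one_mulVec]
  ext i
  exact congrFun h i

theorem ofFrame_frameVec (g : RMetric M) (x : M) (v : E3) : ofFrame g x (frameVec g x v) = v := by
  have h : (orthoFrame g x).mulVec ((orthoFrame g x)⁻¹.mulVec v) = v := by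
    rw [Matrix.mulVec_mulVec,
      Matrix.mul_nonsing_inv _ (isUnit_iff_ne_zero.2 (det_orthoFrame_ne_zero g x)), Matrix.one_mulVec]
  ext i
  exact congrFun h i

theorem inner_ofFrame (g : RMetric M) (x : M) (ν ν' : E3) :
    g.inner x (ofFrame g x ν) (ofFrame g x ν') = inner ℝ ν ν' := by
  have h := orthoFrame_orthonormal g x
  have h2 : ∀ i j, ((orthoFrame g x)ᵀ * gram g x * orthoFrame g x) i j = if i = j then 1 else 0 :=
    fun i j => by rw [h, Matrix.one_apply]
  have h3 : g.inner x (ofFrame g x ν) (ofFrame g x ν') =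
      ∑ i, ∑ j, ν i * ((orthoFrame g x)ᵀ * gram g x * orthoFrame g x) i j * ν' j := by
    rw [inner_eq_gram]
    simp only [ofFrame, Matrix.mulVec, dotProduct, Matrix.mul_apply, Matrix.transpose_apply,
      Fin.sum_univ_three]
    ring
  rw [h3]
  simp only [h2]
  simp [PiLp.inner_apply, mul_comm]

theorem inner_eq_frameVec (g : RMetric M) (x : M) (v v' : E3) :
    g.inner x v v' = inner ℝ (frameVec g x v) (frameVec g x v') := by
  rw [← inner_ofFrame g x, ofFrame_frameVec, ofFrame_frameVec]

theorem toChart_ofFrame (g : RMetric M) {p x : M} (hp : x ∈ (chartAt E3 p).source) (ν : E3)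
    (i : Fin 3) : toChart p x (ofFrame g x ν) i = ∑ j, chartOrtho g p x i j * ν j := by
  rw [chartFrame_mulVec_toChart hp]
  have : (chartFrame p x)⁻¹.mulVec ((orthoFrame g x).mulVec ν) = (chartOrtho g p x).mulVec ν := by
    rw [Matrix.mulVec_mulVec, chartOrtho]
  exact congrFun this i

end FrameVec

/-- A unit vector orthogonal to a plane is determined by its side. -/
theorem eq_smul_of_orthogonal {E : Type*} [NormedAddCommGroup E] [InnerProductSpace ℝ E] {ν m : E}
    {s : ℝ} (hs : s = 1 ∨ s = -1) (h : ∀ η, inner ℝ η m = 0 → inner ℝ ν η = 0)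
    (h1 : inner ℝ ν ν = 1) (hpos : 0 < s * inner ℝ ν m) : ν = s • ‖m‖⁻¹ • m := by
  have hm : m ≠ 0 := by rintro rfl; simp at hpos
  have hm2 : 0 < ‖m‖ := norm_pos_iff.2 hm
  set a := inner ℝ ν m / ‖m‖ ^ 2 with ha
  have h2 : inner ℝ (ν - a • m) m = 0 := by
    rw [inner_sub_left, inner_smul_left, real_inner_self_eq_norm_sq, ha]
    simp only [conj_trivial]
    field_simp
    ring
  have h3 := h _ h2
  have h4 : ν - a • m = 0 := by
    rw [← inner_self_eq_zero (𝕜 := ℝ)]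
    nth_rw 1 [inner_sub_left]
    rw [h3, inner_smul_left, real_inner_comm, h2]
    simp
  have h5 : ν = a • m := sub_eq_zero.1 h4
  have h6 : (a * ‖m‖) ^ 2 = 1 := by
    rw [← h1]
    conv_rhs => rw [h5]
    rw [inner_smul_left, inner_smul_right, real_inner_self_eq_norm_sq]
    simp only [conj_trivial]
    ring
  have h7 : 0 < s * a := by
    rw [ha, ← mul_div_assoc]
    positivity
  have h8 : a * ‖m‖ = s := by
    rcases hs with rfl | rfl
    · have : 0 < a * ‖m‖ := by nlinarith
      nlinarith
    · have : a * ‖m‖ < 0 := by nlinarith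
      nlinarith
  rw [smul_smul, ← h8, mul_assoc, mul_inv_cancel₀ hm2.ne', mul_one]
  exact h5

section Normal

variable {M : Type*} [TopologicalSpace M] [ChartedSpace E3 M] [IsManifold 𝓘(ℝ, E3) ∞ M]
  {X : AFBackground M} {S : Type*} [TopologicalSpace S] [ChartedSpace E2 S]

namespace SliceChart

variable {Y : SeparatingSurface X S} {p : M} (c : SliceChart Y p)

/-- A vector with positive `t`-component, up to the sign `s` of the outside, points outside. -/
theorem eventually_outside {s : ℝ} {O : Set M}
    (hO : ∀ z ∈ Metric.ball c.z₀ c.ε, ∀ t ∈ Ioo (-c.ε) c.ε,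
      0 < s * t → (chartAt E3 p).symm (c.P.symm (z, t)) ∈ O)
    {y : S} (hy : y ∈ c.U) {v : E3} (hv : 0 < s * c.dt (c.ψ (c.θ y)) (toChart p (Y.ι y) v)) :
    ∀ᶠ t : ℝ in 𝓝[>] 0,
      (chartAt E3 (Y.ι y)).symm (chartAt E3 (Y.ι y) (Y.ι y) + t • v) ∈ O := by
  set x := Y.ι y with hx
  have hz := c.mem_closedBall_of_mem hy
  have hp := c.ι_mem_source hy
  have hxs := mem_chart_source E3 x
  set e := chartAt E3 x
  have hL : HasDerivAt (fun t : ℝ => e x + t • v) v 0 := by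
    simpa using ((hasDerivAt_id (0 : ℝ)).smul_const v).const_add (e x)
  have hT : HasFDerivAt (transMap x p) (toChart p x) (e x + (0 : ℝ) • v) := by
    rw [zero_smul, add_zero]
    exact ((contDiffAt_transMap (transDomain_of_mem hxs hp)).differentiableAt (by simp)).hasFDerivAt
  have hTx : transMap x p (e x + (0 : ℝ) • v) = c.ψ (c.θ y) := by
    rw [zero_smul, add_zero, transMap, e.left_inv hxs, c.chart_ι hy]
  have ht : HasFDerivAt (fun z => (c.P z).2) (c.dt (c.ψ (c.θ y)))
      (transMap x p (e x + (0 : ℝ) • v)) := by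
    rw [hTx]
    exact ((c.contDiffAt_t (c.ψ_mem_source hz)).differentiableAt (by simp)).hasFDerivAt
  have hd : HasDerivAt (fun t : ℝ => s * (c.P (transMap x p (e x + t • v))).2)
      (s * c.dt (c.ψ (c.θ y)) (toChart p x v)) 0 := by
    have h1 : HasDerivAt (fun t : ℝ => transMap x p (e x + t • v)) (toChart p x v) 0 :=
      HasFDerivAt.comp_hasDerivAt (f := fun t : ℝ => e x + t • v) (0 : ℝ) hT hL
    have h2 : HasDerivAt (fun t : ℝ => (c.P (transMap x p (e x + t • v))).2)
        (c.dt (c.ψ (c.θ y)) (toChart p x v)) 0 :=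
      HasFDerivAt.comp_hasDerivAt (f := fun t : ℝ => transMap x p (e x + t • v)) (0 : ℝ) ht h1
    exact h2.const_mul s
  have h0 : s * (c.P (transMap x p (e x + (0 : ℝ) • v))).2 = 0 := by
    rw [hTx, c.P_ψ hz, mul_zero]
  have hslope := hd.tendsto_slope_zero_right
  simp only [zero_add, h0, sub_zero, smul_eq_mul] at hslope
  have hcont : ContinuousAt (fun t : ℝ => e.symm (e x + t • v)) 0 := by
    have h1 : ContinuousAt e.symm (e x + (0 : ℝ) • v) := by
      rw [zero_smul, add_zero]
      exact e.symm.continuousAt (e.map_source hxs)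
    exact ContinuousAt.comp (f := fun t : ℝ => e x + t • v) h1 (by fun_prop)
  have hbox : ∀ᶠ t : ℝ in 𝓝 0, e.symm (e x + t • v) ∈ (chartAt E3 p).source ∧
      chartAt E3 p (e.symm (e x + t • v)) ∈ c.P.source ∧
      c.P (chartAt E3 p (e.symm (e x + t • v))) ∈ Metric.ball c.z₀ c.ε ×ˢ Ioo (-c.ε) c.ε := by
    have h1 : Filter.Tendsto (fun t : ℝ => e.symm (e x + t • v)) (𝓝 0) (𝓝 (Y.ι y)) := by
      have h2 : e.symm (e x + (0 : ℝ) • v) = Y.ι y := by rw [zero_smul, add_zero, e.left_inv hxs]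
      rw [← h2]
      exact hcont
    exact h1.eventually (c.eventually_mem_box hy)
  filter_upwards [hslope.eventually (lt_mem_nhds hv), self_mem_nhdsWithin,
    hbox.filter_mono nhdsWithin_le_nhds] with t h1 h2 h3
  obtain ⟨h4, h5, h6⟩ := h3
  have h7 : 0 < s * (c.P (transMap x p (e x + t • v))).2 :=
    (mul_pos_iff_of_pos_left (inv_pos.2 h2)).1 h1
  have h8 := hO _ h6.1 _ h6.2 h7
  rwa [Prod.mk.eta, c.P.left_inv h5, (chartAt E3 p).left_inv h4] at h8

variable [SecondCountableTopology M] [Nonempty M]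

/-- The components of the conormal `dt` in the orthonormal frame. -/
def conormal (y : S) : E3 :=
  WithLp.toLp 2 fun j => ∑ i, c.dt (c.ψ (c.θ y)) (stdVec i) * chartOrtho X.metric p (Y.ι y) i j

/-- The conormal represents the differential `dt` in the orthonormal frame. -/
theorem dt_toChart {y : S} (hy : y ∈ c.U) (v : E3) :
    c.dt (c.ψ (c.θ y)) (toChart p (Y.ι y) v) =
      inner ℝ (frameVec X.metric (Y.ι y) v) (c.conormal y) := by
  have hp := c.ι_mem_source hy
  set ν := frameVec X.metric (Y.ι y) v with hν
  have hv : v = ofFrame X.metric (Y.ι y) ν := (ofFrame_frameVec _ _ v).symm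
  have h1 : c.dt (c.ψ (c.θ y)) (toChart p (Y.ι y) v) =
      ∑ i, toChart p (Y.ι y) v i * c.dt (c.ψ (c.θ y)) (stdVec i) := by
    conv_lhs => rw [eq_sum_stdVec (toChart p (Y.ι y) v)]
    simp
  rw [h1, hv]
  simp only [toChart_ofFrame X.metric hp, conormal, PiLp.inner_apply, Fin.sum_univ_three]
  simp
  ring

theorem aemeasurable_conormal [MeasurableSpace M] [BorelSpace M] [MeasurableSpace S]
    [BorelSpace S] (μ : Measure S) (j : Fin 3) :
    AEMeasurable (fun y => c.conormal y j) (μ.restrict c.U) := by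
  have hι : Measurable Y.ι := Y.embedding.isEmbedding.continuous.measurable
  have hUm := c.isOpen_U.measurableSet
  have hO : ∀ i, AEMeasurable (fun y => chartOrtho X.metric p (Y.ι y) i j) (μ.restrict c.U) := by
    intro i
    have h := aemeasurable_chartOrtho X.metric p ((μ.restrict c.U).map Y.ι) i j
    rw [Measure.restrict_eq_self_of_ae_mem] at h
    · exact h.comp_measurable hι
    · refine (ae_map_iff (p := fun x => x ∈ (chartAt E3 p).source) hι.aemeasurable
        (chartAt E3 p).open_source.measurableSet).2 ?_
      filter_upwards [self_mem_ae_restrict hUm] with y hy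
      exact c.ι_mem_source hy
  have hd : ∀ i, AEMeasurable (fun y => c.dt (c.ψ (c.θ y)) (stdVec i)) (μ.restrict c.U) := by
    intro i
    refine ContinuousOn.aemeasurable (fun y hy => ContinuousAt.continuousWithinAt ?_) hUm
    have hz := c.mem_closedBall_of_mem hy
    have h1 : ContinuousAt (fun y => c.ψ (c.θ y)) y :=
      ContinuousAt.comp (g := c.ψ) (c.contDiffAt_ψ hz).continuousAt (c.θ.continuousAt hy.1)
    have h2 : ContinuousAt (fun z => c.dt z (stdVec i)) (c.ψ (c.θ y)) :=
      ((c.contDiffAt_t (c.ψ_mem_source hz)).fderiv_right (m := ∞)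
        (by norm_cast)).continuousAt.clm_apply continuousAt_const
    exact ContinuousAt.comp (g := fun z => c.dt z (stdVec i)) h2 h1
  simp only [conormal]
  exact Finset.aemeasurable_fun_sum _ fun i _ => (hd i).mul (hO i)

variable [IsManifold 𝓘(ℝ, E2) ∞ S]

/-- If the outside is the side `s t > 0`, there is exactly one outward unit normal, the conormal
normalised and multiplied by `s`. -/
theorem isOutwardUnitNormal_iff {s : ℝ} (hs : s = 1 ∨ s = -1)
    (hside : ∀ z ∈ Metric.ball c.z₀ c.ε, ∀ t ∈ Ioo (-c.ε) c.ε,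
      (0 < s * t → (chartAt E3 p).symm (c.P.symm (z, t)) ∈ Y.outside) ∧
      (s * t < 0 → (chartAt E3 p).symm (c.P.symm (z, t)) ∈ Y.inside))
    {y : S} (hy : y ∈ c.U) (v : E3) : IsOutwardUnitNormal Y y v ↔
      frameVec X.metric (Y.ι y) v = s • ‖c.conormal y‖⁻¹ • c.conormal y := by
  have hp := c.ι_mem_source hy
  have hz := c.mem_closedBall_of_mem hy
  set g := X.metric
  set m := c.conormal y with hm
  have hdt : ∀ v, c.dt (c.ψ (c.θ y)) (toChart p (Y.ι y) v) =
    inner ℝ (frameVec g (Y.ι y) v) m := c.dt_toChart hy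
  have hm0 : m ≠ 0 := by
    intro h0
    obtain ⟨u, hu⟩ := c.exists_dt_ne_zero hz
    obtain ⟨v, rfl⟩ := toChart_surjective hp u
    apply hu
    rw [hdt, h0, inner_zero_right]
  have hmn : 0 < ‖m‖ := norm_pos_iff.2 hm0
  have hs0 : s * s = 1 := by rcases hs with rfl | rfl <;> norm_num
  -- the tangent vectors of the surface are the vectors orthogonal to the conormal
  have htan : ∀ η : E3, inner ℝ η m = 0 ↔ ∃ t : E2, frameVec g (Y.ι y)
      (mfderiv 𝓘(ℝ, E2) 𝓘(ℝ, E3) Y.ι y t : E3) = η := by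
    intro η
    have h1 := hdt (ofFrame g (Y.ι y) η)
    rw [frameVec_ofFrame] at h1
    rw [← h1, c.dt_eq_zero_iff_mfderiv hy]
    constructor
    · rintro ⟨t, ht⟩
      refine ⟨t, ?_⟩
      have h2 := toChart_injective hp ht
      have h3 := congrArg (fun a : E3 => frameVec g (Y.ι y) a) h2
      exact h3.trans (frameVec_ofFrame g _ η)
    · rintro ⟨t, rfl⟩
      exact ⟨t, congrArg (toChart p (Y.ι y)) (ofFrame_frameVec g (Y.ι y) _).symm⟩
  constructor
  · intro hv
    have hη : ∀ η, inner ℝ η m = 0 → inner ℝ (frameVec g (Y.ι y) v) η = 0 := by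
      intro η hη
      obtain ⟨t, rfl⟩ := (htan η).1 hη
      exact (inner_eq_frameVec g (Y.ι y) v _).symm.trans (hv.normal t)
    have h1 : inner ℝ (frameVec g (Y.ι y) v) (frameVec g (Y.ι y) v) = 1 :=
      (inner_eq_frameVec g (Y.ι y) v v).symm.trans hv.unit
    refine eq_smul_of_orthogonal hs hη h1 ?_
    by_contra hcon
    rcases (not_lt.1 hcon).lt_or_eq with hlt | heq
    · have hv' : 0 < (-s) * c.dt (c.ψ (c.θ y)) (toChart p (Y.ι y) v) := by
        rw [hdt]; linarith
      have h2 := c.eventually_outside (O := Y.inside)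
        (fun z hz t ht h => (hside z hz t ht).2 (by linarith)) hy hv'
      obtain ⟨t, ht1, ht2⟩ := (h2.and hv.points).exists
      exact disjoint_left.1 Y.disjoint ht2 ht1
    · have h2 : inner ℝ (frameVec g (Y.ι y) v) m = 0 := by
        have : s ≠ 0 := by rintro rfl; norm_num at hs0
        exact (mul_eq_zero.1 heq).resolve_left this
      rw [hη _ h2] at h1
      exact zero_ne_one h1
  · intro hν
    have hin : inner ℝ (frameVec g (Y.ι y) v) m = s * ‖m‖ := by
      rw [hν, inner_smul_left, inner_smul_left, real_inner_self_eq_norm_sq]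
      simp only [conj_trivial]
      field_simp
    refine ⟨?_, fun t => ?_, ?_⟩
    · refine (inner_eq_frameVec g (Y.ι y) v v).trans ?_
      rw [hν, inner_smul_left, inner_smul_right, inner_smul_left, inner_smul_right,
        real_inner_self_eq_norm_sq]
      simp only [conj_trivial]
      field_simp
      rw [sq, hs0]
    · refine (inner_eq_frameVec g (Y.ι y) v _).trans ?_
      have h2 := (htan _).2 ⟨t, rfl⟩
      rw [hν, inner_smul_left, inner_smul_left, real_inner_comm, h2]
      simp
    · refine c.eventually_outside (s := s) (fun z hz t ht => (hside z hz t ht).1) hy ?_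
      rw [show tangentToE3 v = v from rfl, hdt, hin, ← mul_assoc, hs0, one_mul]
      exact hmn

/-- Along a slice chart the unit normal is, up to a constant sign, the normalised conormal. -/
theorem exists_frameVec_unitNormal (hne : c.U.Nonempty) : ∃ s : ℝ, |s| = 1 ∧ ∀ y ∈ c.U,
    frameVec X.metric (Y.ι y) (unitNormal Y y) = s • ‖c.conormal y‖⁻¹ • c.conormal y := by
  obtain ⟨s, hs, hside⟩ := c.exists_side hne
  refine ⟨s, by rcases hs with rfl | rfl <;> simp, fun y hy => ?_⟩
  have hiff := c.isOutwardUnitNormal_iff hs hside hy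
  have hex : ∃ v, IsOutwardUnitNormal Y y v :=
    ⟨ofFrame X.metric (Y.ι y) (s • ‖c.conormal y‖⁻¹ • c.conormal y),
      (hiff _).2 (frameVec_ofFrame _ _ _)⟩
  have hn : unitNormal Y y = hex.choose := dif_pos hex
  exact (hiff (unitNormal Y y)).1 (hn ▸ hex.choose_spec)

end SliceChart

variable [SecondCountableTopology M] [Nonempty M] [IsManifold 𝓘(ℝ, E2) ∞ S]

theorem norm_frameVec_unitNormal_le (Y : SeparatingSurface X S) (y : S) :
    ‖frameVec X.metric (Y.ι y) (unitNormal Y y)‖ ≤ 1 := by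
  obtain ⟨s, hs, h⟩ := (sliceAt Y y).exists_frameVec_unitNormal ⟨y, mem_sliceAt_U Y y⟩
  rw [h y (mem_sliceAt_U Y y), norm_smul, norm_smul, Real.norm_eq_abs, hs, one_mul, norm_inv,
    norm_norm]
  exact inv_mul_le_one

variable [MeasurableSpace M] [BorelSpace M] [MeasurableSpace S] [BorelSpace S] [CompactSpace S]

theorem aemeasurable_unitNormal (Y : SeparatingSurface X S) (j : Fin 3) :
    AEMeasurable (fun y => frameVec X.metric (Y.ι y) (unitNormal Y y) j) (surfaceArea Y) := by
  obtain ⟨t, ht⟩ := exists_finset_sliceAt Y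
  rw [← Measure.restrict_univ (μ := surfaceArea Y), ← ht, aemeasurable_iUnion_iff]
  intro y
  set c := sliceAt Y (y : S)
  obtain ⟨s, -, hs⟩ := c.exists_frameVec_unitNormal ⟨y, mem_sliceAt_U Y y⟩
  have h1 := c.aemeasurable_conormal (surfaceArea Y)
  have h2 : AEMeasurable (fun y => ‖c.conormal y‖) ((surfaceArea Y).restrict c.U) := by
    simp only [EuclideanSpace.norm_eq, Fin.sum_univ_three, Real.norm_eq_abs, sq_abs]
    exact ((((h1 0).pow_const 2).add ((h1 1).pow_const 2)).add ((h1 2).pow_const 2)).sqrt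
  refine ((h2.inv.mul (h1 j)).const_mul s).congr ?_
  filter_upwards [self_mem_ae_restrict c.isOpen_U.measurableSet] with z hz
  rw [hs z hz]
  simp

end Normal

/-! ### Integrals of products of square integrable functions -/

section SmoothIntegrand

variable {S : Type*} [MeasurableSpace S] {μ : Measure S}
  {E : Type*} [NormedAddCommGroup E] [NormedSpace ℝ E]
  {F : Type*} [NormedAddCommGroup F] [NormedSpace ℝ F]
  {G : Type*} [NormedAddCommGroup G] [NormedSpace ℝ G]
  {H : Type*} [NormedAddCommGroup H] [NormedSpace ℝ H]

/-- Each member of the family `f` of functions on `S` is integrable, and its integral depends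
smoothly on the parameter. -/
structure SmoothIntegrand (μ : Measure S) (f : E → S → H) : Prop where
  integrable : ∀ Z, Integrable (f Z) μ
  contDiff : ContDiff ℝ ∞ fun Z => ∫ y, f Z y ∂μ

namespace SmoothIntegrand

theorem congr_ae {f f' : E → S → H} (h : SmoothIntegrand μ f) (hf : ∀ Z, f Z =ᵐ[μ] f' Z) :
    SmoothIntegrand μ f' where
  integrable Z := (h.integrable Z).congr (hf Z)
  contDiff := by
    convert h.contDiff using 2 with Z
    exact integral_congr_ae (hf Z).symm

theorem add {f f' : E → S → H} (h : SmoothIntegrand μ f) (h' : SmoothIntegrand μ f') :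
    SmoothIntegrand μ fun Z y => f Z y + f' Z y where
  integrable Z := (h.integrable Z).add (h'.integrable Z)
  contDiff := by
    convert h.contDiff.add h'.contDiff using 2 with Z
    exact integral_add (h.integrable Z) (h'.integrable Z)

theorem sub {f f' : E → S → H} (h : SmoothIntegrand μ f) (h' : SmoothIntegrand μ f') :
    SmoothIntegrand μ fun Z y => f Z y - f' Z y where
  integrable Z := (h.integrable Z).sub (h'.integrable Z)
  contDiff := by
    convert h.contDiff.sub h'.contDiff using 2 with Z
    exact integral_sub (h.integrable Z) (h'.integrable Z)

theorem sum {ι : Type*} (s : Finset ι) {f : ι → E → S → H} (h : ∀ i, SmoothIntegrand μ (f i)) :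
    SmoothIntegrand μ fun Z y => ∑ i ∈ s, f i Z y where
  integrable Z := integrable_finsetSum s fun i _ => (h i).integrable Z
  contDiff := by
    convert ContDiff.sum (s := s) fun i _ => (h i).contDiff using 2 with Z
    exact integral_finsetSum s fun i _ => (h i).integrable Z

/-- By the Hölder inequality a bounded bilinear expression with bounded measurable coefficient `a` in
two square integrable functions is integrable, and its integral is a bounded bilinear form in them. -/
theorem bilin [CompleteSpace H] {a : S → ℝ} (ha : MemLp a ∞ μ) (B : F →L[ℝ] G →L[ℝ] H)
    {T₁ : E → Lp F 2 μ} {T₂ : E → Lp G 2 μ} (h₁ : ContDiff ℝ ∞ T₁) (h₂ : ContDiff ℝ ∞ T₂) :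
    SmoothIntegrand μ fun Z y => a y • B (T₁ Z y) (T₂ Z y) := by
  let m : Lp F 2 μ →L[ℝ] Lp F 2 μ :=
    (ContinuousLinearMap.lsmul ℝ ℝ : ℝ →L[ℝ] F →L[ℝ] F).holderL μ ∞ 2 2 (ha.toLp a)
  have hm : ∀ t : Lp F 2 μ, ∀ᵐ y ∂μ, m t y = a y • t y := fun t => by
    filter_upwards [(ContinuousLinearMap.lsmul ℝ ℝ : ℝ →L[ℝ] F →L[ℝ] F).coeFn_holder (r := 2)
      (ha.toLp a) t, ha.coeFn_toLp] with y h h'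
    refine h.trans ?_
    rw [h']; rfl
  have hint : ∀ Z, (fun y => B (m (T₁ Z) y) (T₂ Z y)) =ᵐ[μ] fun y => a y • B (T₁ Z y) (T₂ Z y) :=
    fun Z => by
      filter_upwards [hm (T₁ Z)] with y h
      rw [h]; simp
  refine SmoothIntegrand.congr_ae ⟨fun Z => ?_, ?_⟩ hint
  · exact memLp_one_iff_integrable.1
      (B.memLp_of_bilin 1 (Lp.memLp (m (T₁ Z))) (Lp.memLp (T₂ Z)))
  · have : (fun Z => ∫ y, B (m (T₁ Z) y) (T₂ Z y) ∂μ) =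
        fun Z => B.lpPairing μ 2 2 (m (T₁ Z)) (T₂ Z) := by
      funext Z
      exact (B.lpPairing_eq_integral _ _).symm
    rw [this]
    exact ((B.lpPairing μ 2 2).contDiff.comp (m.contDiff.comp h₁)).clm_apply h₂

/-- On a finite measure space linear expressions are the case of `SmoothIntegrand.bilin` in which the
second function is the constant `1`. -/
theorem lin [IsFiniteMeasure μ] [CompleteSpace H] {a : S → ℝ} (ha : MemLp a ∞ μ)
    (L : F →L[ℝ] H) {T : E → Lp F 2 μ} (h : ContDiff ℝ ∞ T) :
    SmoothIntegrand μ fun Z y => a y • L (T Z y) := by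
  have h1 : MemLp (fun _ : S => (1 : ℝ)) 2 μ := memLp_const 1
  refine (bilin ha ((ContinuousLinearMap.lsmul ℝ ℝ : ℝ →L[ℝ] H →L[ℝ] H).flip.comp L) h
    (contDiff_const (c := h1.toLp _))).congr_ae fun Z => ?_
  filter_upwards [h1.coeFn_toLp] with y hy
  rw [hy]; simp

end SmoothIntegrand

end SmoothIntegrand

/-! ### The surface charges -/

section Charges

variable {M : Type*} [TopologicalSpace M] [ChartedSpace E3 M] [IsManifold 𝓘(ℝ, E3) ∞ M]
  [SecondCountableTopology M] [Nonempty M]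
  [MeasurableSpace M] [BorelSpace M] {X : AFBackground M}
  {S : Type*} [TopologicalSpace S] [ChartedSpace E2 S] [IsManifold 𝓘(ℝ, E2) ∞ S]
  [CompactSpace S] [MeasurableSpace S] [BorelSpace S] (Y : SeparatingSurface X S)
  {𝔤 : Type*} [LieRing 𝔤] [LieAlgebra ℝ 𝔤] (γ : InnerProductSpace.Core ℝ 𝔤)

instance [FiniteDimensional ℝ 𝔤] : FiniteDimensional ℝ (GaugeAlg γ) :=
  show FiniteDimensional ℝ 𝔤 from inferInstance

instance [FiniteDimensional ℝ 𝔤] : CompleteSpace (gaugeCenter γ) := FiniteDimensional.complete ℝ _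

instance [FiniteDimensional ℝ 𝔤] : CompleteSpace (gaugeCompl γ) := FiniteDimensional.complete ℝ _

theorem memLp_unitNormal (j : Fin 3) :
    MemLp (fun y => frameVec X.metric (Y.ι y) (unitNormal Y y) j) ∞ (surfaceArea Y) :=
  memLp_top_of_bound (aemeasurable_unitNormal Y j).aestronglyMeasurable 1
    (.of_forall fun y => (PiLp.norm_apply_le _ j).trans (norm_frameVec_unitNormal_le Y y))

theorem contDiff_surfaceTrace {V : Type*} [NormedAddCommGroup V] [NormedSpace ℝ V]
    [CompleteSpace V] {r s w k : ℕ} {P : Submodule ℝ (TComp r s V)} {δ : ℝ} (hk : 1 ≤ k) :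
    ContDiff ℝ ∞ fun f : sobolev X w P k δ => surfaceTrace Y f :=
  (traceOp w P Y δ hk).contDiff

theorem smoothIntegrand_chargeDensity :
    SmoothIntegrand (surfaceArea Y) (chargeDensity Y γ) := by
  have := isFiniteMeasure_surfaceArea Y
  have hε : ContDiff ℝ ∞ fun Z : PhaseAmbient X γ => surfaceTrace Y Z.2.2.2 :=
    (contDiff_surfaceTrace Y le_rfl).comp (contDiff_snd.comp (contDiff_snd.comp contDiff_snd))
  exact SmoothIntegrand.sum _ fun j => SmoothIntegrand.lin (memLp_unitNormal Y j)
    (PiLp.proj 2 (𝕜 := ℝ) (fun _ : TIdx 1 0 => StrongDual ℝ (GaugeAlg γ)) (![j], ![])) hε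

theorem smoothIntegrand_angularDensity [FiniteDimensional ℝ 𝔤] (χ : ∀ x : M, TangentSpace 𝓘(ℝ, E3) x)
    (hχ : MemLp (fun y => frameVec X.metric (Y.ι y) (χ (Y.ι y))) ∞ (surfaceArea Y)) :
    SmoothIntegrand (surfaceArea Y) (angularDensity Y γ χ) := by
  have := isFiniteMeasure_surfaceArea Y
  have hc : ∀ i, MemLp (fun y => frameVec X.metric (Y.ι y) (χ (Y.ι y)) i) ∞ (surfaceArea Y) :=
    fun i => (EuclideanSpace.proj (𝕜 := ℝ) i).comp_memLp' hχ
  have ha : ∀ (q : ℝ) i j, MemLp (fun y => q * (frameVec X.metric (Y.ι y) (χ (Y.ι y)) i *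
      frameVec X.metric (Y.ι y) (unitNormal Y y) j)) ∞ (surfaceArea Y) :=
    fun q i j => ((memLp_unitNormal Y j).mul (hc i)).const_mul q
  have hh : ContDiff ℝ ∞ fun Z : PhaseAmbient X γ => surfaceTrace Y Z.1 :=
    (contDiff_surfaceTrace Y one_le_two).comp contDiff_fst
  have hπ : ContDiff ℝ ∞ fun Z : PhaseAmbient X γ => surfaceTrace Y Z.2.1 :=
    (contDiff_surfaceTrace Y le_rfl).comp (contDiff_fst.comp contDiff_snd)
  have hz : ContDiff ℝ ∞ fun Z : PhaseAmbient X γ => surfaceTrace Y Z.2.2.1.1 :=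
    (contDiff_surfaceTrace Y one_le_two).comp
      (contDiff_fst.comp (contDiff_fst.comp (contDiff_snd.comp contDiff_snd)))
  have hκ : ContDiff ℝ ∞ fun Z : PhaseAmbient X γ => surfaceTrace Y Z.2.2.1.2 :=
    (contDiff_surfaceTrace Y one_le_two).comp
      (contDiff_snd.comp (contDiff_fst.comp (contDiff_snd.comp contDiff_snd)))
  have hε : ContDiff ℝ ∞ fun Z : PhaseAmbient X γ => surfaceTrace Y Z.2.2.2 :=
    (contDiff_surfaceTrace Y le_rfl).comp (contDiff_snd.comp (contDiff_snd.comp contDiff_snd))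
  let pπ := fun k j : Fin 3 => PiLp.proj 2 (𝕜 := ℝ) (fun _ : TIdx 2 0 => ℝ) (![k, j], ![])
  let ph := fun i k : Fin 3 => PiLp.proj 2 (𝕜 := ℝ) (fun _ : TIdx 0 2 => ℝ) (![], ![i, k])
  let pε := fun j : Fin 3 =>
    PiLp.proj 2 (𝕜 := ℝ) (fun _ : TIdx 1 0 => StrongDual ℝ (GaugeAlg γ)) (![j], ![])
  let pz := fun i : Fin 3 => (gaugeCenter γ).subtypeL.comp
    (PiLp.proj 2 (𝕜 := ℝ) (fun _ : TIdx 0 1 => gaugeCenter γ) (![], ![i]))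
  let pκ := fun i : Fin 3 => (gaugeCompl γ).subtypeL.comp
    (PiLp.proj 2 (𝕜 := ℝ) (fun _ : TIdx 0 1 => gaugeCompl γ) (![], ![i]))
  let D := ContinuousLinearMap.id ℝ (StrongDual ℝ (GaugeAlg γ))
  -- the terms are those from the expansion of `g = g̊ + h` and `A = A_𝔷 + A_𝔨`, with `ha` providing
  -- the bounded coefficients built from `χ` and the normal
  refine (SmoothIntegrand.sum Finset.univ fun j => ((SmoothIntegrand.sum Finset.univ fun i =>
    SmoothIntegrand.sum Finset.univ fun k =>
      (SmoothIntegrand.lin (ha (2 * if i = k then 1 else 0) i j) (pπ k j) hπ).add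
      (SmoothIntegrand.bilin (ha 2 i j)
        ((ContinuousLinearMap.mul ℝ ℝ).bilinearComp (ph i k) (pπ k j)) hh hπ)).sub
    (SmoothIntegrand.sum Finset.univ fun i =>
      (SmoothIntegrand.bilin (ha 1 i j) (D.bilinearComp (pε j) (pz i)) hε hz).add
      (SmoothIntegrand.bilin (ha 1 i j) (D.bilinearComp (pε j) (pκ i)) hε hκ)))).congr_ae
    fun Z => .of_forall fun y => ?_
  simp only [angularDensity]
  refine Finset.sum_congr rfl fun j _ => ?_
  rw [sub_mul]
  congr 1
  · rw [Finset.mul_sum, Finset.sum_mul]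
    refine Finset.sum_congr rfl fun i _ => ?_
    rw [Finset.mul_sum, Finset.mul_sum, Finset.sum_mul]
    refine Finset.sum_congr rfl fun k _ => ?_
    simp only [ContinuousLinearMap.bilinearComp_apply, ContinuousLinearMap.mul_apply', ph, pπ,
      PiLp.proj_apply, smul_eq_mul]
    ring
  · rw [Finset.sum_mul]
    refine Finset.sum_congr rfl fun i _ => ?_
    simp only [ContinuousLinearMap.bilinearComp_apply, D, pε, pz, pκ, ContinuousLinearMap.id_apply,
      PiLp.proj_apply, smul_eq_mul, ContinuousLinearMap.comp_apply, Submodule.subtypeL_apply,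
      map_add]
    ring

end Charges

end

theorem lemma1
    {M : Type*} [TopologicalSpace M] [ChartedSpace E3 M] [IsManifold 𝓘(ℝ, E3) ∞ M]
    [T2Space M] [SecondCountableTopology M] [ConnectedSpace M]
    [MeasurableSpace M] [BorelSpace M] (X : AFBackground M)
    {S : Type*} [TopologicalSpace S] [ChartedSpace E2 S] [IsManifold 𝓘(ℝ, E2) ∞ S]
    [CompactSpace S] [MeasurableSpace S] [BorelSpace S] (Y : SeparatingSurface X S)
    {𝔤 : Type*} [LieRing 𝔤] [LieAlgebra ℝ 𝔤] [FiniteDimensional ℝ 𝔤]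
    (γ : InnerProductSpace.Core ℝ 𝔤)
    (χ : ∀ x : M, TangentSpace 𝓘(ℝ, E3) x)
    (hχ : MemLp (fun y => frameVec X.metric (Y.ι y) (χ (Y.ι y))) ∞ (surfaceArea Y)) :
    (∀ Z ∈ phaseSpace X γ,
      ((∃! t, IsTrace Y Z.1 t) ∧ (∃! t, IsTrace Y Z.2.1 t) ∧ (∃! t, IsTrace Y Z.2.2.1.1 t) ∧
        (∃! t, IsTrace Y Z.2.2.1.2 t) ∧ (∃! t, IsTrace Y Z.2.2.2 t)) ∧
      Integrable (chargeDensity Y γ Z) (surfaceArea Y) ∧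
      Integrable (angularDensity Y γ χ Z) (surfaceArea Y)) ∧
    ContDiffOn ℝ ∞ (surfaceCharge Y γ) (phaseSpace X γ) ∧
    ContDiffOn ℝ ∞ (angularMomentum Y γ χ) (phaseSpace X γ) := by

  have hQ := smoothIntegrand_chargeDensity Y γ
  have hJ := smoothIntegrand_angularDensity Y γ χ hχ
  refine ⟨fun Z _ => ⟨⟨existsUnique_isTrace Y one_le_two _, existsUnique_isTrace Y le_rfl _,
    existsUnique_isTrace Y one_le_two _, existsUnique_isTrace Y one_le_two _,
    existsUnique_isTrace Y le_rfl _⟩, hQ.integrable Z, hJ.integrable Z⟩, ?_, ?_⟩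
  · exact (hQ.contDiff.const_smul _).contDiffOn
  · exact (contDiff_const.mul hJ.contDiff).contDiffOn
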